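/- **Theorem 2.2.** Let $\nu\in\mathbf N$, let $m_1\le m_2\le\dots\le m_{\nu+1}$ be natural numbers, let $n=m_1+\dots+m_\nu$, $m=m_{\nu+1}$, and let $t_0<t_1<T$. Consider the control system $\dot x=f(t,x,u)$, $t\in[t_0,T]$, with state $x=(x_1,\dots,x_\nu)\in\mathbf R^{m_1}\times\dots\times\mathbf R^{m_\nu}=\mathbf R^n$ and control $u=x_{\nu+1}\in\mathbf R^m$, whose right-hand side has the triangular form $$f(t,x,u)=\bigl(f_1(t,x_1,x_2),\,f_2(t,x_1,x_2,x_3),\,\dots,\,f_\nu(t,x_1,\dots,x_\nu,u)\bigr),\qquad f_i(t,x_1,\dots,x_{i+1})\in\mathbf R^{m_i}.$$ Assume: (I) $f$, $\partial f/\partial x$ and $\partial f/\partial u$ exist and are continuous on $[t_0,T]\times\mathbf R^n\times\mathbf R^m$. (II) For each $i=1,\dots,\nu$ and each $(t,x_1,\dots,x_i)\in[t_0,T]\times\mathbf R^{m_1}\times\dots\times\mathbf R^{m_i}$, the map $f_i(t,x_1,\dots,x_i,\cdot)$ is of class $C^{m_{i+1}-m_i+1}(\mathbf R^{m_{i+1}};\mathbf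 R^{m_i})$ and is onto $\mathbf R^{m_i}$. Let $x_i^*\in\mathbf R^{m_i}$ ($1\le i\le\nu+1$) and $z_i^*\in\mathbf R^{m_i}$ ($1\le i\le\nu$) satisfy $$z_i^*=f_i(t_1,x_1^*,\dots,x_{i+1}^*),\qquad \operatorname{rank}\frac{\partial f_i}{\partial x_{i+1}}(t_1,x_1^*,\dots,x_{i+1}^*)=m_i,\qquad i=1,\dots,\nu,$$ and let $z_{\nu+1}^*\in\mathbf R^{m_{\nu+1}}$ be arbitrary. Let $p\in\{1,\dots,\nu\}$, $k=m_1+\dots+m_p$, $y^*=(x_1^*,\dots,x_p^*)\in\mathbf R^k$, $J=[t_1,T]$, and consider the $k$-dimensional control system $$\dot y(t)=\varphi(t,y(t),v(t)),\quad t\in J,\qquad \varphi(t,x_1,\dots,x_p,v)=\bigl(f_1(t,x_1,x_2),\dots,f_{p-1}(t,x_1,\dots,x_p),\,f_p(t,x_1,\dots,x_p,v)\bigr),\tag{$*$}$$ with state $y=(x_1,\dots,x_p)\in\mathbf R^k$ and control $v\in\mathbf R^{m_{p+1}}$. Suppose that there is a family $\{y(\xi,\cdot)=(x_1(\xi,\cdot),\dots,x_p(\xi,\cdot))\}_{\xi\in\mathbf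 R^k}$ of functions $J\to\mathbf R^k$ such that: 1) for each $i=1,\dots,p$ the map $\xi\mapsto x_i(\xi,\cdot)$ is of class $C(\mathbf R^k;C^1(J;\mathbf R^{m_i}))$; 2) for each $\xi\in\mathbf R^k$, $\dot x_i(\xi,t)=f_i(t,x_1(\xi,t),\dots,x_{i+1}(\xi,t))$ for all $1\le i\le p-1$ and $t\in J$; 3) for each $\xi\in\mathbf R^k$, $y(\xi,t_1)=y^*$, $y(\xi,T)=\xi$ and $\dot x_p(\xi,t_1)=z_p^*$. Then there is a family of controls $\{\hat v_{(\xi,\beta)}\}_{(\xi,\beta)\in\mathbf R^k\times\mathbf R^{m_{p+1}}}$ such that: 4) the map $(\xi,\beta)\mapsto\hat v_{(\xi,\beta)}$ is of class $C(\mathbf R^k\times\mathbf R^{m_{p+1}};C^1(J;\mathbf R^{m_{p+1}}))$; 5) for each $(\xi,\beta)$, $\hat v_{(\xi,\beta)}(T)=\beta$, $\hat v_{(\xi,\beta)}(t_1)=x_{p+1}^*$ and $\frac{d}{dt}\hat v_{(\xi,\beta)}(t_1)=z_{p+1}^*$; 6) for each $(\xi,\beta)$, the trajectory of $(*)$ with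 control $\hat v_{(\xi,\beta)}$ that starts at $y^*$ at time $t_1$ is defined on all of $J$ and equals $\xi$ at time $T$. -/

import Mathlib

open Set Filter Topology

namespace TriangularControl

/-- The `i`-th block space `ℝ^{m i}`, with the Euclidean norm.  Blocks are numbered from `0`, so that
`Block m 0` is the space of the block usually written `x₁`. -/
abbrev Block (m : ℕ → ℕ) (i : ℕ) : Type := EuclideanSpace ℝ (Fin (m i))

/-- Tuples of the first `r` blocks: `ℝ^{m 0} × ⋯ × ℝ^{m (r-1)}`, i.e. `ℝ^{m 0 + ⋯ + m (r-1)}`.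
Only the topology and the linear structure of this finite-dimensional space are used. -/
abbrev State (m : ℕ → ℕ) (r : ℕ) : Type := (i : Fin r) → Block m i

/-- The first `r` blocks of a tuple of `s ≥ r` blocks. -/
def trunc {m : ℕ → ℕ} {r s : ℕ} (h : r ≤ s) (x : State m s) : State m r :=
  fun j => x (Fin.castLE h j)

/-- The tuple `(x, v)`: one more block is appended to a tuple of `r` blocks. -/
def extend {m : ℕ → ℕ} {r : ℕ} (x : State m r) (v : Block m r) : State m (r + 1) :=
  Fin.snoc (α := fun j : Fin (r + 1) => Block m j) x v

/-- The triangular right-hand side with `r` blocks built from the components `f i`, where `f i`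
depends on `t` and on the blocks `0, …, i + 1` only: its `i`-th block is `f i (t, x₀, …, x_{i+1})`,
and the role of block number `r` is played by the control `v`. -/
def field {m : ℕ → ℕ} (f : (i : ℕ) → ℝ → State m (i + 2) → Block m i) (r : ℕ)
    (t : ℝ) (y : State m r) (v : Block m r) : State m r :=
  fun i => f i t (trunc (by have := i.2; omega) (extend y v))

/-- The full right-hand side (with `ν` blocks) and its partial derivatives with respect to the
state and the control exist and are continuous in `(t, x, u)`, `t ∈ [t₀, T]`. -/
structure RegularField {m : ℕ → ℕ} (ν : ℕ) (f : (i : ℕ) → ℝ → State m (i + 2) → Block m i)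
    (t₀ T : ℝ) : Prop where
  continuousOn :
    ContinuousOn (fun q : ℝ × State m ν × Block m ν => field f ν q.1 q.2.1 q.2.2)
      (Icc t₀ T ×ˢ univ)
  differentiable_state : ∀ t ∈ Icc t₀ T, ∀ (x : State m ν) (u : Block m ν),
    DifferentiableAt ℝ (fun x' => field f ν t x' u) x
  continuousOn_fderiv_state :
    ContinuousOn (fun q : ℝ × State m ν × Block m ν =>
      fderiv ℝ (fun x' => field f ν q.1 x' q.2.2) q.2.1) (Icc t₀ T ×ˢ univ)
  differentiable_control : ∀ t ∈ Icc t₀ T, ∀ (x : State m ν) (u : Block m ν),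
    DifferentiableAt ℝ (fun u' => field f ν t x u') u
  continuousOn_fderiv_control :
    ContinuousOn (fun q : ℝ × State m ν × Block m ν =>
      fderiv ℝ (fun u' => field f ν q.1 q.2.1 u') q.2.2) (Icc t₀ T ×ˢ univ)

/-- Each `f i (t, x₀, …, x_i, ·)` is of class `C^{m (i+1) - m i + 1}` and maps `ℝ^{m (i+1)}` onto
`ℝ^{m i}`. -/
def SurjectiveBlocks {m : ℕ → ℕ} (ν : ℕ) (f : (i : ℕ) → ℝ → State m (i + 2) → Block m i)
    (t₀ T : ℝ) : Prop :=
  ∀ i < ν, ∀ t ∈ Icc t₀ T, ∀ x : State m (i + 1),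
    ContDiff ℝ ((m (i + 1) - m i + 1 : ℕ) : WithTop ℕ∞) (fun v => f i t (extend x v)) ∧
    Function.Surjective (fun v : Block m (i + 1) => f i t (extend x v))

/-- `ξ ↦ g ξ` is a continuous map into the Banach space `C¹([a, b]; E)`: every `g ξ` is `C¹` on
`[a, b]` (one-sided derivatives at the end points), and `g ξ → g ξ₀`, `(g ξ)' → (g ξ₀)'` uniformly
on `[a, b]` as `ξ → ξ₀`. -/
structure ContinuousC1Family {X E : Type*} [TopologicalSpace X] [NormedAddCommGroup E]
    [NormedSpace ℝ E] (a b : ℝ) (g : X → ℝ → E) : Prop where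
  contDiffOn : ∀ ξ, ContDiffOn ℝ 1 (g ξ) (Icc a b)
  tendsto : ∀ ξ₀, TendstoUniformlyOn g (g ξ₀) (𝓝 ξ₀) (Icc a b)
  tendsto_deriv : ∀ ξ₀, TendstoUniformlyOn (fun ξ => derivWithin (g ξ) (Icc a b))
    (derivWithin (g ξ₀) (Icc a b)) (𝓝 ξ₀) (Icc a b)

/-- `y` is a trajectory, defined on the whole of `[a, b]`, of the system with right-hand side
`field f r` and (continuous) control `v`, and `y` starts at `y₀` at time `a`. -/
structure IsTrajectory {m : ℕ → ℕ} (f : (i : ℕ) → ℝ → State m (i + 2) → Block m i) (r : ℕ)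
    (a b : ℝ) (y₀ : State m r) (v : ℝ → Block m r) (y : ℝ → State m r) : Prop where
  initial : y a = y₀
  ode : ∀ t ∈ Icc a b, HasDerivWithinAt y (field f r t (y t) (v t)) (Icc a b) t

end TriangularControl

/-! The curves `y ξ` already solve every equation of the truncated system except the last one, so
the control only has to remove the defect of that last equation, namely its right-hand side along `y
ξ` minus the velocity of the last block. Surjectivity need not provide a continuous choice of
control values at which the defect vanishes, but it makes the defect vanish on average. The values
of a surjective map surround the origin, finitely many of them do so robustly, and hence `0` is a
convex combination of values taken at points of a fixed countable dense set, with weights that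
partitions of unity make continuous in the parameter and in time (`exists_surrounding`,
`exists_relaxed_weights`). A control that visits these points in rapid succession, for times
proportional to the weights, produces a defect with uniformly small integrals (`exists_chattering`).
By Grönwall's lemma (`exists_solution_near`), the solution that ends at `ξ` at time `T` then follows
`y ξ` backwards, as closely as desired, down to a time `t₁ + δ ξ` (`exists_backward_control`). The
conditions at `T` hold exactly; the whole error sits at `t₁ + δ ξ`.

This error is absorbed on `[t₁, t₁ + δ]`, where the rank condition acts. Write the solution as `y`
plus a displacement whose block `j`, numbered from `0`, is `δ ^ (p - j) • X j`, and take `s = (t -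
t₁) / δ` as time. Each block is driven to leading order by the next one, and this scaling balances
the two sides, so on `[0, 1]` the system for `X` is a small Lipschitz perturbation of a chain `X j'
= B j (X (j + 1))` with surjective `B j` (`RegularField.exists_linear_chain`). The negative powers
of `δ` do no harm because `y` solves the earlier equations exactly. The chain is steered explicitly
by derivatives of cut-off monomials (`exists_chain_curves`), and a contraction argument carries this
over to the perturbed system, with coefficients continuous in the parameters (`exists_steering`,
`RegularField.exists_local_steering`).

The steering term vanishes for `s < 1/3` and for `s ≥ 1`. Near `t₁` the control is therefore the
affine function with the prescribed value and velocity, and after `t₁ + δ` it is the blended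
chattering control. The small quantities `δ` and the chattering period are chosen as continuous
positive functions, again by partitions of unity, so the control is jointly `C¹`. Uniqueness of
solutions turns the constructed trajectory into a statement about every trajectory. -/

namespace TriangularControl

/-! ### Approximate solutions, uniqueness and continuous dependence for ordinary differential
equations. -/

section ODE

open Metric MeasureTheory
open scoped NNReal

variable {E : Type*} [NormedAddCommGroup E] [NormedSpace ℝ E]

/-- The radial retraction of a normed space onto the closed ball of radius `ρ` around `0`. -/
noncomputable def radialClamp (ρ : ℝ) (x : E) : E := (ρ / max ρ ‖x‖) • x

theorem radialClamp_of_norm_le {ρ : ℝ} (hρ : 0 < ρ) {x : E} (hx : ‖x‖ ≤ ρ) :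
    radialClamp ρ x = x := by
  rw [radialClamp, max_eq_left hx, div_self hρ.ne', one_smul]

theorem norm_radialClamp_le_norm {ρ : ℝ} (hρ : 0 < ρ) (x : E) : ‖radialClamp ρ x‖ ≤ ‖x‖ := by
  have h : 0 < max ρ ‖x‖ := lt_max_of_lt_left hρ
  rw [radialClamp, norm_smul, Real.norm_of_nonneg (by positivity)]
  exact mul_le_of_le_one_left (norm_nonneg _) ((div_le_one h).2 (le_max_left _ _))

theorem norm_radialClamp_le {ρ : ℝ} (hρ : 0 < ρ) (x : E) : ‖radialClamp ρ x‖ ≤ ρ := by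
  have h : 0 < max ρ ‖x‖ := lt_max_of_lt_left hρ
  rw [radialClamp, norm_smul, Real.norm_of_nonneg (by positivity), div_mul_eq_mul_div,
    div_le_iff₀ h]
  exact mul_le_mul_of_nonneg_left (le_max_right _ _) hρ.le

/-- Split the difference into a common contraction of `x - y` and a change of the contraction factor
applied to `y`. Each part has norm at most `‖x - y‖`, the second because `t ↦ max ρ t` is
1-Lipschitz; hence the constant 2, valid in every normed space. -/
theorem lipschitzWith_radialClamp {ρ : ℝ} (hρ : 0 < ρ) :
    LipschitzWith 2 (radialClamp ρ : E → E) := by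
  refine LipschitzWith.of_dist_le_mul fun x y => ?_
  rw [dist_eq_norm, dist_eq_norm]
  have hx : 0 < max ρ ‖x‖ := lt_max_of_lt_left hρ
  have hy : 0 < max ρ ‖y‖ := lt_max_of_lt_left hρ
  have hd : |ρ / max ρ ‖x‖ - ρ / max ρ ‖y‖| * ‖y‖ ≤ ‖x - y‖ := by
    have h1 : ρ / max ρ ‖x‖ - ρ / max ρ ‖y‖
        = ρ / max ρ ‖x‖ * ((max ρ ‖y‖ - max ρ ‖x‖) / max ρ ‖y‖) := by
      field_simp
    have h2 : |max ρ ‖y‖ - max ρ ‖x‖| ≤ ‖x - y‖ := by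
      calc |max ρ ‖y‖ - max ρ ‖x‖| ≤ |‖y‖ - ‖x‖| := by
            rw [max_comm ρ ‖y‖, max_comm ρ ‖x‖]
            exact abs_max_sub_max_le_abs _ _ _
        _ ≤ ‖x - y‖ := by rw [abs_sub_comm]; exact abs_norm_sub_norm_le x y
    rw [h1, abs_mul, abs_of_pos (by positivity : 0 < ρ / max ρ ‖x‖), abs_div _ (max ρ ‖y‖),
      abs_of_pos hy]
    calc ρ / max ρ ‖x‖ * (|max ρ ‖y‖ - max ρ ‖x‖| / max ρ ‖y‖) * ‖y‖
        = ρ / max ρ ‖x‖ * |max ρ ‖y‖ - max ρ ‖x‖| * (‖y‖ / max ρ ‖y‖) := by ring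
      _ ≤ 1 * ‖x - y‖ * 1 := by
          gcongr
          · exact (div_le_one hx).2 (le_max_left _ _)
          · exact (div_le_one hy).2 (le_max_right _ _)
      _ = ‖x - y‖ := by ring
  have h3 : radialClamp ρ x - radialClamp ρ y
      = (ρ / max ρ ‖x‖) • (x - y) + (ρ / max ρ ‖x‖ - ρ / max ρ ‖y‖) • y := by
    simp only [radialClamp, smul_sub, sub_smul]; abel
  have h4 : ‖(ρ / max ρ ‖x‖) • (x - y)‖ ≤ ‖x - y‖ := by
    rw [norm_smul, Real.norm_of_nonneg (by positivity)]
    exact mul_le_of_le_one_left (norm_nonneg _) ((div_le_one hx).2 (le_max_left _ _))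
  rw [h3]
  refine (norm_add_le _ _).trans ?_
  rw [norm_smul (_ - _), Real.norm_eq_abs]
  push_cast
  linarith

/-- Grönwall's lemma in integral form for approximate solutions: if `z` solves the integral equation
up to `ε` then a genuine solution exists and stays close to `z`. -/
theorem exists_solution_near [CompleteSpace E] {a b : ℝ} (hab : a ≤ b) {F : ℝ → E → E}
    (hF : ContinuousOn (Function.uncurry F) (Icc a b ×ˢ univ)) {z : ℝ → E}
    (hz : ContinuousOn z (Icc a b)) {x₀ : E} {L : ℝ≥0} {ρ ε : ℝ} (hρ : 0 < ρ)
    (hL : ∀ t ∈ Icc a b, LipschitzOnWith L (F t) (closedBall (z t) ρ))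
    (hε : ∀ t ∈ Icc a b, ‖z t - x₀ - ∫ s in a..t, F s (z s)‖ ≤ ε)
    (hεL : ε * Real.exp (L * (b - a)) ≤ ρ) :
    ∃ x : ℝ → E, x a = x₀ ∧
      (∀ t ∈ Icc a b, HasDerivWithinAt x (F t (x t)) (Icc a b) t) ∧
      ∀ t ∈ Icc a b, ‖x t - z t‖ ≤ ε * Real.exp (L * (b - a)) := by
  have ha : a ∈ Icc a b := left_mem_Icc.2 hab
  have hε0 : 0 ≤ ε := (norm_nonneg _).trans (hε a ha)
  set q : E → E := radialClamp ρ with hq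
  -- Clamping the argument to the tube of radius `ρ` around `z` makes the field bounded and globally
  -- Lipschitz, so that a solution exists on all of `[a, b]`. The estimate below shows afterwards
  -- that the clamp was never active.
  set G : ℝ → E → E := fun t x => F t (z t + q (x - z t)) with hG
  have hmem : ∀ t x, z t + q (x - z t) ∈ closedBall (z t) ρ := fun t x => by
    rw [mem_closedBall_iff_norm, add_sub_cancel_left]; exact norm_radialClamp_le hρ _
  have hFz : ContinuousOn (fun t => F t (z t)) (Icc a b) :=
    hF.comp (continuousOn_id.prodMk hz) fun t ht => ⟨ht, mem_univ _⟩
  obtain ⟨C, hC⟩ := isCompact_Icc.exists_bound_of_continuousOn hFz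
  -- The clamp does not increase norms, so comparison with the centre `z t` costs only `L`, not the
  -- Lipschitz constant `2 * L` of `G t`.
  have hGz : ∀ t ∈ Icc a b, ∀ x, ‖G t x - F t (z t)‖ ≤ L * ‖x - z t‖ ∧
      ‖G t x - F t (z t)‖ ≤ L * ρ := by
    intro t ht x
    have h := (hL t ht).norm_sub_le (hmem t x) (mem_closedBall_self hρ.le)
    rw [add_sub_cancel_left] at h
    exact ⟨h.trans (mul_le_mul_of_nonneg_left (norm_radialClamp_le_norm hρ _) L.2),
      h.trans (mul_le_mul_of_nonneg_left (norm_radialClamp_le hρ _) L.2)⟩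
  have hC0 : 0 ≤ C := (norm_nonneg _).trans (hC a ha)
  set M : ℝ≥0 := ⟨C, hC0⟩ + L * ⟨ρ, hρ.le⟩ with hM
  have hGM : ∀ t ∈ Icc a b, ∀ x, ‖G t x‖ ≤ M := by
    intro t ht x
    have h := norm_add_le (G t x - F t (z t)) (F t (z t))
    rw [sub_add_cancel] at h
    have h1 := (hGz t ht x).2
    have h2 := hC t ht
    have h3 : (M : ℝ) = C + L * ρ := rfl
    linarith
  have hba : 0 ≤ b - a := sub_nonneg.2 hab
  have hPL : IsPicardLindelof G (⟨a, ha⟩ : Icc a b) x₀ (M * ⟨b - a, hba⟩) 0 M (L * 2) := by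
    refine ⟨fun t ht => ?_, fun x _ => ?_, fun t ht x _ => hGM t ht x, ?_⟩
    · refine LipschitzWith.lipschitzOnWith ?_
      refine LipschitzWith.of_dist_le_mul fun x x' => ?_
      have h := (hL t ht).dist_le_mul _ (hmem t x) _ (hmem t x')
      refine h.trans ?_
      have h2 := (lipschitzWith_radialClamp (E := E) hρ).dist_le_mul (x - z t) (x' - z t)
      rw [dist_add_left]
      rw [dist_sub_right] at h2
      push_cast at h2 ⊢
      rw [mul_assoc]
      exact mul_le_mul_of_nonneg_left h2 L.2
    · refine hF.comp (continuousOn_id.prodMk (hz.add ?_)) fun t ht => ⟨ht, mem_univ _⟩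
      exact (lipschitzWith_radialClamp hρ).continuous.comp_continuousOn (continuousOn_const.sub hz)
    · have h : ((M * ⟨b - a, hba⟩ : ℝ≥0) : ℝ) = M * (b - a) := rfl
      simp [h, hba]
  obtain ⟨x, hxa, hx⟩ := hPL.exists_eq_forall_mem_Icc_hasDerivWithinAt₀
  have hxa' : x a = x₀ := hxa
  have hzx : ContinuousOn x (Icc a b) := fun t ht => (hx t ht).continuousWithinAt
  -- Grönwall needs a differentiable comparison curve, and `z` is only continuous. The integral
  -- curve `Z` lies within `ε` of `z`. Grönwall gives `‖x - Z‖ ≤ ε (exp - 1)`, and the missing `ε`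
  -- comes from `Z - z`.
  set Z : ℝ → E := fun t => x₀ + ∫ s in a..t, F s (z s) with hZ
  have hZd : ∀ t ∈ Icc a b, HasDerivWithinAt Z (F t (z t)) (Icc a b) t := by
    intro t ht
    have h := ODE.hasDerivWithinAt_picard_Icc (f := fun s (_ : E) => F s (z s)) (u := univ)
      (α := z) (tmin := a) (tmax := b) (t₀ := a) ha
      (hFz.comp continuousOn_fst fun q hq => hq.1) hz (fun _ _ => mem_univ _) x₀ ht
    exact h
  have hclose : ∀ t ∈ Icc a b, ‖x t - Z t‖ ≤ gronwallBound 0 L (L * ε) (t - a) := by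
    refine norm_le_gronwallBound_of_norm_deriv_right_le
      (f' := fun t => G t (x t) - F t (z t)) ?_ ?_ ?_ ?_
    · exact hzx.sub fun t ht => (hZd t ht).continuousWithinAt
    · intro t ht
      exact ((hx t (Ico_subset_Icc_self ht)).sub (hZd t (Ico_subset_Icc_self ht))).mono_of_mem_nhdsWithin
        (Icc_mem_nhdsGE_of_mem ht)
    · simp [hZ, hxa']
    · intro t ht
      have ht' := Ico_subset_Icc_self ht
      refine (hGz t ht' _).1.trans ?_
      have h1 : ‖x t - z t‖ ≤ ‖x t - Z t‖ + ε := by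
        have h2 := hε t ht'
        have h3 : x t - z t = (x t - Z t) - (z t - x₀ - ∫ s in a..t, F s (z s)) := by
          simp only [hZ]; abel
        rw [h3]
        exact (norm_sub_le _ _).trans (by gcongr)
      rw [← mul_add]
      exact mul_le_mul_of_nonneg_left h1 L.2
  have hgb : ∀ t ∈ Icc a b, gronwallBound 0 L (L * ε) (t - a) + ε ≤ ε * Real.exp (L * (b - a)) := by
    intro t ht
    have hexp : Real.exp (L * (t - a)) ≤ Real.exp (L * (b - a)) := by
      have := ht.2
      gcongr
    have h0 : gronwallBound 0 (L : ℝ) (L * ε) (t - a) = ε * (Real.exp (L * (t - a)) - 1) := by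
      by_cases hL0 : (L : ℝ) = 0
      · simp [hL0, gronwallBound_K0]
      · rw [gronwallBound_of_K_ne_0 hL0]
        field_simp
        ring
    rw [h0]
    nlinarith
  have hfin : ∀ t ∈ Icc a b, ‖x t - z t‖ ≤ ε * Real.exp (L * (b - a)) := by
    intro t ht
    have h3 : x t - z t = (x t - Z t) - (z t - x₀ - ∫ s in a..t, F s (z s)) := by
      simp only [hZ]; abel
    rw [h3]
    exact (norm_sub_le _ _).trans ((add_le_add (hclose t ht) (hε t ht)).trans (hgb t ht))
  refine ⟨x, hxa', fun t ht => ?_, hfin⟩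
  have h := hx t ht
  have h1 : G t (x t) = F t (x t) := by
    simp only [hG, hq]
    rw [radialClamp_of_norm_le hρ ((hfin t ht).trans hεL), add_sub_cancel]
  rwa [h1] at h

/-- Uniqueness for the initial value problem with a right-hand side that is Lipschitz on bounded
sets. -/
theorem solution_unique {a b : ℝ} {F : ℝ → E → E}
    (hF : ∀ R : ℝ, ∃ L : ℝ≥0, ∀ t ∈ Icc a b, LipschitzOnWith L (F t) (closedBall 0 R))
    {x x' : ℝ → E}
    (hx : ∀ t ∈ Icc a b, HasDerivWithinAt x (F t (x t)) (Icc a b) t)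
    (hx' : ∀ t ∈ Icc a b, HasDerivWithinAt x' (F t (x' t)) (Icc a b) t)
    (h0 : x a = x' a) : EqOn x x' (Icc a b) := by
  have hc : ContinuousOn x (Icc a b) := fun t ht => (hx t ht).continuousWithinAt
  have hc' : ContinuousOn x' (Icc a b) := fun t ht => (hx' t ht).continuousWithinAt
  obtain ⟨C, hC⟩ := isCompact_Icc.exists_bound_of_continuousOn hc
  obtain ⟨C', hC'⟩ := isCompact_Icc.exists_bound_of_continuousOn hc'
  obtain ⟨L, hL⟩ := hF (max C C')
  refine ODE_solution_unique_of_mem_Icc_right (v := F) (s := fun _ => closedBall 0 (max C C'))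
    (K := L) (fun t ht => hL t (Ico_subset_Icc_self ht)) hc ?_ ?_ hc' ?_ ?_ h0
  · exact fun t ht => (hx t (Ico_subset_Icc_self ht)).mono_of_mem_nhdsWithin
      (Icc_mem_nhdsGE_of_mem ht)
  · exact fun t ht => mem_closedBall_zero_iff.2
      ((hC t (Ico_subset_Icc_self ht)).trans (le_max_left _ _))
  · exact fun t ht => (hx' t (Ico_subset_Icc_self ht)).mono_of_mem_nhdsWithin
      (Icc_mem_nhdsGE_of_mem ht)
  · exact fun t ht => mem_closedBall_zero_iff.2
      ((hC' t (Ico_subset_Icc_self ht)).trans (le_max_right _ _))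

/-- A solution satisfies the integral equation. -/
theorem solution_eq_integral [CompleteSpace E] {a b : ℝ} {F : ℝ → E → E}
    (hF : ContinuousOn (Function.uncurry F) (Icc a b ×ˢ univ)) {x : ℝ → E}
    (hx : ∀ t ∈ Icc a b, HasDerivWithinAt x (F t (x t)) (Icc a b) t) {t : ℝ}
    (ht : t ∈ Icc a b) : x t - x a = ∫ s in a..t, F s (x s) := by
  have hc : ContinuousOn x (Icc a b) := fun t ht => (hx t ht).continuousWithinAt
  have hsub : Icc a t ⊆ Icc a b := Icc_subset_Icc_right ht.2
  symm
  refine intervalIntegral.integral_eq_sub_of_hasDerivAt_of_le ht.1 (hc.mono hsub) ?_ ?_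
  · exact fun s hs => (hx s ⟨hs.1.le, hs.2.le.trans ht.2⟩).hasDerivAt
      (Icc_mem_nhds hs.1 (hs.2.trans_le ht.2))
  · refine ContinuousOn.intervalIntegrable ?_
    rw [uIcc_of_le ht.1]
    exact (hF.comp (continuousOn_id.prodMk hc) fun t ht => ⟨ht, mem_univ _⟩).mono hsub

/-- The endpoint of a solution depends continuously on parameters. -/
theorem continuous_solution_endpoint [CompleteSpace E] {P : Type*} [TopologicalSpace P]
    {a b : ℝ} (hab : a ≤ b) {F : P → ℝ → E → E}
    (hF : ContinuousOn (fun q : P × ℝ × E => F q.1 q.2.1 q.2.2) (univ ×ˢ Icc a b ×ˢ univ))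
    (hlip : ∀ p₀, ∀ R : ℝ, ∃ L : ℝ≥0, ∀ᶠ p in 𝓝 p₀,
      ∀ t ∈ Icc a b, LipschitzOnWith L (F p t) (closedBall 0 R))
    {x₀ : P → E} (hx₀ : Continuous x₀) {x : P → ℝ → E} (hxa : ∀ p, x p a = x₀ p)
    (hx : ∀ p, ∀ t ∈ Icc a b, HasDerivWithinAt (x p) (F p t (x p t)) (Icc a b) t) :
    Continuous fun p => x p b := by
  have hFp : ∀ p, ContinuousOn (Function.uncurry (F p)) (Icc a b ×ˢ univ) := fun p =>
    hF.comp (f := fun q : ℝ × E => (p, q)) (by fun_prop) fun q hq => ⟨mem_univ _, hq⟩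
  have hc : ∀ p, ContinuousOn (x p) (Icc a b) := fun p t ht => (hx p t ht).continuousWithinAt
  refine continuous_iff_continuousAt.2 fun p₀ => ?_
  obtain ⟨C, hC⟩ := isCompact_Icc.exists_bound_of_continuousOn (hc p₀)
  obtain ⟨L, hL⟩ := hlip p₀ (C + 1)
  rw [Metric.continuousAt_iff']
  intro ε hε
  set e := Real.exp (L * (b - a)) with he
  have he0 : 0 < e := Real.exp_pos _
  have hba : 0 ≤ b - a := sub_nonneg.2 hab
  -- The solution at `p₀` solves the equation at `p` up to `η + η * (b - a)`: one `η` from the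
  -- initial value, the rest from the field. After multiplication by the Grönwall factor this must
  -- stay below both the tube radius `1` and `ε`.
  set η : ℝ := min 1 (ε / 2) / e / (1 + (b - a)) / 2 with hη
  have hη0 : 0 < η := by positivity
  have hunif : ∀ᶠ p in 𝓝 p₀, ∀ t ∈ Icc a b, ‖F p t (x p₀ t) - F p₀ t (x p₀ t)‖ < η := by
    have h1 : ContinuousOn (Function.uncurry fun (p : P) (t : ℝ) => F p t (x p₀ t))
        (univ ×ˢ Icc a b) :=
      hF.comp (f := fun q : P × ℝ => (q.1, q.2, x p₀ q.2))
        (continuousOn_fst.prodMk (continuousOn_snd.prodMk ((hc p₀).comp continuousOn_snd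
          fun q hq => hq.2))) fun q hq => ⟨mem_univ _, hq.2, mem_univ _⟩
    obtain ⟨v, hv, hv'⟩ := isCompact_Icc.mem_uniformity_of_prod h1 (mem_univ p₀)
      (Metric.dist_mem_uniformity hη0)
    rw [nhdsWithin_univ] at hv
    filter_upwards [hv] with p hp t ht
    have := hv' p hp t ht
    rwa [mem_ofPred_eq, dist_eq_norm] at this
  have hinit : ∀ᶠ p in 𝓝 p₀, ‖x₀ p - x₀ p₀‖ < η := by
    have := Metric.continuousAt_iff'.1 (hx₀.continuousAt (x := p₀)) η hη0
    simpa only [dist_eq_norm] using this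
  filter_upwards [hL, hunif, hinit] with p hpL hpu hpi
  have hη1 : (η + η * (b - a)) * e = min 1 (ε / 2) / 2 := by
    rw [hη]; field_simp
  have hm1 : min 1 (ε / 2) ≤ 1 := min_le_left _ _
  have hm2 : min 1 (ε / 2) ≤ ε / 2 := min_le_right _ _
  have hball : ∀ t ∈ Icc a b, closedBall (x p₀ t) 1 ⊆ closedBall 0 (C + 1) := by
    intro t ht v hv
    rw [mem_closedBall_iff_norm] at hv
    rw [mem_closedBall_zero_iff]
    have h1 := norm_add_le (v - x p₀ t) (x p₀ t)
    rw [sub_add_cancel] at h1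
    have := hC t ht
    linarith
  have herr : ∀ t ∈ Icc a b, ‖x p₀ t - x₀ p - ∫ s in a..t, F p s (x p₀ s)‖
      ≤ η + η * (b - a) := by
    intro t ht
    have hi : ∀ p, IntervalIntegrable (fun s => F p s (x p₀ s)) volume a t := fun p => by
      refine ContinuousOn.intervalIntegrable ?_
      rw [uIcc_of_le ht.1]
      exact ((hFp p).comp (continuousOn_id.prodMk (hc p₀)) fun t ht => ⟨ht, mem_univ _⟩).mono
        (Icc_subset_Icc_right ht.2)
    have h1 : x p₀ t - x₀ p - ∫ s in a..t, F p s (x p₀ s)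
        = -(x₀ p - x₀ p₀) - ∫ s in a..t, (F p s (x p₀ s) - F p₀ s (x p₀ s)) := by
      rw [intervalIntegral.integral_sub (hi p) (hi p₀), ← solution_eq_integral (hFp p₀) (hx p₀) ht,
        hxa]
      abel
    have h2 : ‖∫ s in a..t, (F p s (x p₀ s) - F p₀ s (x p₀ s))‖ ≤ η * |t - a| := by
      refine intervalIntegral.norm_integral_le_of_norm_le_const fun s hs => ?_
      rw [uIoc_of_le ht.1] at hs
      exact (hpu s ⟨hs.1.le, hs.2.trans ht.2⟩).le
    rw [abs_of_nonneg (sub_nonneg.2 ht.1)] at h2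
    have h3 : η * (t - a) ≤ η * (b - a) := by
      have := ht.2
      gcongr
    rw [h1]
    refine (norm_sub_le _ _).trans ?_
    rw [norm_neg]
    linarith
  obtain ⟨u, hua, hu, huz⟩ := exists_solution_near hab (hFp p) (hc p₀) (x₀ := x₀ p) (L := L)
    (ρ := 1) (ε := η + η * (b - a)) one_pos (fun t ht => (hpL t ht).mono (hball t ht)) herr
    (by rw [← he, hη1]; linarith)
  have huniq : EqOn u (x p) (Icc a b) := by
    refine solution_unique (fun R => ?_) hu (hx p) (by rw [hua, hxa])
    obtain ⟨L', hL'⟩ := hlip p R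
    exact ⟨L', hL'.self_of_nhds⟩
  have hb : b ∈ Icc a b := right_mem_Icc.2 hab
  rw [dist_eq_norm, ← huniq hb]
  have := huz b hb
  rw [← he, hη1] at this
  linarith

end ODE

/-! ### Steering of small perturbations of an explicitly steered linear system. -/

section Steering

open Metric MeasureTheory
open scoped NNReal

variable {E U P : Type*} [NormedAddCommGroup E] [NormedSpace ℝ E] [CompleteSpace E]
  [NormedAddCommGroup U] [NormedSpace ℝ U] [TopologicalSpace P]

/-- Steering a family of control systems on `[0, 1]` from `0` to prescribed small targets, when the
systems are small Lipschitz perturbations of a linear system that is steered by the explicit curves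
`s ↦ (QX s c, QU s c)`.  The coefficient `c` of the control depends continuously on the
parameters. -/
theorem exists_steering {G : P → ℝ → E → U → E}
    (hG : ContinuousOn (fun q : P × ℝ × E × U => G q.1 q.2.1 q.2.2.1 q.2.2.2)
      (univ ×ˢ Icc 0 1 ×ˢ univ))
    (hlip : ∀ p₀, ∀ R : ℝ, ∃ L : ℝ≥0, ∀ᶠ p in 𝓝 p₀, ∀ s ∈ Icc (0 : ℝ) 1, ∀ u, ‖u‖ ≤ R →
      LipschitzOnWith L (fun x => G p s x u) (closedBall 0 R))
    {NX : E →L[ℝ] E} {NU : U →L[ℝ] E} {QX : ℝ → E →L[ℝ] E} {QU : ℝ → E →L[ℝ] U}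
    (hQX : ∀ s, HasDerivAt QX (NX ∘L QX s + NU ∘L QU s) s) (hQU : Continuous QU)
    (hQ0 : QX 0 = 0) (hQ1 : QX 1 = ContinuousLinearMap.id ℝ E)
    {K κ κ' r : ℝ} {L : ℝ≥0} (hK : 1 ≤ K) (hr : 0 < r)
    (hKX : ∀ s ∈ Icc (0 : ℝ) 1, ‖QX s‖ ≤ K) (hKU : ∀ s ∈ Icc (0 : ℝ) 1, ‖QU s‖ ≤ K)
    (hκ : ∀ p, ∀ s ∈ Icc (0 : ℝ) 1, ∀ x x' u u', ‖x‖ ≤ r → ‖x'‖ ≤ r → ‖u‖ ≤ r → ‖u'‖ ≤ r →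
      ‖G p s x u - G p s x' u' - (NX (x - x') + NU (u - u'))‖ ≤ κ * max ‖x - x'‖ ‖u - u'‖)
    (hG0 : ∀ p, ∀ s ∈ Icc (0 : ℝ) 1, ‖G p s 0 0‖ ≤ κ')
    (hL : ‖NX‖ + κ ≤ L) (hκ0 : 0 ≤ κ) (hκK : κ * K * Real.exp L ≤ 1 / 4)
    (hκ' : κ' * Real.exp L ≤ r / (32 * K))
    {η : P → E} (hη : Continuous η) (hηr : ∀ p, ‖η p‖ ≤ r / (32 * K)) :
    ∃ c : P → E, Continuous c ∧ ∀ p, ∃ X : ℝ → E, X 0 = 0 ∧ X 1 = η p ∧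
      ∀ s ∈ Icc (0 : ℝ) 1, HasDerivWithinAt X (G p s (X s) (QU s (c p))) (Icc 0 1) s := by
  have hK0 : 0 < K := one_pos.trans_le hK
  -- Coefficients are sought in the ball of radius `r'`. There the linear curves have norm at most
  -- `r / 8`, which leaves room for tubes of radius `r / 2` inside the ball of radius `r`.
  set r' : ℝ := r / (8 * K) with hr'
  have hr'0 : 0 < r' := by positivity
  have hr'4 : r / (32 * K) = r' / 4 := by rw [hr']; field_simp; norm_num
  have hKr' : K * r' = r / 8 := by rw [hr']; field_simp
  have hr'r : r' ≤ r / 8 := by nlinarith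
  rw [hr'4] at hκ' hηr
  set e := Real.exp L with he
  have he0 : 0 < e := Real.exp_pos _
  have he1 : Real.exp (L * (1 - 0)) = e := by simp [he]
  have hQXle : ∀ s ∈ Icc (0 : ℝ) 1, ∀ c, ‖QX s c‖ ≤ K * ‖c‖ := fun s hs c =>
    (QX s).le_of_opNorm_le (hKX s hs) c
  have hQUle : ∀ s ∈ Icc (0 : ℝ) 1, ∀ c, ‖QU s c‖ ≤ K * ‖c‖ := fun s hs c =>
    (QU s).le_of_opNorm_le (hKU s hs) c
  have hQXc : Continuous QX := continuous_iff_continuousAt.2 fun s => (hQX s).continuousAt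
  have hQXd : ∀ c s, HasDerivAt (fun s => QX s c) (NX (QX s c) + NU (QU s c)) s := fun c s => by
    simpa using (hQX s).clm_apply (hasDerivAt_const s c)
  have hFc : ∀ c, ContinuousOn (fun q : P × ℝ × E => G q.1 q.2.1 q.2.2 (QU q.2.1 c))
      (univ ×ˢ Icc 0 1 ×ˢ univ) := fun c =>
    hG.comp (f := fun q : P × ℝ × E => (q.1, q.2.1, q.2.2, QU q.2.1 c))
      (by fun_prop) fun q hq => ⟨mem_univ _, hq.2.1, mem_univ _⟩
  have hFp : ∀ c p, ContinuousOn (Function.uncurry fun s x => G p s x (QU s c))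
      (Icc 0 1 ×ˢ univ) := fun c p =>
    (hFc c).comp (f := fun q : ℝ × E => (p, q)) (by fun_prop) fun q hq => ⟨mem_univ _, hq⟩
  have hlipc : ∀ c p₀, ∀ R : ℝ, ∃ L : ℝ≥0, ∀ᶠ p in 𝓝 p₀, ∀ s ∈ Icc (0 : ℝ) 1,
      LipschitzOnWith L (fun x => G p s x (QU s c)) (closedBall 0 R) := by
    intro c p₀ R
    obtain ⟨L', hL'⟩ := hlip p₀ (max R (K * ‖c‖))
    refine ⟨L', hL'.mono fun p hp s hs => (hp s hs _ ?_).mono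
      (closedBall_subset_closedBall (le_max_left _ _))⟩
    exact (hQUle s hs c).trans (le_max_right _ _)
  have hlipr : ∀ p, ∀ s ∈ Icc (0 : ℝ) 1, ∀ u, ‖u‖ ≤ r →
      LipschitzOnWith L (fun x => G p s x u) (closedBall 0 r) := by
    intro p s hs u hu
    refine LipschitzOnWith.of_dist_le_mul fun x hx x' hx' => ?_
    rw [mem_closedBall_zero_iff] at hx hx'
    rw [dist_eq_norm, dist_eq_norm]
    have h := hκ p s hs x x' u u hx hx' hu hu
    rw [sub_self, map_zero, add_zero, norm_zero, max_eq_left (norm_nonneg _)] at h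
    have h1 := norm_add_le (G p s x u - G p s x' u - NX (x - x')) (NX (x - x'))
    rw [sub_add_cancel] at h1
    have h2 := NX.le_opNorm (x - x')
    have h3 := mul_le_mul_of_nonneg_right hL (norm_nonneg (x - x'))
    linarith
  have hrc : ∀ c, ‖c‖ ≤ r' → ∀ s ∈ Icc (0 : ℝ) 1, ‖QX s c‖ ≤ r / 8 ∧ ‖QU s c‖ ≤ r / 8 := by
    intro c hc s hs
    rw [← hKr']
    exact ⟨(hQXle s hs c).trans (by gcongr), (hQUle s hs c).trans (by gcongr)⟩
  -- The linear curve is an approximate solution with defect `κ * (K * r') + κ'`. Each of the two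
  -- summands, times the Grönwall factor, is at most `r' / 4`. Outside the ball of coefficients an
  -- arbitrary function is returned.
  have hsol : ∀ p c, ∃ X : ℝ → E, ‖c‖ ≤ r' → X 0 = 0 ∧
      (∀ s ∈ Icc (0 : ℝ) 1, HasDerivWithinAt X (G p s (X s) (QU s c)) (Icc 0 1) s) ∧
      ∀ s ∈ Icc (0 : ℝ) 1, ‖X s - QX s c‖ ≤ r' / 2 := by
    intro p c
    by_cases hc : ‖c‖ ≤ r'
    swap
    · exact ⟨0, fun h => absurd h hc⟩
    have hball : ∀ s ∈ Icc (0 : ℝ) 1, closedBall (QX s c) (r / 2) ⊆ closedBall 0 r := by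
      intro s hs
      refine closedBall_subset_closedBall' ?_
      rw [dist_zero_right]
      linarith [(hrc c hc s hs).1]
    have herr : ∀ t ∈ Icc (0 : ℝ) 1, ‖QX t c - 0 - ∫ s in (0 : ℝ)..t, G p s (QX s c) (QU s c)‖
        ≤ κ * (K * r') + κ' := by
      intro t ht
      have hi : IntervalIntegrable (fun s => G p s (QX s c) (QU s c)) volume 0 t := by
        refine ContinuousOn.intervalIntegrable ?_
        rw [uIcc_of_le ht.1]
        exact ((hFp c p).comp (f := fun s => (s, QX s c)) (by fun_prop)
          fun t ht => ⟨ht, mem_univ _⟩).mono (Icc_subset_Icc_right ht.2)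
      have hi' : IntervalIntegrable (fun s => NX (QX s c) + NU (QU s c)) volume 0 t :=
        Continuous.intervalIntegrable (by fun_prop) _ _
      have h0 : ∫ s in (0 : ℝ)..t, (NX (QX s c) + NU (QU s c)) = QX t c - 0 := by
        rw [intervalIntegral.integral_eq_sub_of_hasDerivAt (fun s _ => hQXd c s) hi', hQ0]
        simp
      rw [← h0, ← intervalIntegral.integral_sub hi' hi]
      have h2 : ‖∫ s in (0 : ℝ)..t, ((NX (QX s c) + NU (QU s c)) - G p s (QX s c) (QU s c))‖
          ≤ (κ * (K * r') + κ') * |t - 0| := by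
        refine intervalIntegral.norm_integral_le_of_norm_le_const fun s hs => ?_
        rw [uIoc_of_le ht.1] at hs
        have hs' : s ∈ Icc (0 : ℝ) 1 := ⟨hs.1.le, hs.2.trans ht.2⟩
        obtain ⟨h3, h4⟩ := hrc c hc s hs'
        have h5 := hκ p s hs' (QX s c) 0 (QU s c) 0 (by linarith) (by simpa using hr.le)
          (by linarith) (by simpa using hr.le)
        rw [sub_zero, sub_zero] at h5
        have h6 := hG0 p s hs'
        have h7 : κ * max ‖QX s c‖ ‖QU s c‖ ≤ κ * (K * r') := by
          rw [hKr']
          exact mul_le_mul_of_nonneg_left (max_le h3 h4) hκ0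
        have h8 : (NX (QX s c) + NU (QU s c)) - G p s (QX s c) (QU s c)
            = -(G p s (QX s c) (QU s c) - G p s 0 0 - (NX (QX s c) + NU (QU s c)))
              - G p s 0 0 := by abel
        rw [h8]
        refine (norm_sub_le _ _).trans ?_
        rw [norm_neg]
        linarith
      have h9 : 0 ≤ κ * (K * r') + κ' :=
        add_nonneg (by positivity) ((norm_nonneg _).trans (hG0 p 0 ⟨le_rfl, zero_le_one⟩))
      rw [sub_zero, abs_of_nonneg ht.1] at h2
      exact h2.trans (mul_le_of_le_one_right h9 ht.2)
    have hεe : (κ * (K * r') + κ') * Real.exp (L * (1 - 0)) ≤ r' / 2 := by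
      rw [he1]
      nlinarith
    obtain ⟨X, hX0, hX, hXz⟩ := exists_solution_near zero_le_one (hFp c p)
      (z := fun s => QX s c) (by fun_prop) (x₀ := 0) (L := L) (ρ := r / 2)
      (ε := κ * (K * r') + κ') (by positivity)
      (fun s hs => (hlipr p s hs _ (by linarith [(hrc c hc s hs).2])).mono (hball s hs))
      herr (hεe.trans (by linarith))
    exact ⟨X, fun _ => ⟨hX0, hX, fun s hs => (hXz s hs).trans hεe⟩⟩
  choose X hX using hsol
  have hX1 : ∀ p c c', ‖c‖ ≤ r' → ‖c'‖ ≤ r' →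
      ‖X p c 1 - X p c' 1 - (c - c')‖ ≤ 1 / 4 * ‖c - c'‖ := by
    intro p c c' hc hc'
    obtain ⟨hX0, hXd, hXz⟩ := hX p c hc
    obtain ⟨hX0', hXd', hXz'⟩ := hX p c' hc'
    have hXc' : ContinuousOn (X p c') (Icc 0 1) := fun t ht => (hXd' t ht).continuousWithinAt
    have hcc : ‖c - c'‖ ≤ 2 * r' := (norm_sub_le _ _).trans (by linarith)
    -- Comparing with the nonlinear solution for `c'`, shifted by the linear response to `c - c'`,
    -- gives a defect proportional to `‖c - c'‖`. Hence `c ↦ X p c 1 - c` is `1/4`-Lipschitz.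
    set z : ℝ → E := fun s => X p c' s + QX s (c - c') with hz
    have hzc : ContinuousOn z (Icc 0 1) := hXc'.add (by fun_prop)
    have hX'le : ∀ s ∈ Icc (0 : ℝ) 1, ‖X p c' s‖ ≤ r / 4 := by
      intro s hs
      have h := norm_add_le (X p c' s - QX s c') (QX s c')
      rw [sub_add_cancel] at h
      linarith [hXz' s hs, (hrc c' hc' s hs).1]
    have hzle : ∀ s ∈ Icc (0 : ℝ) 1, ‖z s‖ ≤ r / 2 := by
      intro s hs
      refine (norm_add_le _ _).trans ?_
      have h1 := hQXle s hs (c - c')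
      have h2 : K * ‖c - c'‖ ≤ K * (2 * r') := by gcongr
      linarith [hX'le s hs]
    have herr : ∀ t ∈ Icc (0 : ℝ) 1, ‖z t - 0 - ∫ s in (0 : ℝ)..t, G p s (z s) (QU s c)‖
        ≤ κ * (K * ‖c - c'‖) := by
      intro t ht
      have hsub : Icc 0 t ⊆ Icc (0 : ℝ) 1 := Icc_subset_Icc_right ht.2
      have hi : IntervalIntegrable (fun s => G p s (z s) (QU s c)) volume 0 t := by
        refine ContinuousOn.intervalIntegrable ?_
        rw [uIcc_of_le ht.1]
        exact ((hFp c p).comp (f := fun s => (s, z s)) (continuousOn_id.prodMk hzc)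
          fun t ht => ⟨ht, mem_univ _⟩).mono hsub
      have hi1 : IntervalIntegrable (fun s => G p s (X p c' s) (QU s c')) volume 0 t := by
        refine ContinuousOn.intervalIntegrable ?_
        rw [uIcc_of_le ht.1]
        exact ((hFp c' p).comp (f := fun s => (s, X p c' s)) (continuousOn_id.prodMk hXc')
          fun t ht => ⟨ht, mem_univ _⟩).mono hsub
      have hi2 : IntervalIntegrable (fun s => NX (QX s (c - c')) + NU (QU s (c - c')))
          volume 0 t := Continuous.intervalIntegrable (by fun_prop) _ _
      have h0 : ∫ s in (0 : ℝ)..t, (NX (QX s (c - c')) + NU (QU s (c - c')))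
          = QX t (c - c') := by
        rw [intervalIntegral.integral_eq_sub_of_hasDerivAt (fun s _ => hQXd _ s) hi2, hQ0]
        simp
      have h0' : ∫ s in (0 : ℝ)..t, G p s (X p c' s) (QU s c') = X p c' t := by
        rw [← solution_eq_integral (hFp c' p) hXd' ht, hX0', sub_zero]
      have h1 : z t - 0 - ∫ s in (0 : ℝ)..t, G p s (z s) (QU s c)
          = ∫ s in (0 : ℝ)..t, (G p s (X p c' s) (QU s c')
            + (NX (QX s (c - c')) + NU (QU s (c - c'))) - G p s (z s) (QU s c)) := by
        rw [intervalIntegral.integral_sub (hi1.add hi2) hi,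
          intervalIntegral.integral_add hi1 hi2, h0, h0', sub_zero]
      rw [h1]
      have h2 : ‖∫ s in (0 : ℝ)..t, (G p s (X p c' s) (QU s c')
            + (NX (QX s (c - c')) + NU (QU s (c - c'))) - G p s (z s) (QU s c))‖
          ≤ (κ * (K * ‖c - c'‖)) * |t - 0| := by
        refine intervalIntegral.norm_integral_le_of_norm_le_const fun s hs => ?_
        rw [uIoc_of_le ht.1] at hs
        have hs' : s ∈ Icc (0 : ℝ) 1 := ⟨hs.1.le, hs.2.trans ht.2⟩
        have h5 := hκ p s hs' (z s) (X p c' s) (QU s c) (QU s c') (by linarith [hzle s hs'])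
          (by linarith [hX'le s hs']) (by linarith [(hrc c hc s hs').2])
          (by linarith [(hrc c' hc' s hs').2])
        rw [← map_sub, show z s - X p c' s = QX s (c - c') by simp [hz]] at h5
        have h7 : κ * max ‖QX s (c - c')‖ ‖QU s (c - c')‖ ≤ κ * (K * ‖c - c'‖) :=
          mul_le_mul_of_nonneg_left (max_le (hQXle s hs' _) (hQUle s hs' _)) hκ0
        have h8 : G p s (X p c' s) (QU s c')
            + (NX (QX s (c - c')) + NU (QU s (c - c'))) - G p s (z s) (QU s c)
            = -(G p s (z s) (QU s c) - G p s (X p c' s) (QU s c')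
              - (NX (QX s (c - c')) + NU (QU s (c - c')))) := by abel
        rw [h8, norm_neg]
        exact h5.trans h7
      rw [sub_zero, abs_of_nonneg ht.1] at h2
      exact h2.trans (mul_le_of_le_one_right (by positivity) ht.2)
    have hεe : κ * (K * ‖c - c'‖) * Real.exp (L * (1 - 0)) ≤ 1 / 4 * ‖c - c'‖ := by
      rw [he1]
      have := mul_le_mul_of_nonneg_right hκK (norm_nonneg (c - c'))
      linarith
    have hball : ∀ s ∈ Icc (0 : ℝ) 1, closedBall (z s) (r / 2) ⊆ closedBall 0 r := by
      intro s hs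
      refine closedBall_subset_closedBall' ?_
      rw [dist_zero_right]
      linarith [hzle s hs]
    obtain ⟨Y, hY0, hY, hYz⟩ := exists_solution_near zero_le_one (hFp c p)
      (z := z) hzc (x₀ := 0) (L := L) (ρ := r / 2)
      (ε := κ * (K * ‖c - c'‖)) (by positivity)
      (fun s hs => (hlipr p s hs _ (by linarith [(hrc c hc s hs).2])).mono (hball s hs))
      herr (hεe.trans (by linarith))
    have h1 : (1 : ℝ) ∈ Icc (0 : ℝ) 1 := right_mem_Icc.2 zero_le_one
    have huniq : EqOn Y (X p c) (Icc 0 1) := by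
      refine solution_unique (F := fun s x => G p s x (QU s c)) (fun R => ?_) hY hXd
        (by rw [hY0, hX0])
      obtain ⟨L', hL'⟩ := hlipc c p R
      exact ⟨L', hL'.self_of_nhds⟩
    have h2 := (hYz 1 h1).trans hεe
    rw [huniq h1] at h2
    simpa [hz, hQ1, sub_sub] using h2
  have hX1c : ∀ p c, ‖c‖ ≤ r' → ‖X p c 1 - c‖ ≤ r' / 2 := by
    intro p c hc
    have h := (hX p c hc).2.2 1 (right_mem_Icc.2 zero_le_one)
    simpa [hQ1] using h
  have hfix : ∀ p, ∃ c, ‖c‖ ≤ r' ∧ X p c 1 = η p := by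
    intro p
    -- A fixed point of `Λ` is a coefficient whose solution ends at `η p`. The ball is preserved
    -- because the error `r' / 2` and the target bound `r' / 4` add up to less than `r'`.
    set Λ : E → E := fun c => c - X p c 1 + η p with hΛ
    have hmaps : MapsTo Λ (closedBall 0 r') (closedBall 0 r') := by
      intro c hc
      rw [mem_closedBall_zero_iff] at hc ⊢
      refine (norm_add_le _ _).trans ?_
      rw [norm_sub_rev]
      linarith [hX1c p c hc, hηr p]
    have hcontr : ContractingWith (1 / 4) (hmaps.restrict Λ _ _) := by
      refine ⟨by rw [← NNReal.coe_lt_coe]; norm_num, LipschitzWith.of_dist_le_mul fun c c' => ?_⟩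
      have h := hX1 p c c' (mem_closedBall_zero_iff.1 c.2) (mem_closedBall_zero_iff.1 c'.2)
      rw [Subtype.dist_eq, Subtype.dist_eq, dist_eq_norm, dist_eq_norm]
      have h1 : Λ c - Λ c' = -(X p c 1 - X p c' 1 - ((c : E) - c')) := by
        simp only [hΛ]; abel
      rw [MapsTo.val_restrict_apply, MapsTo.val_restrict_apply, h1, norm_neg]
      simpa using h
    obtain ⟨c, hc, hcf, -⟩ := ContractingWith.exists_fixedPoint' isClosed_closedBall.isComplete
      hmaps hcontr (x := 0) (by simpa using hr'0.le) (edist_ne_top _ _)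
    refine ⟨c, mem_closedBall_zero_iff.1 hc, ?_⟩
    have h : c - X p c 1 + η p = c := hcf
    rw [sub_add_eq_add_sub, sub_eq_iff_eq_add, add_right_inj] at h
    exact h.symm
  choose c hcr hc using hfix
  refine ⟨c, continuous_iff_continuousAt.2 fun p₀ => ?_, fun p =>
    ⟨X p (c p), (hX p _ (hcr p)).1, hc p, (hX p _ (hcr p)).2.1⟩⟩
  -- Continuity of the fixed point needs only the solutions for the frozen coefficient `c p₀`: the
  -- `1/4`-Lipschitz bound gives `3/4 * ‖c p - c p₀‖ ≤ ‖η p - X p (c p₀) 1‖`.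
  have hcont : Continuous fun p => X p (c p₀) 1 :=
    continuous_solution_endpoint zero_le_one (F := fun p s x => G p s x (QU s (c p₀)))
      (hFc (c p₀)) (hlipc (c p₀)) (x₀ := fun _ => 0) continuous_const
      (fun p => (hX p _ (hcr p₀)).1) (fun p => (hX p _ (hcr p₀)).2.1)
  have hlim : Tendsto (fun p => 2 * ‖η p - X p (c p₀) 1‖) (𝓝 p₀) (𝓝 0) := by
    have h : Continuous fun p => 2 * ‖η p - X p (c p₀) 1‖ := by fun_prop
    have h1 := h.tendsto p₀
    simpa [hc p₀] using h1
  refine tendsto_iff_norm_sub_tendsto_zero.2 (squeeze_zero (fun _ => norm_nonneg _) (fun p => ?_)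
    hlim)
  have h := hX1 p (c p) (c p₀) (hcr p) (hcr p₀)
  rw [hc p] at h
  have h1 := norm_sub_norm_le (c p - c p₀) (η p - X p (c p₀) 1)
  rw [norm_sub_rev (c p - c p₀)] at h1
  linarith [norm_nonneg (η p - X p (c p₀) 1)]

end Steering

/-! ### Families of curves that are jointly `C¹`. -/

section JointC1

variable {Y Y' F G : Type*} [TopologicalSpace Y] [TopologicalSpace Y'] [NormedAddCommGroup F]
  [NormedSpace ℝ F] [NormedAddCommGroup G] [NormedSpace ℝ G]

/-- A family of curves is jointly `C¹` if the curves are differentiable, and if their values and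
their velocities depend continuously on the parameter and on time. -/
structure JointC1 (g : Y → ℝ → F) : Prop where
  continuous : Continuous fun q : Y × ℝ => g q.1 q.2
  differentiable : ∀ y, Differentiable ℝ (g y)
  continuous_deriv : Continuous fun q : Y × ℝ => deriv (g q.1) q.2

namespace JointC1

theorem of_hasDerivAt {g g' : Y → ℝ → F} (hg : Continuous fun q : Y × ℝ => g q.1 q.2)
    (hg' : Continuous fun q : Y × ℝ => g' q.1 q.2) (h : ∀ y t, HasDerivAt (g y) (g' y t) t) :
    JointC1 g :=
  ⟨hg, fun y t => (h y t).differentiableAt, by simpa only [(h _ _).deriv] using hg'⟩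

/-- Values and velocities depend only on germs, so joint `C¹` regularity is local. Sums whose number
of terms is only locally bounded are handled in this way. -/
theorem congr_local {g : Y → ℝ → F}
    (h : ∀ y₀ t₀, ∃ g₁ : Y → ℝ → F, JointC1 g₁ ∧
      ∀ᶠ q : Y × ℝ in 𝓝 (y₀, t₀), g q.1 q.2 = g₁ q.1 q.2) : JointC1 g := by
  have hslice : ∀ {g₁ : Y → ℝ → F} {q₀ : Y × ℝ},
      (∀ᶠ q : Y × ℝ in 𝓝 q₀, g q.1 q.2 = g₁ q.1 q.2) → g q₀.1 =ᶠ[𝓝 q₀.2] g₁ q₀.1 := by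
    intro g₁ q₀ hq
    have h1 : Tendsto (fun t : ℝ => (q₀.1, t)) (𝓝 q₀.2) (𝓝 q₀) := by
      have : Continuous fun t : ℝ => (q₀.1, t) := by fun_prop
      exact this.tendsto q₀.2
    exact h1.eventually hq
  refine ⟨continuous_iff_continuousAt.2 fun q₀ => ?_, fun y t => ?_,
    continuous_iff_continuousAt.2 fun q₀ => ?_⟩
  · obtain ⟨g₁, hg₁, he⟩ := h q₀.1 q₀.2
    exact hg₁.continuous.continuousAt.congr (he.mono fun q hq => hq.symm)
  · obtain ⟨g₁, hg₁, he⟩ := h y t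
    exact (hg₁.differentiable y t).congr_of_eventuallyEq (hslice he)
  · obtain ⟨g₁, hg₁, he⟩ := h q₀.1 q₀.2
    refine hg₁.continuous_deriv.continuousAt.congr ?_
    filter_upwards [he.eventually_nhds] with q hq
    exact (hslice hq).deriv_eq.symm

theorem const {c : Y → F} (hc : Continuous c) : JointC1 fun y (_ : ℝ) => c y :=
  of_hasDerivAt (by fun_prop) continuous_const fun _ t => hasDerivAt_const t _

theorem add {g₁ g₂ : Y → ℝ → F} (h₁ : JointC1 g₁) (h₂ : JointC1 g₂) :
    JointC1 fun y t => g₁ y t + g₂ y t :=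
  of_hasDerivAt (h₁.continuous.add h₂.continuous)
    (h₁.continuous_deriv.add h₂.continuous_deriv)
    fun y t => (h₁.differentiable y t).hasDerivAt.add (h₂.differentiable y t).hasDerivAt

theorem sub {g₁ g₂ : Y → ℝ → F} (h₁ : JointC1 g₁) (h₂ : JointC1 g₂) :
    JointC1 fun y t => g₁ y t - g₂ y t :=
  of_hasDerivAt (h₁.continuous.sub h₂.continuous)
    (h₁.continuous_deriv.sub h₂.continuous_deriv)
    fun y t => (h₁.differentiable y t).hasDerivAt.sub (h₂.differentiable y t).hasDerivAt

theorem smul {g₁ : Y → ℝ → ℝ} {g₂ : Y → ℝ → F} (h₁ : JointC1 g₁) (h₂ : JointC1 g₂) :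
    JointC1 fun y t => g₁ y t • g₂ y t :=
  of_hasDerivAt (h₁.continuous.smul h₂.continuous)
    ((h₁.continuous.smul h₂.continuous_deriv).add (h₁.continuous_deriv.smul h₂.continuous))
    fun y t => (h₁.differentiable y t).hasDerivAt.smul (h₂.differentiable y t).hasDerivAt

theorem sum {ι : Type*} (s : Finset ι) {g : ι → Y → ℝ → F} (h : ∀ i ∈ s, JointC1 (g i)) :
    JointC1 fun y t => ∑ i ∈ s, g i y t :=
  of_hasDerivAt (continuous_finsetSum s fun i hi => (h i hi).continuous)
    (continuous_finsetSum s fun i hi => (h i hi).continuous_deriv)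
    fun y t => HasDerivAt.fun_sum fun i hi => ((h i hi).differentiable y t).hasDerivAt

/-- Reparametrization by a continuous change of parameters and an affine change of time. -/
theorem comp_affine {g : Y → ℝ → F} (hg : JointC1 g) {π : Y' → Y} (hπ : Continuous π)
    {α β : Y' → ℝ} (hα : Continuous α) (hβ : Continuous β) :
    JointC1 fun y t => g (π y) (α y * t + β y) :=
  of_hasDerivAt (g' := fun y t => α y • deriv (g (π y)) (α y * t + β y))
    (hg.continuous.comp (f := fun q : Y' × ℝ => (π q.1, α q.1 * q.2 + β q.1)) (by fun_prop))
    (Continuous.smul (by fun_prop)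
      (hg.continuous_deriv.comp (f := fun q : Y' × ℝ => (π q.1, α q.1 * q.2 + β q.1))
        (by fun_prop)))
    fun y t => by
      have h1 : HasDerivAt (fun t => α y * t + β y) (α y) t := by
        simpa using ((hasDerivAt_id t).const_mul (α y)).add_const (β y)
      exact (hg.differentiable (π y) _).hasDerivAt.scomp t h1

theorem of_contDiff {f : ℝ → F} (hf : ContDiff ℝ 1 f) : JointC1 fun (_ : Y) t => f t :=
  of_hasDerivAt (hf.continuous.comp continuous_snd)
    ((contDiff_one_iff_deriv.1 hf).2.comp continuous_snd)
    fun _ t => (hf.differentiable one_ne_zero t).hasDerivAt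

theorem clm_apply {A : Y → ℝ → G →L[ℝ] F} (hA : JointC1 A) {c : Y → G} (hc : Continuous c) :
    JointC1 fun y t => A y t (c y) :=
  of_hasDerivAt (g' := fun y t => deriv (A y) t (c y))
    (hA.continuous.clm_apply (by fun_prop))
    (hA.continuous_deriv.clm_apply (by fun_prop))
    fun y t => by
      simpa using (hA.differentiable y t).hasDerivAt.clm_apply (hasDerivAt_const t (c y))

/-- A jointly `C¹` family is a continuous map into the space of `C¹` curves on a segment. -/
theorem continuousC1Family {g : Y → ℝ → F} (hg : JointC1 g) {a b : ℝ} (hab : a < b) :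
    ContinuousC1Family a b g := by
  have hunif : ∀ {k : Y → ℝ → F}, (Continuous fun q : Y × ℝ => k q.1 q.2) → ∀ y₀,
      TendstoUniformlyOn k (k y₀) (𝓝 y₀) (Icc a b) := by
    intro k hk y₀ u hu
    obtain ⟨v, hv, hv'⟩ := isCompact_Icc.mem_uniformity_of_prod (f := k) (s := univ)
      (k := Icc a b) hk.continuousOn (mem_univ y₀) (symm_le_uniformity hu)
    rw [nhdsWithin_univ] at hv
    filter_upwards [hv] with y hy t ht using hv' y hy t ht
  have hdw : ∀ y, ∀ t ∈ Icc a b, derivWithin (g y) (Icc a b) t = deriv (g y) t := fun y t ht =>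
    (hg.differentiable y t).derivWithin (uniqueDiffOn_Icc hab t ht)
  refine ⟨fun y => ?_, fun y₀ => hunif hg.continuous y₀, fun y₀ => ?_⟩
  · refine ContDiff.contDiffOn (contDiff_one_iff_deriv.2 ⟨hg.differentiable y, ?_⟩)
    exact hg.continuous_deriv.comp (f := fun t : ℝ => (y, t)) (by fun_prop)
  · intro u hu
    filter_upwards [hunif (k := fun y => deriv (g y)) hg.continuous_deriv y₀ u hu] with y hy t ht
    rw [hdw y t ht, hdw y₀ t ht]
    exact hy t ht

end JointC1

end JointC1

/-! ### Continuous convex weights that average a surjective map to zero. -/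

section Weights

variable {X E U : Type*} [MetricSpace X] [NormedAddCommGroup E] [NormedSpace ℝ E]
  [FiniteDimensional ℝ E] [NormedAddCommGroup U]

/-- Finitely many points which surround the origin robustly: `0` is a convex combination, with
continuous coefficients, of all nearby configurations of points. -/
theorem exists_surrounding (E : Type*) [NormedAddCommGroup E] [NormedSpace ℝ E]
    [FiniteDimensional ℝ E] : ∃ (n : ℕ) (O : Set (Fin n → E)) (a : (Fin n → E) → Fin n → ℝ),
    IsOpen O ∧ O.Nonempty ∧ ContinuousOn a O ∧ ∀ u ∈ O, (∀ i, 0 ≤ a u i) ∧ ∑ i, a u i = 1 ∧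
      ∑ i, a u i • u i = 0 := by
  set d := Module.finrank ℝ E
  set b := Module.finBasis ℝ E
  -- `T u` sends the basis vectors to `u 1, …, u d`. When it is invertible, the coordinates of `(T
  -- u)⁻¹ (-u 0)` are the coefficients `c` with `u 0 + ∑ c i • u (i + 1) = 0`. Robustness is the
  -- openness of the conditions that `T u` is a unit and that `c` is positive.
  set T : (Fin (d + 1) → E) → (E →L[ℝ] E) := fun u =>
    ∑ i : Fin d, (LinearMap.toContinuousLinearMap (b.coord i)).smulRight (u i.succ) with hT
  have hTapply : ∀ u x, T u x = ∑ i : Fin d, b.coord i x • u i.succ := fun u x => by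
    simp [hT]
  have hTc : Continuous T := by
    refine continuous_finsetSum _ fun i _ => ?_
    have : Continuous fun x : E =>
        (LinearMap.toContinuousLinearMap (b.coord i)).smulRight x :=
      (ContinuousLinearMap.smulRightL ℝ E E (LinearMap.toContinuousLinearMap (b.coord i))).continuous
    exact this.comp (continuous_apply _)
  set w : (Fin (d + 1) → E) → E := fun u => Ring.inverse (T u) (-u 0) with hw
  have hwc : ∀ u, IsUnit (T u) → ContinuousAt w u := by
    intro u hu
    obtain ⟨e, he⟩ := hu
    have h1 : ContinuousAt Ring.inverse (T u) := he ▸ NormedRing.inverse_continuousAt e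
    exact (h1.comp hTc.continuousAt).clm_apply (continuous_apply 0).neg.continuousAt
  set c : (Fin (d + 1) → E) → Fin d → ℝ := fun u i => b.coord i (w u) with hc
  have hcc : ∀ u, IsUnit (T u) → ContinuousAt c u := fun u hu =>
    continuousAt_pi.2 fun i =>
      (LinearMap.toContinuousLinearMap (b.coord i)).continuous.continuousAt.comp (hwc u hu)
  have hcu : ∀ u, IsUnit (T u) → u 0 + ∑ i : Fin d, c u i • u i.succ = 0 := by
    intro u hu
    have h1 : T u (w u) = -u 0 := by
      rw [hw]
      have := congrArg (fun A : E →L[ℝ] E => A (-u 0)) (Ring.mul_inverse_cancel (T u) hu)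
      simpa using this
    rw [hTapply] at h1
    simp only [hc]
    rw [h1, add_neg_cancel]
  set O : Set (Fin (d + 1) → E) := {u | IsUnit (T u) ∧ ∀ i, 0 < c u i} with hO
  have hOopen : IsOpen O := by
    refine isOpen_iff_mem_nhds.2 fun u hu => ?_
    have h1 : ∀ᶠ u' in 𝓝 u, IsUnit (T u') :=
      hTc.continuousAt.eventually (Units.isOpen.mem_nhds hu.1)
    have h2 : ∀ᶠ u' in 𝓝 u, ∀ i, 0 < c u' i := by
      refine eventually_all.2 fun i => ?_
      have : ContinuousAt (fun u' => c u' i) u := (continuousAt_pi.1 (hcc u hu.1)) i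
      exact this.eventually (lt_mem_nhds (hu.2 i))
    exact h1.and h2
  refine ⟨d + 1, O, fun u => (1 + ∑ i, c u i)⁻¹ • Fin.cons 1 (c u), hOopen, ?_, ?_, ?_⟩
  -- The simplex with vertices the basis vectors and minus their sum: here `T` is the identity and
  -- all coefficients are `1`.
  · refine ⟨Fin.cons (-∑ i, b i) b, ?_⟩
    set u₀ : Fin (d + 1) → E := Fin.cons (-∑ i, b i) b with hu₀
    have hTu : T u₀ = 1 := by
      ext x
      rw [hTapply]
      simp [hu₀]
    refine ⟨hTu ▸ isUnit_one, fun i => ?_⟩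
    have : w u₀ = ∑ i, b i := by
      simp only [hw, hTu, Ring.inverse_one, one_apply_eq_self]
      simp [hu₀]
    simp only [hc, this, map_sum, Module.Basis.coord_apply, Module.Basis.repr_self]
    simp
  · intro u hu
    have hcu := hcc u hu.1
    refine ContinuousAt.continuousWithinAt ?_
    have hpos : 1 + ∑ i, c u i ≠ 0 := by
      have : 0 ≤ ∑ i, c u i := Finset.sum_nonneg fun i _ => (hu.2 i).le
      positivity
    have h1 : ContinuousAt (fun u => (1 + ∑ i, c u i)⁻¹) u := by
      refine ContinuousAt.inv₀ (continuousAt_const.add ?_) hpos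
      exact tendsto_finsetSum _ fun i _ => (continuousAt_pi.1 hcu) i
    refine h1.smul ?_
    refine continuousAt_pi.2 fun i => ?_
    refine Fin.cases ?_ (fun i => ?_) i
    · simp [continuousAt_const]
    · simpa using (continuousAt_pi.1 hcu) i
  · intro u hu
    have h0 : 0 ≤ ∑ i, c u i := Finset.sum_nonneg fun i _ => (hu.2 i).le
    have hpos : 1 + ∑ i, c u i ≠ 0 := by positivity
    refine ⟨fun i => ?_, ?_, ?_⟩
    · refine Fin.cases ?_ (fun i => ?_) i
      · simp only [Pi.smul_apply, Fin.cons_zero, smul_eq_mul, mul_one]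
        positivity
      · have := hu.2 i
        simp only [Pi.smul_apply, Fin.cons_succ, smul_eq_mul]
        positivity
    · simp only [Pi.smul_apply, Fin.sum_univ_succ, Fin.cons_zero, Fin.cons_succ, smul_eq_mul]
      rw [← Finset.mul_sum, ← mul_add]
      exact inv_mul_cancel₀ hpos
    · simp only [Pi.smul_apply, smul_assoc, ← Finset.smul_sum, Fin.sum_univ_succ, Fin.cons_zero,
        Fin.cons_succ, one_smul]
      rw [hcu u hu.1, smul_zero]

/-- Convex weights, depending continuously on parameters, which average a family of values of a
surjective map exactly to `0`.  The number of weights in use is locally bounded. -/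
theorem exists_relaxed_weights [TopologicalSpace.SeparableSpace U] {Λ : ℝ} (hΛ : 0 ≤ Λ)
    {φ : X → ℝ → U → E} (hφ : Continuous fun q : X × ℝ × U => φ q.1 q.2.1 q.2.2)
    (hsurj : ∀ ξ σ, Function.Surjective (φ ξ σ)) :
    ∃ (v : ℕ → U) (m : X → ℕ) (a : X → ℝ → ℕ → ℝ),
      (∀ ξ₀, ∃ M, ∀ᶠ ξ in 𝓝 ξ₀, m ξ ≤ M) ∧
      (∀ j, Continuous fun q : X × ℝ => a q.1 q.2 j) ∧
      ∀ ξ σ, (∀ j, 0 ≤ a ξ σ j) ∧ (∀ j, m ξ ≤ j → a ξ σ j = 0) ∧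
        ∑ j ∈ Finset.range (m ξ), a ξ σ j = 1 ∧
        (σ ∈ Icc 0 Λ → ∑ j ∈ Finset.range (m ξ), a ξ σ j • φ ξ σ (v j) = 0) := by
  obtain ⟨k, O, α, hO, ⟨u₀, hu₀⟩, hα, hαO⟩ := exists_surrounding E
  -- The points are fixed once and for all, and only their weights vary with the parameters. This is
  -- what allows continuous dependence without a continuous right inverse of `φ`.
  set v : ℕ → U := TopologicalSpace.denseSeq U with hv
  have hφz : ∀ z : X × ℝ, Continuous (φ z.1 z.2) := fun z =>
    hφ.comp (f := fun u : U => (z.1, z.2, u)) (by fun_prop)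
  have hφv : ∀ J : Fin k → ℕ, Continuous fun z : X × ℝ => fun i => φ z.1 z.2 (v (J i)) :=
    fun J => continuous_pi fun i =>
      hφ.comp (f := fun z : X × ℝ => (z.1, z.2, v (J i))) (by fun_prop)
  set Q : ℕ → X × ℝ → Prop := fun n z =>
    ∃ J : Fin k → ℕ, (∀ i, J i < n) ∧ (fun i => φ z.1 z.2 (v (J i))) ∈ O with hQ
  have hQmono : ∀ {n n' z}, n ≤ n' → Q n z → Q n' z := by
    rintro n n' z hn ⟨J, hJ, hJO⟩
    exact ⟨J, fun i => (hJ i).trans_le hn, hJO⟩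
  have hQopen : ∀ n z, Q n z → ∀ᶠ z' in 𝓝 z, Q n z' := by
    rintro n z ⟨J, hJ, hJO⟩
    filter_upwards [(hφv J).continuousAt.eventually (hO.mem_nhds hJO)] with z' hz'
    exact ⟨J, hJ, hz'⟩
  -- Surjectivity attains the configuration `u₀` exactly. Continuity of `φ` and openness of `O`
  -- allow the preimages to be moved to points of the dense sequence.
  have hQex : ∀ z, ∃ n, Q n z := by
    intro z
    choose x hx using fun i => hsurj z.1 z.2 (u₀ i)
    have hc : Continuous fun x : Fin k → U => fun i => φ z.1 z.2 (x i) :=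
      continuous_pi fun i => (hφz z).comp (continuous_apply i)
    have hd : DenseRange fun J : Fin k → ℕ => fun i => v (J i) :=
      DenseRange.piMap fun _ => TopologicalSpace.denseRange_denseSeq U
    obtain ⟨J, hJ⟩ := hd.exists_mem_open (hO.preimage hc) ⟨x, by simpa [hx] using hu₀⟩
    refine ⟨(Finset.univ.sup J) + 1, J, fun i => ?_, hJ⟩
    exact Nat.lt_succ_of_le (Finset.le_sup (Finset.mem_univ i))
  -- Compactness of `[0, Λ]` bounds the number of required points uniformly in `σ`, locally in `ξ`.
  have hstage : ∀ ξ₀, ∃ n, ∀ᶠ ξ in 𝓝 ξ₀, ∀ σ ∈ Icc 0 Λ, Q n (ξ, σ) := by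
    intro ξ₀
    refine isCompact_Icc.induction_on
      (p := fun S => ∃ n, ∀ᶠ ξ in 𝓝 ξ₀, ∀ σ ∈ S, Q n (ξ, σ)) ?_ ?_ ?_ ?_
    · exact ⟨0, by simp⟩
    · rintro S S' hS ⟨n, hn⟩
      exact ⟨n, hn.mono fun ξ h σ hσ => h σ (hS hσ)⟩
    · rintro S S' ⟨n, hn⟩ ⟨n', hn'⟩
      refine ⟨max n n', ?_⟩
      filter_upwards [hn, hn'] with ξ h h' σ hσ
      exact hσ.elim (fun hσ => hQmono (le_max_left _ _) (h σ hσ))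
        fun hσ => hQmono (le_max_right _ _) (h' σ hσ)
    · intro σ _
      obtain ⟨n, hn⟩ := hQex (ξ₀, σ)
      have h := hQopen n _ hn
      rw [nhds_prod_eq] at h
      obtain ⟨pa, hpa, pb, hpb, hab⟩ := eventually_prod_iff.1 h
      exact ⟨{σ | pb σ}, mem_nhdsWithin_of_mem_nhds hpb, n,
        hpa.mono fun ξ hξ σ hσ => hab hξ hσ⟩
  obtain ⟨N, hN⟩ := exists_continuous_forall_mem_convex_of_local_const (X := X) (E := ℝ)
    (t := fun ξ => {x : ℝ | ∀ σ ∈ Icc 0 Λ, ∃ n : ℕ, (n : ℝ) ≤ x ∧ Q n (ξ, σ)})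
    (fun ξ => by
      refine OrdConnected.convex (IsUpperSet.ordConnected ?_)
      intro x y hxy hx σ hσ
      obtain ⟨n, hn, h⟩ := hx σ hσ
      exact ⟨n, hn.trans hxy, h⟩)
    (fun ξ₀ => by
      obtain ⟨n, hn⟩ := hstage ξ₀
      exact ⟨n, hn.mono fun ξ h σ hσ => ⟨n, le_rfl, h σ hσ⟩⟩)
  -- The added `1` is slack: indices admissible at `z₀` remain admissible at nearby `z`, where only
  -- `N z₀.1 < N z.1 + 1` is known.
  set m : X → ℕ := fun ξ => ⌈N ξ + 1⌉₊ with hm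
  -- All requirements on the weights are convex, so local continuous choices can be patched by a
  -- partition of unity. Locally the coefficients from `exists_surrounding` are placed at the
  -- indices `J i`, and added up where `J` repeats an index.
  obtain ⟨a, ha⟩ := exists_continuous_forall_mem_convex_of_local (X := X × Icc 0 Λ) (E := ℕ → ℝ)
    (t := fun z => {w | (∀ j, 0 ≤ w j) ∧ (∀ j : ℕ, N z.1 + 1 ≤ j → w j = 0) ∧
      ∑ j ∈ Finset.range (m z.1), w j = 1 ∧
      ∑ j ∈ Finset.range (m z.1), w j • φ z.1 z.2 (v j) = 0})
    (fun z => by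
      rintro w ⟨h1, h2, h3, h4⟩ w' ⟨h1', h2', h3', h4'⟩ s s' hs hs' hss
      refine ⟨fun j => ?_, fun j hj => ?_, ?_, ?_⟩
      · have := h1 j
        have := h1' j
        simp only [Pi.add_apply, Pi.smul_apply, smul_eq_mul]
        positivity
      · simp [h2 j hj, h2' j hj]
      · simp only [Pi.add_apply, Pi.smul_apply, smul_eq_mul]
        rw [Finset.sum_add_distrib, ← Finset.mul_sum, ← Finset.mul_sum, h3, h3', mul_one, mul_one,
          hss]
      · simp only [Pi.add_apply, Pi.smul_apply, add_smul, smul_assoc]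
        rw [Finset.sum_add_distrib, ← Finset.smul_sum, ← Finset.smul_sum, h4, h4', smul_zero,
          smul_zero, add_zero])
    (fun z₀ => by
      obtain ⟨n, hn, J, hJ, hJO⟩ := hN z₀.1 z₀.2 z₀.2.2
      have hc : Continuous fun z : X × Icc 0 Λ => fun i => φ z.1 z.2 (v (J i)) :=
        (hφv J).comp (f := fun z : X × Icc 0 Λ => (z.1, (z.2 : ℝ))) (by fun_prop)
      have hU₁ := (hO.preimage hc).mem_nhds hJO
      have hU₂ : {z : X × Icc 0 Λ | N z₀.1 < N z.1 + 1} ∈ 𝓝 z₀ := by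
        have h : Continuous fun z : X × Icc 0 Λ => N z.1 + 1 := by fun_prop
        exact h.continuousAt.eventually (lt_mem_nhds (by simp))
      refine ⟨_, inter_mem hU₁ hU₂,
        fun z j => ∑ i, if J i = j then α (fun i => φ z.1 z.2 (v (J i))) i else 0, ?_, ?_⟩
      · refine continuousOn_pi.2 fun j => continuousOn_finsetSum _ fun i _ => ?_
        split_ifs
        · exact ((continuous_apply i).comp_continuousOn hα).comp hc.continuousOn fun z hz => hz.1
        · exact continuousOn_const
      · intro z hz
        obtain ⟨h0, h1, h2⟩ := hαO _ hz.1
        have hJm : ∀ i, J i < m z.1 := by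
          intro i
          have h : (J i : ℝ) < n := by exact_mod_cast hJ i
          refine Nat.lt_ceil.2 (h.trans (hn.trans_lt hz.2))
        refine ⟨fun j => Finset.sum_nonneg fun i _ => ?_, fun j hj => ?_, ?_, ?_⟩
        · split_ifs
          · exact h0 i
          · exact le_rfl
        · refine Finset.sum_eq_zero fun i _ => if_neg ?_
          rintro rfl
          have h : (J i : ℝ) < n := by exact_mod_cast hJ i
          exact absurd hj (not_le.2 (h.trans (hn.trans_lt hz.2)))
        · rw [Finset.sum_comm, ← h1]
          refine Finset.sum_congr rfl fun i _ => ?_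
          rw [Finset.sum_ite_eq, if_pos (Finset.mem_range.2 (hJm i))]
        · simp only [Finset.sum_smul]
          rw [Finset.sum_comm, ← h2]
          refine Finset.sum_congr rfl fun i _ => ?_
          simp only [ite_smul, zero_smul]
          rw [Finset.sum_ite_eq, if_pos (Finset.mem_range.2 (hJm i))])
  refine ⟨v, m, fun ξ σ => a (ξ, projIcc 0 Λ hΛ σ), fun ξ₀ => ⟨⌈N ξ₀ + 2⌉₊, ?_⟩, fun j => ?_,
    fun ξ σ => ?_⟩
  · have h : ∀ᶠ ξ in 𝓝 ξ₀, N ξ < N ξ₀ + 1 :=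
      N.continuous.continuousAt.eventually (gt_mem_nhds (by simp))
    exact h.mono fun ξ hξ => Nat.ceil_le_ceil (by linarith)
  · refine (continuous_apply j).comp (a.continuous.comp ?_)
    exact continuous_fst.prodMk (continuous_projIcc.comp continuous_snd)
  · obtain ⟨h1, h2, h3, h4⟩ := ha (ξ, projIcc 0 Λ hΛ σ)
    refine ⟨h1, fun j hj => h2 j (Nat.ceil_le.1 hj), h3, fun hσ => ?_⟩
    simp only [projIcc_of_mem hΛ hσ] at h4 ⊢
    exact h4

end Weights

/-! ### Rapidly switching smooth controls with small integrated defect. -/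

section Chattering

open MeasureTheory

/-- A smooth approximation of the indicator function of `[c, c']`, which is `0` outside of the
interval and `1` at distance `≥ w` from its complement. -/
noncomputable def bump (w c c' θ : ℝ) : ℝ :=
  Real.smoothTransition ((θ - c) / w) * Real.smoothTransition ((c' - θ) / w)

theorem bump_nonneg (w c c' θ : ℝ) : 0 ≤ bump w c c' θ :=
  mul_nonneg (Real.smoothTransition.nonneg _) (Real.smoothTransition.nonneg _)

theorem bump_le_one (w c c' θ : ℝ) : bump w c c' θ ≤ 1 :=
  mul_le_one₀ (Real.smoothTransition.le_one _) (Real.smoothTransition.nonneg _)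
    (Real.smoothTransition.le_one _)

theorem bump_of_le {w c c' θ : ℝ} (hw : 0 < w) (h : θ ≤ c) : bump w c c' θ = 0 := by
  rw [bump, Real.smoothTransition.zero_of_nonpos
    (div_nonpos_of_nonpos_of_nonneg (sub_nonpos.2 h) hw.le), zero_mul]

theorem bump_of_ge {w c c' θ : ℝ} (hw : 0 < w) (h : c' ≤ θ) : bump w c c' θ = 0 := by
  rw [bump, Real.smoothTransition.zero_of_nonpos (x := (c' - θ) / w)
    (div_nonpos_of_nonpos_of_nonneg (sub_nonpos.2 h) hw.le), mul_zero]

theorem bump_eq_one {w c c' θ : ℝ} (hw : 0 < w) (h : c + w ≤ θ) (h' : θ ≤ c' - w) :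
    bump w c c' θ = 1 := by
  rw [bump, Real.smoothTransition.one_of_one_le ((one_le_div hw).2 (by linarith)),
    Real.smoothTransition.one_of_one_le ((one_le_div hw).2 (by linarith)), mul_one]

theorem bump_self {w c : ℝ} (hw : 0 < w) (θ : ℝ) : bump w c c θ = 0 :=
  (le_total θ c).elim (bump_of_le hw) (bump_of_ge hw)

theorem jointC1_bump {Y : Type*} [TopologicalSpace Y] {w c c' : Y → ℝ} (hw : Continuous w)
    (hw0 : ∀ y, 0 < w y) (hc : Continuous c) (hc' : Continuous c') :
    JointC1 fun y θ => bump (w y) (c y) (c' y) θ := by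
  have hS : JointC1 fun (_ : Unit) t => Real.smoothTransition t :=
    JointC1.of_contDiff Real.smoothTransition.contDiff
  have hwi : Continuous fun y => (w y)⁻¹ := hw.inv₀ fun y => (hw0 y).ne'
  have h1 := hS.comp_affine (Y' := Y) (π := fun _ => ()) (by fun_prop) hwi
    (β := fun y => -(c y * (w y)⁻¹)) (by fun_prop)
  have h2 := hS.comp_affine (Y' := Y) (π := fun _ => ()) (by fun_prop) hwi.neg
    (β := fun y => c' y * (w y)⁻¹) (by fun_prop)
  convert! h1.smul h2 using 3 with y θ
  rw [bump, smul_eq_mul]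
  congr 2 <;> · simp only [div_eq_mul_inv, Pi.neg_apply]; ring

variable {E U : Type*} [NormedAddCommGroup E] [NormedSpace ℝ E]
  [NormedAddCommGroup U] [NormedSpace ℝ U]

/-- The integrand is bounded by `2 * M` and vanishes at distance at least `w` from both ends, so it
lives on a set of length at most `2 * w`. If the interval is shorter than that, its whole length is
charged. -/
theorem norm_integral_bump_sub_le {ψ : U → E} (hψ : Continuous ψ) {M R : ℝ}
    (hM : ∀ u, ‖u‖ ≤ R → ‖ψ u‖ ≤ M) {v : U} (hv : ‖v‖ ≤ R) {w c c' : ℝ} (hw : 0 < w)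
    (hc : c ≤ c') :
    ‖∫ θ in c..c', (ψ (bump w c c' θ • v) - ψ v)‖ ≤ 4 * M * w := by
  set g : ℝ → E := fun θ => ψ (bump w c c' θ • v) - ψ v with hg
  have hM0 : 0 ≤ M := (norm_nonneg _).trans (hM v hv)
  have hbc : Continuous fun θ => bump w c c' θ :=
    (jointC1_bump (Y := Unit) (w := fun _ => w) (c := fun _ => c) (c' := fun _ => c')
      continuous_const (fun _ => hw) continuous_const continuous_const).continuous.comp
      (f := fun θ : ℝ => ((), θ)) (by fun_prop)
  have hgc : Continuous g := by fun_prop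
  have hgi : ∀ a b, IntervalIntegrable g volume a b := fun a b => hgc.intervalIntegrable a b
  have hg2 : ∀ θ, ‖g θ‖ ≤ 2 * M := by
    intro θ
    refine (norm_sub_le _ _).trans ?_
    have h1 : ‖bump w c c' θ • v‖ ≤ R := by
      rw [norm_smul, Real.norm_of_nonneg (bump_nonneg _ _ _ _)]
      exact (mul_le_of_le_one_left (norm_nonneg _) (bump_le_one _ _ _ _)).trans hv
    linarith [hM _ h1, hM v hv]
  have hlen : ∀ a b, a ≤ b → ‖∫ θ in a..b, g θ‖ ≤ 2 * M * (b - a) := by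
    intro a b hab
    have := intervalIntegral.norm_integral_le_of_norm_le_const (a := a) (b := b) (f := g)
      fun θ _ => hg2 θ
    rwa [abs_of_nonneg (sub_nonneg.2 hab)] at this
  rcases le_total (c' - c) (2 * w) with h | h
  · refine (hlen c c' hc).trans ?_
    nlinarith
  · have hmid : ∫ θ in (c + w)..(c' - w), g θ = 0 := by
      rw [← intervalIntegral.integral_zero (a := c + w) (b := c' - w) (μ := volume)]
      refine intervalIntegral.integral_congr fun θ hθ => ?_
      rw [uIcc_of_le (by linarith)] at hθ
      simp [hg, bump_eq_one hw hθ.1 hθ.2]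
    rw [← intervalIntegral.integral_add_adjacent_intervals (hgi c (c + w)) (hgi _ _),
      ← intervalIntegral.integral_add_adjacent_intervals (hgi (c + w) (c' - w)) (hgi _ _),
      hmid, zero_add]
    refine (norm_add_le _ _).trans ?_
    have h1 := hlen c (c + w) (by linarith)
    have h2 := hlen (c' - w) c' (by linarith)
    nlinarith

/-- The curve that dwells at the points `v 0, …, v (m - 1)` during the consecutive intervals
`[C j, C (j + 1)]`, up to transitions of length `w`. -/
noncomputable def dwell (w : ℝ) (C : ℕ → ℝ) (m : ℕ) (v : ℕ → U) (θ : ℝ) : U :=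
  ∑ j ∈ Finset.range m, bump w (C j) (C (j + 1)) θ • v j

theorem dwell_eq {w : ℝ} (hw : 0 < w) {C : ℕ → ℝ} (hC : Monotone C) {m : ℕ} (v : ℕ → U) {θ : ℝ}
    {j : ℕ} (hj : j < m) (h : C j ≤ θ) (h' : θ ≤ C (j + 1)) :
    dwell w C m v θ = bump w (C j) (C (j + 1)) θ • v j := by
  refine Finset.sum_eq_single j (fun i _ hij => ?_) fun hj' => ?_
  · rcases hij.lt_or_gt with hij | hij
    · rw [bump_of_ge hw ((hC hij).trans h), zero_smul]
    · rw [bump_of_le hw (h'.trans (hC hij)), zero_smul]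
  · exact absurd (Finset.mem_range.2 hj) hj'

theorem dwell_of_le {w : ℝ} (hw : 0 < w) {C : ℕ → ℝ} (hC : Monotone C) (m : ℕ) (v : ℕ → U) {θ : ℝ}
    (h : θ ≤ C 0) : dwell w C m v θ = 0 :=
  Finset.sum_eq_zero fun j _ => by rw [bump_of_le hw (h.trans (hC (Nat.zero_le j))), zero_smul]

theorem dwell_of_ge {w : ℝ} (hw : 0 < w) {C : ℕ → ℝ} (hC : Monotone C) (m : ℕ) (v : ℕ → U) {θ : ℝ}
    (h : C m ≤ θ) : dwell w C m v θ = 0 :=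
  Finset.sum_eq_zero fun j hj => by
    rw [bump_of_ge hw ((hC (Finset.mem_range.1 hj)).trans h), zero_smul]

/-- The bumps have disjoint supports apart from end points, so at most one summand is alive at a
time and the norms do not add up. -/
theorem norm_dwell_le {w : ℝ} (hw : 0 < w) {C : ℕ → ℝ} (hC : Monotone C) {m : ℕ} {v : ℕ → U}
    {R : ℝ} (hR : 0 ≤ R) (hv : ∀ j < m, ‖v j‖ ≤ R) (θ : ℝ) : ‖dwell w C m v θ‖ ≤ R := by
  induction m with
  | zero => simpa [dwell] using hR
  | succ m ih =>
    have hsucc : dwell w C (m + 1) v θ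
        = dwell w C m v θ + bump w (C m) (C (m + 1)) θ • v m := Finset.sum_range_succ _ _
    rw [hsucc]
    rcases le_total θ (C m) with h | h
    · rw [bump_of_le hw h, zero_smul, add_zero]
      exact ih fun j hj => hv j (hj.trans (Nat.lt_succ_self m))
    · rw [dwell_of_ge hw hC m v h, zero_add, norm_smul, Real.norm_of_nonneg (bump_nonneg _ _ _ _)]
      exact (mul_le_of_le_one_left (norm_nonneg _) (bump_le_one _ _ _ _)).trans
        (hv m (Nat.lt_succ_self m))

theorem continuous_dwell {w : ℝ} (hw : 0 < w) (C : ℕ → ℝ) (m : ℕ) (v : ℕ → U) :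
    Continuous (dwell w C m v) := by
  refine continuous_finsetSum _ fun j _ => Continuous.smul ?_ continuous_const
  exact (jointC1_bump (Y := Unit) (w := fun _ => w) (c := fun _ => C j) (c' := fun _ => C (j + 1))
      continuous_const (fun _ => hw) continuous_const continuous_const).continuous.comp
      (f := fun θ : ℝ => ((), θ)) (by fun_prop)

/-- On its own dwelling interval each point acts alone, so the integral is the weighted sum of the
values up to the transition errors of the individual intervals. -/
theorem norm_integral_dwell_sub_le [CompleteSpace E] {ψ : U → E} (hψ : Continuous ψ) {M R : ℝ}
    (hM : ∀ u, ‖u‖ ≤ R → ‖ψ u‖ ≤ M) {w : ℝ} (hw : 0 < w) {C : ℕ → ℝ} (hC : Monotone C) {m : ℕ}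
    {v : ℕ → U} (hv : ∀ j < m, ‖v j‖ ≤ R) :
    ‖(∫ θ in C 0..C m, ψ (dwell w C m v θ))
      - ∑ j ∈ Finset.range m, (C (j + 1) - C j) • ψ (v j)‖ ≤ m * (4 * M * w) := by
  have hi : ∀ a b, IntervalIntegrable (fun θ => ψ (dwell w C m v θ)) volume a b := fun a b =>
    (hψ.comp (continuous_dwell hw C m v)).intervalIntegrable a b
  rw [← intervalIntegral.sum_integral_adjacent_intervals fun k _ => hi _ _,
    ← Finset.sum_sub_distrib]
  refine (norm_sum_le _ _).trans ?_
  rw [← nsmul_eq_mul]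
  refine (Finset.sum_le_card_nsmul _ _ (4 * M * w) fun j hj => ?_).trans_eq (by simp)
  have hj' := Finset.mem_range.1 hj
  have h1 : ∫ θ in C j..C (j + 1), ψ (dwell w C m v θ)
      = ∫ θ in C j..C (j + 1), ψ (bump w (C j) (C (j + 1)) θ • v j) := by
    refine intervalIntegral.integral_congr fun θ hθ => ?_
    rw [uIcc_of_le (hC (Nat.le_succ j))] at hθ
    simp only [dwell_eq hw hC v hj' hθ.1 hθ.2]
  have hbc : Continuous fun θ => bump w (C j) (C (j + 1)) θ :=
    (jointC1_bump (Y := Unit) (w := fun _ => w) (c := fun _ => C j) (c' := fun _ => C (j + 1))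
      continuous_const (fun _ => hw) continuous_const continuous_const).continuous.comp
      (f := fun θ : ℝ => ((), θ)) (by fun_prop)
  have h2 := norm_integral_bump_sub_le hψ hM (hv j hj') hw (hC (Nat.le_succ j))
  rw [intervalIntegral.integral_sub
    ((by fun_prop : Continuous fun θ => ψ (bump w (C j) (C (j + 1)) θ • v j)).intervalIntegrable _ _)
    intervalIntegrable_const, intervalIntegral.integral_const, ← h1] at h2
  exact h2

variable {X : Type*} [MetricSpace X] [FiniteDimensional ℝ E] [ProperSpace U]

/-- Chattering controls: for a family of maps `φ ξ σ` onto `E` there are smooth controls, depending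
continuously on `ξ` and on a period `h`, along which the integrals of `φ` are uniformly small as
`h → 0`. -/
theorem exists_chattering {Λ : ℝ} (hΛ : 0 ≤ Λ) {φ : X → ℝ → U → E}
    (hφ : Continuous fun q : X × ℝ × U => φ q.1 q.2.1 q.2.2)
    (hsurj : ∀ ξ σ, Function.Surjective (φ ξ σ)) :
    ∃ V : X × Ioi (0 : ℝ) → ℝ → U, JointC1 V ∧ ∀ ξ₀,
      (∃ R, ∀ᶠ ξ in 𝓝 ξ₀, ∀ h σ, ‖V (ξ, h) σ‖ ≤ R) ∧
      ∀ ε > 0, ∃ h₀ > 0, ∀ᶠ ξ in 𝓝 ξ₀, ∀ h : Ioi (0 : ℝ), (h : ℝ) ≤ h₀ → ∀ σ ∈ Icc 0 Λ,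
        ‖∫ s in (0 : ℝ)..σ, φ ξ s (V (ξ, h) s)‖ ≤ ε := by
  have := FiniteDimensional.complete ℝ E
  obtain ⟨v, m, a, hm, ha, haw⟩ := exists_relaxed_weights hΛ hφ hsurj
  -- The period `[k h, (k + 1) h]` is divided in proportion to the weights, frozen at its left end
  -- `k h`. That the weights sum to `1` makes the division exhaust the period.
  set C : X × Ioi (0 : ℝ) → ℕ → ℕ → ℝ := fun q k j =>
    k * (q.2 : ℝ) + q.2 * ∑ i ∈ Finset.range j, a q.1 (k * q.2) i with hC
  have hCmono : ∀ q k, Monotone (C q k) := fun q k => monotone_nat_of_le_succ fun j => by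
    have h1 := (haw q.1 (k * q.2)).1 j
    have h2 : (0 : ℝ) < q.2 := q.2.2
    simp only [hC, Finset.sum_range_succ]
    nlinarith
  have hC0 : ∀ q k, C q k 0 = k * q.2 := fun q k => by simp [hC]
  have hCm : ∀ q k, C q k (m q.1) = (k + 1) * q.2 := fun q k => by
    simp only [hC]
    rw [(haw q.1 (k * q.2)).2.2.1]; ring
  have hCc : ∀ k j, Continuous fun q => C q k j := fun k j => by
    have h1 : ∀ i, Continuous fun q : X × Ioi (0 : ℝ) => a q.1 (k * q.2) i := fun i =>
      (ha i).comp (f := fun q : X × Ioi (0 : ℝ) => (q.1, k * (q.2 : ℝ))) (by fun_prop)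
    have h2 := continuous_finsetSum (Finset.range j) fun i _ => h1 i
    exact Continuous.add (by fun_prop) (Continuous.mul (by fun_prop) h2)
  have hw : ∀ h : Ioi (0 : ℝ), 0 < (h : ℝ) ^ 2 := fun h => pow_pos h.2 2
  -- The transition width `h ^ 2` makes the transition error of one period of order `h ^ 2`, which
  -- is negligible after summing about `Λ / h` periods.
  set B : X × Ioi (0 : ℝ) → ℕ → ℝ → U := fun q k => dwell ((q.2 : ℝ) ^ 2) (C q k) (m q.1) v with hB
  have hBle : ∀ q (k : ℕ) σ, σ ≤ k * (q.2 : ℝ) → B q k σ = 0 := fun q k σ hσ =>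
    dwell_of_le (hw _) (hCmono q k) _ _ (by rwa [hC0])
  have hBge : ∀ q (k : ℕ) σ, (k + 1) * (q.2 : ℝ) ≤ σ → B q k σ = 0 := fun q k σ hσ =>
    dwell_of_ge (hw _) (hCmono q k) _ _ (by rwa [hCm])
  set V : X × Ioi (0 : ℝ) → ℝ → U := fun q σ => B q ⌊σ / q.2⌋₊ σ with hV
  -- Each `B q k` vanishes outside its own period. The jump of the floor function is therefore
  -- invisible, and `V` is locally a finite sum of bumps.
  have hVsum : ∀ q (K : ℕ) σ, σ < K * (q.2 : ℝ) → V q σ = ∑ k ∈ Finset.range K, B q k σ := by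
    intro q K σ hσ
    have hq : (0 : ℝ) < q.2 := q.2.2
    symm
    refine Finset.sum_eq_single _ (fun k _ hk => ?_) fun hK => ?_
    · rcases hk.lt_or_gt with hk | hk
      · refine hBge q k σ ?_
        have h1 : ((k + 1 : ℕ) : ℝ) ≤ σ / q.2 :=
          (Nat.le_floor_iff' (Nat.succ_ne_zero k)).1 hk
        rw [le_div_iff₀ hq] at h1
        exact_mod_cast h1
      · refine hBle q k σ ?_
        have h1 := Nat.lt_of_floor_lt hk
        rw [div_lt_iff₀ hq] at h1
        exact h1.le
    · rw [Finset.mem_range, not_lt] at hK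
      refine hBle q _ σ (hσ.le.trans ?_)
      gcongr
  have hVk : ∀ q (k : ℕ) σ, σ ∈ Icc (k * (q.2 : ℝ)) ((k + 1 : ℕ) * q.2) → V q σ = B q k σ := by
    intro q k σ hσ
    have hq : (0 : ℝ) < q.2 := q.2.2
    rw [hVsum q (k + 2) σ]
    · refine Finset.sum_eq_single _ (fun i _ hi => ?_) fun hK => ?_
      · rcases hi.lt_or_gt with hi | hi
        · refine hBge q i σ (le_trans ?_ hσ.1)
          have : (i : ℝ) + 1 ≤ k := by exact_mod_cast hi
          gcongr
        · refine hBle q i σ (hσ.2.trans ?_)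
          have : ((k + 1 : ℕ) : ℝ) ≤ i := by exact_mod_cast hi
          gcongr
      · exact absurd (Finset.mem_range.2 (by omega)) hK
    · refine hσ.2.trans_lt ?_
      push_cast
      nlinarith
  have hVC1 : JointC1 V := by
    refine JointC1.congr_local fun q₀ σ₀ => ?_
    obtain ⟨M, hM⟩ := hm q₀.1
    obtain ⟨K, hK⟩ := exists_nat_gt (σ₀ / q₀.2)
    have hq₀ : (0 : ℝ) < q₀.2 := q₀.2.2
    rw [div_lt_iff₀ hq₀] at hK
    refine ⟨fun q σ => ∑ k ∈ Finset.range K, ∑ j ∈ Finset.range M,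
      bump ((q.2 : ℝ) ^ 2) (C q k j) (C q k (j + 1)) σ • v j,
      JointC1.sum _ fun k _ => JointC1.sum _ fun j _ =>
        (jointC1_bump (by fun_prop) (fun q => hw q.2) (hCc k j) (hCc k (j + 1))).smul
          (JointC1.const continuous_const), ?_⟩
    have h1 : ∀ᶠ q : (X × Ioi (0 : ℝ)) × ℝ in 𝓝 (q₀, σ₀), m q.1.1 ≤ M := by
      have h : Continuous fun q : (X × Ioi (0 : ℝ)) × ℝ => q.1.1 := by fun_prop
      exact (h.tendsto (q₀, σ₀)).eventually hM
    have h2 : ∀ᶠ q : (X × Ioi (0 : ℝ)) × ℝ in 𝓝 (q₀, σ₀), q.2 < K * (q.1.2 : ℝ) := by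
      have h : Continuous fun q : (X × Ioi (0 : ℝ)) × ℝ => (K : ℝ) * q.1.2 := by fun_prop
      exact continuous_snd.continuousAt.eventually_lt h.continuousAt hK
    filter_upwards [h1, h2] with q hq1 hq2
    rw [hVsum q.1 K q.2 hq2]
    refine Finset.sum_congr rfl fun k _ => ?_
    refine Finset.sum_subset (Finset.range_mono hq1) fun j _ hj => ?_
    rw [Finset.mem_range, not_lt] at hj
    -- An index beyond `m` has weight `0`, so its dwelling interval is degenerate and its bump
    -- vanishes. For this reason the discontinuous count `m` does no harm.
    have h3 : C q.1 k (j + 1) = C q.1 k j := by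
      simp only [hC, Finset.sum_range_succ, (haw q.1.1 (k * q.1.2)).2.1 j hj, add_zero]
    rw [h3, bump_self (hw _), zero_smul]
  refine ⟨V, hVC1, fun ξ₀ => ?_⟩
  obtain ⟨M, hM⟩ := hm ξ₀
  set R : ℝ := ∑ j ∈ Finset.range M, ‖v j‖ with hR
  have hR0 : 0 ≤ R := Finset.sum_nonneg fun j _ => norm_nonneg _
  have hvR : ∀ j < M, ‖v j‖ ≤ R := fun j hj =>
    Finset.single_le_sum (f := fun j => ‖v j‖) (fun j _ => norm_nonneg _) (Finset.mem_range.2 hj)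
  have hVR : ∀ ξ, m ξ ≤ M → ∀ h σ, ‖V (ξ, h) σ‖ ≤ R := fun ξ hξ h σ =>
    norm_dwell_le (hw _) (hCmono _ _) hR0 (fun j hj => hvR j (hj.trans_le hξ)) σ
  refine ⟨⟨R, hM.mono hVR⟩, fun ε hε => ?_⟩
  -- The budget: `4 * ε' * h` for each complete period, hence `4 * ε' * Λ` in total, plus `ε'` for
  -- the incomplete last period.
  set ε' : ℝ := ε / (4 * Λ + 1) with hε'
  have hε'0 : 0 < ε' := by positivity
  set K : Set (ℝ × U) := Icc 0 Λ ×ˢ Metric.closedBall 0 R with hK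
  have hKc : IsCompact K := isCompact_Icc.prod (isCompact_closedBall _ _)
  have hφ₀ : Continuous fun q : ℝ × U => φ ξ₀ q.1 q.2 :=
    hφ.comp (f := fun q : ℝ × U => (ξ₀, q)) (by fun_prop)
  obtain ⟨M₀, hM₀⟩ := hKc.exists_bound_of_continuousOn hφ₀.continuousOn
  have hunif : ∀ᶠ ξ in 𝓝 ξ₀, ∀ q ∈ K, ‖φ ξ q.1 q.2 - φ ξ₀ q.1 q.2‖ < min 1 ε' := by
    obtain ⟨s, hs, hs'⟩ := hKc.mem_uniformity_of_prod
      (f := fun (ξ : X) (q : ℝ × U) => φ ξ q.1 q.2) (s := univ) hφ.continuousOn (mem_univ ξ₀)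
      (Metric.dist_mem_uniformity (show 0 < min 1 ε' by positivity))
    rw [nhdsWithin_univ] at hs
    filter_upwards [hs] with ξ hξ q hq
    have := hs' ξ hξ q hq
    rwa [mem_ofPred_eq, dist_eq_norm] at this
  obtain ⟨δ, hδ, hδK⟩ := Metric.uniformContinuousOn_iff.1
    (hKc.uniformContinuousOn_of_continuous hφ₀.continuousOn) ε' hε'0
  set M₁ : ℝ := |M₀| + 1 with hM₁
  have hM₁0 : 0 < M₁ := by positivity
  -- The first bound controls the oscillation of `φ` in time over one period. The second covers the
  -- transitions and the incomplete period.
  refine ⟨min (δ / 2) (ε' / (4 * M * M₁ + M₁)), by positivity, ?_⟩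
  filter_upwards [hM, hunif] with ξ hξm hξ h hh σ hσ
  have hh0 : (0 : ℝ) < h := h.2
  have hhδ : (h : ℝ) < δ := by linarith [hh.trans (min_le_left _ _)]
  have hhε : (4 * M * M₁ + M₁) * h ≤ ε' := by
    have := hh.trans (min_le_right _ _)
    rwa [le_div_iff₀ (by positivity), mul_comm] at this
  have hMM₁ : 0 ≤ 4 * (M : ℝ) * M₁ * h := by positivity
  have hbd : ∀ s ∈ Icc 0 Λ, ∀ u, ‖u‖ ≤ R → ‖φ ξ s u‖ ≤ M₁ := by
    intro s hs u hu
    have hmem : (s, u) ∈ K := ⟨hs, mem_closedBall_zero_iff.2 hu⟩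
    have h1 := hξ _ hmem
    have h2 := hM₀ _ hmem
    have h3 := norm_add_le (φ ξ s u - φ ξ₀ s u) (φ ξ₀ s u)
    rw [sub_add_cancel] at h3
    have h4 : min 1 ε' ≤ 1 := min_le_left _ _
    have h5 := le_abs_self M₀
    simp only at h1 h2
    linarith
  have hosc : ∀ s ∈ Icc 0 Λ, ∀ s' ∈ Icc 0 Λ, |s - s'| ≤ h → ∀ u, ‖u‖ ≤ R →
      ‖φ ξ s u - φ ξ s' u‖ ≤ 3 * ε' := by
    intro s hs s' hs' hss u hu
    have hmem : (s, u) ∈ K := ⟨hs, mem_closedBall_zero_iff.2 hu⟩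
    have hmem' : (s', u) ∈ K := ⟨hs', mem_closedBall_zero_iff.2 hu⟩
    have h1 := (hξ _ hmem).le.trans (min_le_right _ _)
    have h2 := (hξ _ hmem').le.trans (min_le_right _ _)
    have h3 := hδK _ hmem _ hmem' (by
      rw [Prod.dist_eq, dist_self, max_eq_left dist_nonneg, Real.dist_eq]
      exact hss.trans_lt hhδ)
    rw [dist_eq_norm] at h3
    simp only at h1 h2 h3
    have h4 : φ ξ s u - φ ξ s' u = (φ ξ s u - φ ξ₀ s u) + (φ ξ₀ s u - φ ξ₀ s' u)
        - (φ ξ s' u - φ ξ₀ s' u) := by abel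
    rw [h4]
    refine (norm_sub_le _ _).trans ((add_le_add_left (norm_add_le _ _) _).trans ?_)
    linarith
  have hVcont : Continuous (V (ξ, h)) :=
    hVC1.continuous.comp (f := fun σ : ℝ => ((ξ, h), σ)) (by fun_prop)
  have hic : Continuous fun s => φ ξ s (V (ξ, h) s) :=
    hφ.comp (f := fun s : ℝ => (ξ, s, V (ξ, h) s)) (by fun_prop)
  have hperiod : ∀ k : ℕ, ((k + 1 : ℕ) : ℝ) * h ≤ Λ →
      ‖∫ s in (k : ℝ) * h..((k + 1 : ℕ) : ℝ) * h, φ ξ s (V (ξ, h) s)‖ ≤ 4 * ε' * h := by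
    intro k hk
    have hk0 : (0 : ℝ) ≤ k * h := by positivity
    have hkk : (k : ℝ) * h ≤ ((k + 1 : ℕ) : ℝ) * h := by
      push_cast
      nlinarith
    have hkmem : (k : ℝ) * h ∈ Icc 0 Λ := ⟨hk0, hkk.trans hk⟩
    set ψ : U → E := φ ξ (k * h) with hψ
    have hψc : Continuous ψ := hφ.comp (f := fun u : U => (ξ, (k : ℝ) * h, u)) (by fun_prop)
    have hψV : Continuous fun s => ψ (V (ξ, h) s) := hψc.comp hVcont
    have h1 := norm_integral_dwell_sub_le hψc (hbd _ hkmem) (hw h) (hCmono (ξ, h) k)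
      (fun j hj => hvR j (hj.trans_le hξm))
    -- With time frozen at the start of the period, the weighted sum is exactly the vanishing
    -- average, so only transition and freezing errors remain.
    have h2 : ∑ j ∈ Finset.range (m ξ), (C (ξ, h) k (j + 1) - C (ξ, h) k j) • ψ (v j) = 0 := by
      have h3 := (haw ξ (k * h)).2.2.2 hkmem
      have h4 : ∀ j, C (ξ, h) k (j + 1) - C (ξ, h) k j = h * a ξ (k * h) j := fun j => by
        simp only [hC, Finset.sum_range_succ]; ring
      simp only [h4, mul_smul]
      rw [← Finset.smul_sum, h3, smul_zero]
    have hCm' := hCm (ξ, h) k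
    simp only [h2, sub_zero, hC0, hCm'] at h1
    have h5 : ∫ s in (k : ℝ) * h..((k + 1 : ℕ) : ℝ) * h, ψ (V (ξ, h) s)
        = ∫ s in (k : ℝ) * h..((k : ℝ) + 1) * h,
          ψ (dwell ((h : ℝ) ^ 2) (C (ξ, h) k) (m ξ) v s) := by
      rw [Nat.cast_succ]
      refine intervalIntegral.integral_congr fun s hs => ?_
      rw [uIcc_of_le (by exact_mod_cast hkk)] at hs
      rw [hVk (ξ, h) k s (by exact_mod_cast hs)]
    have h6 : ‖∫ s in (k : ℝ) * h..((k + 1 : ℕ) : ℝ) * h,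
        (φ ξ s (V (ξ, h) s) - ψ (V (ξ, h) s))‖ ≤ 3 * ε' * h := by
      have h7 := intervalIntegral.norm_integral_le_of_norm_le_const (a := (k : ℝ) * h)
        (b := ((k + 1 : ℕ) : ℝ) * h) (C := 3 * ε')
        (f := fun s => φ ξ s (V (ξ, h) s) - ψ (V (ξ, h) s)) fun s hs => by
          rw [uIoc_of_le hkk] at hs
          refine hosc s ⟨hk0.trans hs.1.le, hs.2.trans hk⟩ _ hkmem ?_ _ (hVR ξ hξm h s)
          rw [abs_of_nonneg (by linarith [hs.1])]
          have := hs.2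
          push_cast at this
          linarith
      have h8 : ((k + 1 : ℕ) : ℝ) * h - k * h = h := by push_cast; ring
      rwa [h8, abs_of_pos hh0] at h7
    have h9 := norm_add_le (∫ s in (k : ℝ) * h..((k + 1 : ℕ) : ℝ) * h,
        (φ ξ s (V (ξ, h) s) - ψ (V (ξ, h) s)))
      (∫ s in (k : ℝ) * h..((k + 1 : ℕ) : ℝ) * h, ψ (V (ξ, h) s))
    rw [intervalIntegral.integral_sub (hic.intervalIntegrable _ _)
      (hψV.intervalIntegrable _ _), sub_add_cancel] at h9
    rw [intervalIntegral.integral_sub (hic.intervalIntegrable _ _)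
      (hψV.intervalIntegrable _ _)] at h6
    rw [← h5] at h1
    have h10 : (m ξ : ℝ) * (4 * M₁ * (h : ℝ) ^ 2) ≤ ε' * h := by
      have h11 : (m ξ : ℝ) ≤ M := by exact_mod_cast hξm
      have h12 : 4 * (M : ℝ) * M₁ * h ≤ ε' := by nlinarith
      calc (m ξ : ℝ) * (4 * M₁ * (h : ℝ) ^ 2) ≤ M * (4 * M₁ * (h : ℝ) ^ 2) := by gcongr
        _ = 4 * (M : ℝ) * M₁ * h * h := by ring
        _ ≤ ε' * h := by gcongr
    linarith
  set n : ℕ := ⌊σ / h⌋₊ with hn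
  have hn1 : (n : ℝ) * h ≤ σ := by
    rw [← le_div_iff₀ hh0]
    exact Nat.floor_le (div_nonneg hσ.1 hh0.le)
  have hn2 : σ < (n + 1) * h := by
    rw [← div_lt_iff₀ hh0]
    exact Nat.lt_floor_add_one _
  have hsum : ‖∫ s in (0 : ℝ)..n * h, φ ξ s (V (ξ, h) s)‖ ≤ n * (4 * ε' * h) := by
    have h1 := intervalIntegral.sum_integral_adjacent_intervals (n := n)
      (a := fun k : ℕ => (k : ℝ) * h) (f := fun s => φ ξ s (V (ξ, h) s)) (μ := volume)
      fun k _ => hic.intervalIntegrable _ _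
    rw [Nat.cast_zero, zero_mul] at h1
    rw [← h1, ← nsmul_eq_mul]
    refine (norm_sum_le _ _).trans
      ((Finset.sum_le_card_nsmul _ _ (4 * ε' * h) fun k hk => ?_).trans_eq (by simp))
    refine hperiod k (le_trans ?_ (hn1.trans hσ.2))
    have : ((k + 1 : ℕ) : ℝ) ≤ n := by exact_mod_cast Finset.mem_range.1 hk
    gcongr
  have hrest : ‖∫ s in (n : ℝ) * h..σ, φ ξ s (V (ξ, h) s)‖ ≤ M₁ * h := by
    have h7 := intervalIntegral.norm_integral_le_of_norm_le_const (a := (n : ℝ) * h)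
      (b := σ) (C := M₁) (f := fun s => φ ξ s (V (ξ, h) s)) fun s hs => by
        rw [uIoc_of_le hn1] at hs
        exact hbd s ⟨(by positivity : (0 : ℝ) ≤ n * h).trans hs.1.le, hs.2.trans hσ.2⟩ _
          (hVR ξ hξm h s)
    rw [abs_of_nonneg (sub_nonneg.2 hn1)] at h7
    refine h7.trans ?_
    gcongr
    linarith
  rw [← intervalIntegral.integral_add_adjacent_intervals (hic.intervalIntegrable 0 (n * h))
    (hic.intervalIntegrable _ _)]
  refine (norm_add_le _ _).trans ((add_le_add hsum hrest).trans ?_)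
  have h1 : (n : ℝ) * (4 * ε' * h) ≤ 4 * ε' * Λ := by
    have : (n : ℝ) * h ≤ Λ := hn1.trans hσ.2
    nlinarith
  have h2 : M₁ * h ≤ ε' := by nlinarith
  have h3 : ε' * (4 * Λ + 1) = ε := div_mul_cancel₀ _ (by positivity)
  linarith

end Chattering

/-! ### Regularity of the single components, deduced from that of the full field. -/

section Regularity

open Metric
open scoped NNReal

/-- Changing first one variable and then the other reduces the claim to two mean value inequalities,
so joint differentiability is never needed. The factor 2 counts the two moves. -/
theorem norm_sub_sub_le_of_partial_fderiv {A B C : Type*} [NormedAddCommGroup A] [NormedSpace ℝ A]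
    [NormedAddCommGroup B] [NormedSpace ℝ B] [NormedAddCommGroup C] [NormedSpace ℝ C]
    {F : A → B → C} {s : Set A} {s' : Set B} (hs : Convex ℝ s) (hs' : Convex ℝ s')
    (hA : ∀ x ∈ s, ∀ u ∈ s', DifferentiableAt ℝ (fun x => F x u) x)
    (hB : ∀ x ∈ s, ∀ u ∈ s', DifferentiableAt ℝ (fun u => F x u) u)
    {DA : A →L[ℝ] C} {DB : B →L[ℝ] C} {κ : ℝ}
    (hDA : ∀ x ∈ s, ∀ u ∈ s', ‖fderiv ℝ (fun x => F x u) x - DA‖ ≤ κ)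
    (hDB : ∀ x ∈ s, ∀ u ∈ s', ‖fderiv ℝ (fun u => F x u) u - DB‖ ≤ κ)
    {q q' : A × B} (hq : q ∈ s ×ˢ s') (hq' : q' ∈ s ×ˢ s') :
    ‖F q.1 q.2 - F q'.1 q'.2 - DA.coprod DB (q - q')‖ ≤ 2 * κ * ‖q - q'‖ := by
  have h1 := hs.norm_image_sub_le_of_norm_fderiv_le' (f := fun x => F x q.2)
    (fun x hx => hA x hx _ hq.2) (fun x hx => hDA x hx _ hq.2) hq'.1 hq.1
  have h2 := hs'.norm_image_sub_le_of_norm_fderiv_le' (f := fun u => F q'.1 u)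
    (fun u hu => hB _ hq'.1 u hu) (fun u hu => hDB _ hq'.1 u hu) hq'.2 hq.2
  have hκ : 0 ≤ κ := (norm_nonneg _).trans (hDA _ hq.1 _ hq.2)
  have h3 : F q.1 q.2 - F q'.1 q'.2 - DA.coprod DB (q - q')
      = (F q.1 q.2 - F q'.1 q.2 - DA (q.1 - q'.1))
        + (F q'.1 q.2 - F q'.1 q'.2 - DB (q.2 - q'.2)) := by
    simp only [ContinuousLinearMap.coprod_apply, Prod.fst_sub, Prod.snd_sub]
    abel
  rw [h3]
  refine (norm_add_le _ _).trans ?_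
  have h4 : ‖q.1 - q'.1‖ ≤ ‖q - q'‖ := norm_fst_le (q - q')
  have h5 : ‖q.2 - q'.2‖ ≤ ‖q - q'‖ := norm_snd_le (q - q')
  have h6 := mul_le_mul_of_nonneg_left h4 hκ
  have h7 := mul_le_mul_of_nonneg_left h5 hκ
  linarith

variable {m : ℕ → ℕ}

theorem extend_of_lt {r : ℕ} (x : State m r) (v : Block m r) {j : ℕ} (h : j < r)
    (h' : j < r + 1) : extend x v ⟨j, h'⟩ = x ⟨j, h⟩ :=
  Fin.snoc_castSucc (α := fun j : Fin (r + 1) => Block m j) v x ⟨j, h⟩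

theorem extend_last {r : ℕ} (x : State m r) (v : Block m r) (h : r < r + 1) :
    extend x v ⟨r, h⟩ = v :=
  Fin.snoc_last (α := fun j : Fin (r + 1) => Block m j) v x

theorem norm_trunc_le {r s : ℕ} (h : r ≤ s) (x : State m s) : ‖trunc h x‖ ≤ ‖x‖ :=
  (pi_norm_le_iff_of_nonneg (norm_nonneg _)).2 fun j => norm_le_pi_norm x (Fin.castLE h j)

/-- The linear map that completes a tuple of `i` blocks by zero blocks to a tuple of `ν` blocks. -/
noncomputable def padBlocks (m : ℕ → ℕ) (i ν : ℕ) : State m i →L[ℝ] State m ν :=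
  ContinuousLinearMap.pi fun j : Fin ν =>
    if h : (j : ℕ) < i then
      ContinuousLinearMap.proj (R := ℝ) (φ := fun k : Fin i => Block m k) ⟨j, h⟩ else 0

theorem padBlocks_apply_of_lt {i ν : ℕ} (z : State m i) {j : ℕ} (hj : j < i) (hj' : j < ν) :
    padBlocks m i ν z ⟨j, hj'⟩ = z ⟨j, hj⟩ := by
  simp [padBlocks, hj]

variable {ν : ℕ} {f : (i : ℕ) → ℝ → State m (i + 2) → Block m i} {t₀ T : ℝ}

/-- The first `ν` blocks and the last block of a tuple of `ν + 1` blocks. -/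
def splitLast {ν : ℕ} (x : State m (ν + 1)) : State m ν × Block m ν :=
  (trunc (Nat.le_succ ν) x, x ⟨ν, Nat.lt_succ_self ν⟩)

/-- Each component of the triangular right-hand side factors through the full right-hand side. -/
theorem exists_component_eq {i : ℕ} (hi : i < ν) (xs : State m (ν + 1)) :
    ∃ A : State m (i + 2) →L[ℝ] State m ν × Block m ν, ∀ t z,
      f i t z = field f ν t
        (splitLast xs + A (z - trunc (Nat.succ_le_succ hi) xs)).1
        (splitLast xs + A (z - trunc (Nat.succ_le_succ hi) xs)).2 ⟨i, hi⟩ := by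
  -- Component `i` reads only its first `i + 2` blocks, so the others may be filled in from `xs`.
  -- The resulting affine embedding passes through `splitLast xs` when `z` is the truncation of
  -- `xs`.
  set A₀ := padBlocks m (i + 2) (ν + 1)
  refine ⟨((padBlocks m (ν + 1) ν).comp A₀).prod
    ((ContinuousLinearMap.proj (R := ℝ) (φ := fun k : Fin (ν + 1) => Block m k)
      ⟨ν, Nat.lt_succ_self ν⟩).comp A₀), fun t z => ?_⟩
  have hi' : i + 2 ≤ ν + 1 := by omega
  have h : ∀ j (hj : j < i + 2), z ⟨j, hj⟩ = xs ⟨j, hj.trans_le hi'⟩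
      + A₀ (z - trunc hi' xs) ⟨j, hj.trans_le hi'⟩ := by
    intro j hj
    rw [padBlocks_apply_of_lt _ hj]
    exact (add_sub_cancel (xs ⟨j, by omega⟩) (z ⟨j, hj⟩)).symm
  rw [field]
  congr 1
  funext ⟨j, hj⟩
  rw [h j hj, trunc]
  rcases Nat.lt_or_ge j ν with hjν | hjν
  · refine Eq.trans ?_ (extend_of_lt _ _ hjν (by omega)).symm
    have := padBlocks_apply_of_lt (A₀ (z - trunc (by omega) xs)) (j := j) (ν := ν) (by omega) hjν
    exact congrArg (xs ⟨j, by omega⟩ + ·) this.symm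
  · obtain rfl : j = ν := by omega
    exact (extend_last _ _ _).symm

theorem RegularField.continuousOn_component (hI : RegularField ν f t₀ T) {i : ℕ} (hi : i < ν) :
    ContinuousOn (fun q : ℝ × State m (i + 2) => f i q.1 q.2) (Icc t₀ T ×ˢ univ) := by
  obtain ⟨A, hA⟩ := exists_component_eq (f := f) hi (0 : State m (ν + 1))
  simp only [hA]
  refine (continuous_apply _).comp_continuousOn (hI.continuousOn.comp
    (f := fun q : ℝ × State m (i + 2) => (q.1,
      splitLast (0 : State m (ν + 1)) + A (q.2 - trunc (by omega) (0 : State m (ν + 1)))))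
      (by fun_prop) fun q hq => ⟨hq.1, mem_univ _⟩)

/-- The continuous partial derivatives are bounded on a compact product of balls containing the
image of the given ball under the embedding. The mean value estimate is then used with zero
reference derivatives. -/
theorem RegularField.lipschitz_component (hI : RegularField ν f t₀ T) {i : ℕ} (hi : i < ν)
    (R : ℝ) : ∃ L : ℝ≥0, ∀ t ∈ Icc t₀ T, LipschitzOnWith L (f i t) (closedBall 0 R) := by
  obtain ⟨A, hA⟩ := exists_component_eq (f := f) hi (0 : State m (ν + 1))
  set R' : ℝ := ‖A‖ * R
  set K : Set (ℝ × State m ν × Block m ν) := Icc t₀ T ×ˢ closedBall 0 R' ×ˢ closedBall 0 R'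
  have hK : IsCompact K :=
    isCompact_Icc.prod ((isCompact_closedBall _ _).prod (isCompact_closedBall _ _))
  have hsub : K ⊆ Icc t₀ T ×ˢ univ := prod_mono_right (subset_univ _)
  obtain ⟨C₁, hC₁⟩ := hK.exists_bound_of_continuousOn (hI.continuousOn_fderiv_state.mono hsub)
  obtain ⟨C₂, hC₂⟩ := hK.exists_bound_of_continuousOn (hI.continuousOn_fderiv_control.mono hsub)
  set C : ℝ := max 0 (max C₁ C₂)
  have hC : 0 ≤ C := le_max_left _ _
  refine ⟨⟨2 * C * ‖A‖, by positivity⟩, fun t ht => LipschitzOnWith.of_dist_le_mul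
    fun z hz z' hz' => ?_⟩
  rw [mem_closedBall_zero_iff] at hz hz'
  have hmem : ∀ z : State m (i + 2), ‖z‖ ≤ R →
      A z ∈ closedBall (0 : State m ν) R' ×ˢ closedBall (0 : Block m ν) R' := by
    intro z hz
    have h1 : ‖A z‖ ≤ R' := (A.le_opNorm z).trans (mul_le_mul_of_nonneg_left hz (norm_nonneg _))
    exact ⟨mem_closedBall_zero_iff.2 ((norm_fst_le _).trans h1),
      mem_closedBall_zero_iff.2 ((norm_snd_le _).trans h1)⟩
  have hzero : ∀ z : State m (i + 2), splitLast (0 : State m (ν + 1))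
      + A (z - trunc (by omega) (0 : State m (ν + 1))) = A z :=
    fun z => by
      have h1 : trunc (by omega) (0 : State m (ν + 1)) = (0 : State m (i + 2)) := rfl
      have h2 : splitLast (0 : State m (ν + 1)) = 0 := rfl
      rw [h1, h2, sub_zero, zero_add]
  have h := norm_sub_sub_le_of_partial_fderiv (F := field f ν t) (DA := 0) (DB := 0) (κ := C)
    (convex_closedBall (0 : State m ν) R') (convex_closedBall (0 : Block m ν) R')
    (fun x _ u _ => hI.differentiable_state t ht x u)
    (fun x _ u _ => hI.differentiable_control t ht x u)
    (fun x hx u hu => by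
      rw [sub_zero]
      exact (hC₁ (t, x, u) ⟨ht, hx, hu⟩).trans ((le_max_left _ _).trans (le_max_right _ _)))
    (fun x hx u hu => by
      rw [sub_zero]
      exact (hC₂ (t, x, u) ⟨ht, hx, hu⟩).trans ((le_max_right _ _).trans (le_max_right _ _)))
    (hmem z hz) (hmem z' hz')
  have h0 : (ContinuousLinearMap.coprod (0 : State m ν →L[ℝ] State m ν)
      (0 : Block m ν →L[ℝ] State m ν)) (A z - A z') = 0 := by simp
  rw [h0, sub_zero, ← map_sub] at h
  rw [dist_eq_norm, dist_eq_norm, hA t z, hA t z', hzero, hzero]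
  refine (norm_le_pi_norm (field f ν t (A z).1 (A z).2 - field f ν t (A z').1 (A z').2)
    ⟨i, hi⟩).trans (h.trans ?_)
  calc 2 * C * ‖A (z - z')‖ ≤ 2 * C * (‖A‖ * ‖z - z'‖) := by
        gcongr
        exact A.le_opNorm _
    _ = 2 * C * ‖A‖ * ‖z - z'‖ := by ring

/-- This is strict differentiability at the reference point, uniform in `t` near `t₁`. The
derivative is the one at time `t₁`, and joint continuity of the partial derivatives keeps them close
to it on a small neighbourhood in all variables. -/
theorem RegularField.strict_component (hI : RegularField ν f t₀ T) {i : ℕ} (hi : i < ν)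
    {t₁ : ℝ} (ht₁ : t₁ ∈ Icc t₀ T) (xs : State m (ν + 1)) :
    ∃ D : State m (i + 2) →L[ℝ] Block m i, ∀ κ > 0, ∃ r > 0, ∀ t ∈ Icc t₀ T, |t - t₁| ≤ r →
      ∀ z z' : State m (i + 2), ‖z - trunc (Nat.succ_le_succ hi) xs‖ ≤ r → ‖z' - trunc (Nat.succ_le_succ hi) xs‖ ≤ r →
        ‖f i t z - f i t z' - D (z - z')‖ ≤ κ * ‖z - z'‖ := by
  obtain ⟨A, hA⟩ := exists_component_eq (f := f) hi xs
  set b : State m ν × Block m ν := splitLast xs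
  set DA := fderiv ℝ (fun x' => field f ν t₁ x' b.2) b.1
  set DB := fderiv ℝ (fun u' => field f ν t₁ b.1 u') b.2
  refine ⟨(ContinuousLinearMap.proj (R := ℝ) (φ := fun k : Fin ν => Block m k) ⟨i, hi⟩).comp
    ((DA.coprod DB).comp A), fun κ hκ => ?_⟩
  set κ' : ℝ := κ / (2 * (‖A‖ + 1)) with hκ'
  have hκ'0 : 0 < κ' := by positivity
  have hmem : (t₁, b) ∈ Icc t₀ T ×ˢ (univ : Set (State m ν × Block m ν)) := ⟨ht₁, mem_univ _⟩
  obtain ⟨δ₁, hδ₁, h₁⟩ := Metric.continuousOn_iff.1 hI.continuousOn_fderiv_state _ hmem κ' hκ'0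
  obtain ⟨δ₂, hδ₂, h₂⟩ := Metric.continuousOn_iff.1 hI.continuousOn_fderiv_control _ hmem κ' hκ'0
  set δ : ℝ := min δ₁ δ₂ / 2 with hδ
  have hδ0 : 0 < δ := by positivity
  have hδδ₁ : δ < δ₁ := by
    have : min δ₁ δ₂ ≤ δ₁ := min_le_left _ _
    rw [hδ]; linarith
  have hδδ₂ : δ < δ₂ := by
    have : min δ₁ δ₂ ≤ δ₂ := min_le_right _ _
    rw [hδ]; linarith
  refine ⟨δ / (‖A‖ + 1), by positivity, fun t ht htt z z' hz hz' => ?_⟩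
  have hrδ : δ / (‖A‖ + 1) ≤ δ := div_le_self hδ0.le (by linarith [norm_nonneg A])
  have hpt : ∀ z : State m (i + 2), ‖z - trunc (by omega) xs‖ ≤ δ / (‖A‖ + 1) →
      b + A (z - trunc (by omega) xs) ∈ closedBall b.1 δ ×ˢ closedBall b.2 δ := by
    intro z hz
    have h1 : ‖A (z - trunc (by omega) xs)‖ ≤ δ := by
      calc _ ≤ ‖A‖ * (δ / (‖A‖ + 1)) := (A.le_opNorm _).trans (by gcongr)
        _ ≤ (‖A‖ + 1) * (δ / (‖A‖ + 1)) := by gcongr; linarith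
        _ = δ := by field_simp
    constructor
    · rw [mem_closedBall_iff_norm, Prod.fst_add, add_sub_cancel_left]
      exact (norm_fst_le _).trans h1
    · rw [mem_closedBall_iff_norm, Prod.snd_add, add_sub_cancel_left]
      exact (norm_snd_le _).trans h1
  have hdist : ∀ x ∈ closedBall b.1 δ, ∀ u ∈ closedBall b.2 δ,
      dist (t, x, u) (t₁, b) ≤ δ := by
    intro x hx u hu
    rw [Prod.dist_eq, Prod.dist_eq, Real.dist_eq]
    exact max_le (htt.trans hrδ) (max_le hx hu)
  have h := norm_sub_sub_le_of_partial_fderiv (F := field f ν t) (DA := DA) (DB := DB) (κ := κ')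
    (convex_closedBall b.1 δ) (convex_closedBall b.2 δ)
    (fun x _ u _ => hI.differentiable_state t ht x u)
    (fun x _ u _ => hI.differentiable_control t ht x u)
    (fun x hx u hu => by
      rw [← dist_eq_norm]
      exact (h₁ (t, x, u) ⟨ht, mem_univ _⟩ ((hdist x hx u hu).trans_lt hδδ₁)).le)
    (fun x hx u hu => by
      rw [← dist_eq_norm]
      exact (h₂ (t, x, u) ⟨ht, mem_univ _⟩ ((hdist x hx u hu).trans_lt hδδ₂)).le)
    (hpt z hz) (hpt z' hz')
  have h3 : b + A (z - trunc (by omega) xs) - (b + A (z' - trunc (by omega) xs)) = A (z - z') := by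
    rw [add_sub_add_left_eq_sub, ← map_sub, sub_sub_sub_cancel_right]
  rw [h3] at h
  rw [hA t z, hA t z']
  refine (norm_le_pi_norm (field f ν t _ _ - field f ν t _ _ - (DA.coprod DB) (A (z - z')))
    ⟨i, hi⟩).trans (h.trans ?_)
  have h5 := A.le_opNorm (z - z')
  calc 2 * κ' * ‖A (z - z')‖ ≤ 2 * κ' * ((‖A‖ + 1) * ‖z - z'‖) := by
        gcongr
        nlinarith [norm_nonneg (z - z')]
    _ = κ * ‖z - z'‖ := by rw [hκ']; field_simp

end Regularity

/-! ### Cut-off monomials with prescribed jets at `0` and `1`. -/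

section Jets

open scoped Nat

/-- A smooth function that vanishes near `0` and coincides with `(s - 1) ^ j / j!` near `1`. -/
noncomputable def jetFun (j : ℕ) (s : ℝ) : ℝ :=
  (s - 1) ^ j / j ! * Real.smoothTransition (3 * s - 1)

theorem contDiff_jetFun (j : ℕ) (n : ℕ) : ContDiff ℝ n (jetFun j) := by
  refine ContDiff.mul (by fun_prop) ?_
  exact (Real.smoothTransition.contDiff (n := (n : ℕ∞))).comp (by fun_prop)

theorem hasDerivAt_iteratedDeriv_jetFun (j l : ℕ) (s : ℝ) :
    HasDerivAt (iteratedDeriv l (jetFun j)) (iteratedDeriv (l + 1) (jetFun j) s) s := by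
  rw [iteratedDeriv_succ]
  exact ((contDiff_jetFun j (l + 1)).differentiable_iteratedDeriv l
    (by exact_mod_cast Nat.lt_succ_self l) s).hasDerivAt

theorem iteratedDeriv_jetFun_of_lt (j l : ℕ) {s : ℝ} (hs : s < 1 / 3) :
    iteratedDeriv l (jetFun j) s = 0 := by
  have h : jetFun j =ᶠ[𝓝 s] fun _ => 0 := by
    filter_upwards [gt_mem_nhds hs] with u hu
    rw [jetFun, Real.smoothTransition.zero_of_nonpos (by linarith), mul_zero]
  rw [h.iteratedDeriv_eq]
  simp

theorem iteratedDeriv_taylor_monomial (j l : ℕ) :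
    iteratedDeriv l (fun s : ℝ => (s - 1) ^ j / j !)
      = if l ≤ j then fun s : ℝ => (s - 1) ^ (j - l) / (j - l)! else 0 := by
  induction l generalizing j with
  | zero => simp
  | succ l ih =>
    rw [iteratedDeriv_succ']
    cases j with
    | zero =>
      have : deriv (fun s : ℝ => (s - 1) ^ 0 / (0 ! : ℝ)) = fun _ => 0 := by
        funext s; simp
      rw [this]
      funext s
      simp
    | succ j =>
      have : deriv (fun s : ℝ => (s - 1) ^ (j + 1) / ((j + 1)! : ℝ))
          = fun s : ℝ => (s - 1) ^ j / (j ! : ℝ) := by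
        funext s
        have h : HasDerivAt (fun s : ℝ => (s - 1) ^ (j + 1) / ((j + 1)! : ℝ))
            (((j + 1 : ℕ) : ℝ) * (s - 1) ^ j * 1 / ((j + 1)! : ℝ)) s :=
          (((hasDerivAt_id s).sub_const 1).pow (j + 1)).div_const _
        rw [h.deriv, Nat.factorial_succ]
        push_cast
        field_simp
      rw [this, ih j]
      simp

/-- The cut-off equals `1` beyond `2 / 3`. At `s = 1` the `l`-th derivative is thus `1` if `l = j`
and `0` otherwise, and derivatives of order above `j` vanish for all `s ≥ 1`. -/
theorem iteratedDeriv_jetFun_of_ge (j l : ℕ) {s : ℝ} (hs : 1 ≤ s) :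
    iteratedDeriv l (jetFun j) s = if l ≤ j then (s - 1) ^ (j - l) / (j - l)! else 0 := by
  have h : jetFun j =ᶠ[𝓝 s] fun s => (s - 1) ^ j / j ! := by
    filter_upwards [lt_mem_nhds (show 2 / 3 < s by linarith)] with u hu
    rw [jetFun, Real.smoothTransition.one_of_one_le (by linarith), mul_one]
  rw [h.iteratedDeriv_eq, iteratedDeriv_taylor_monomial]
  split_ifs <;> rfl

end Jets

/-! ### Explicit steering of a chain of surjections. -/

section Chain

variable {m : ℕ → ℕ}

/-- A linear map into block number `j` extends to a family of maps into all blocks that is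
compatible with given surjections between consecutive blocks. -/
theorem exists_compatible_family {F : Type*} [NormedAddCommGroup F] [NormedSpace ℝ F] {p : ℕ}
    (B : (i : ℕ) → Block m (i + 1) →L[ℝ] Block m i) (hB : ∀ i < p, Function.Surjective (B i))
    (j : ℕ) (π : F →L[ℝ] Block m j) :
    ∃ A : (l : ℕ) → F →L[ℝ] Block m l, A j = π ∧ ∀ l < p, A l = (B l).comp (A (l + 1)) := by
  -- Upwards from block `j` the map is lifted through linear right inverses of the surjections.
  -- Downwards it is obtained by composing with them.
  have hup : ∀ n, ∃ A : (l : ℕ) → F →L[ℝ] Block m l, A j = π ∧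
      ∀ l, j ≤ l → l < j + n → l < p → A l = (B l).comp (A (l + 1)) := by
    intro n
    induction n with
    | zero =>
      exact ⟨Function.update (fun _ => 0) j π, by simp, fun l h1 h2 => absurd h2 (by omega)⟩
    | succ n ih =>
      obtain ⟨A, hA, hAl⟩ := ih
      by_cases hn : j + n < p
      · obtain ⟨C, hC⟩ := (B (j + n)).toLinearMap.exists_rightInverse_of_surjective
          (LinearMap.range_eq_top.2 (hB _ hn))
        refine ⟨Function.update A (j + n + 1)
          ((LinearMap.toContinuousLinearMap C).comp (A (j + n))), ?_, fun l h1 h2 h3 => ?_⟩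
        · rw [Function.update_of_ne (by omega), hA]
        · rw [Function.update_of_ne (by omega)]
          rcases (show l < j + n ∨ l = j + n by omega) with h4 | rfl
          · rw [Function.update_of_ne (by omega), hAl l h1 h4 h3]
          · rw [Function.update_self]
            ext1 x
            exact (LinearMap.congr_fun hC (A (j + n) x)).symm
      · exact ⟨A, hA, fun l h1 h2 h3 => hAl l h1 (by omega) h3⟩
  have hdown : ∀ n ≤ j, ∃ A : (l : ℕ) → F →L[ℝ] Block m l, A j = π ∧
      ∀ l, j - n ≤ l → l < p → A l = (B l).comp (A (l + 1)) := by
    intro n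
    induction n with
    | zero =>
      intro _
      obtain ⟨A, hA, hAl⟩ := hup p
      exact ⟨A, hA, fun l h1 h2 => hAl l (by omega) (by omega) h2⟩
    | succ n ih =>
      intro hn
      obtain ⟨A, hA, hAl⟩ := ih (by omega)
      refine ⟨Function.update A (j - (n + 1)) ((B _).comp (A (j - (n + 1) + 1))), ?_,
        fun l h1 h2 => ?_⟩
      · rw [Function.update_of_ne (by omega), hA]
      · rw [Function.update_of_ne (show l + 1 ≠ j - (n + 1) by omega)]
        rcases h1.eq_or_lt with h3 | h3
        · subst h3
          rw [Function.update_self]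
        · rw [Function.update_of_ne (by omega)]
          exact hAl l (by omega) h2
  obtain ⟨A, hA, hAl⟩ := hdown j le_rfl
  exact ⟨A, hA, fun l hl => hAl l (by omega) hl⟩

theorem extend_add {r : ℕ} (x x' : State m r) (v v' : Block m r) :
    extend (x + x') (v + v') = extend x v + extend x' v' := by
  funext j
  refine Fin.lastCases ?_ (fun j => ?_) j <;> simp [extend]

theorem extend_smul {r : ℕ} (c : ℝ) (x : State m r) (v : Block m r) :
    extend (c • x) (c • v) = c • extend x v := by
  funext j
  refine Fin.lastCases ?_ (fun j => ?_) j <;> simp [extend]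

/-- `extend` as a continuous linear map. -/
noncomputable def extendL (m : ℕ → ℕ) (r : ℕ) : State m r × Block m r →L[ℝ] State m (r + 1) :=
  LinearMap.toContinuousLinearMap
    { toFun := fun q => extend q.1 q.2
      map_add' := fun q q' => extend_add q.1 q'.1 q.2 q'.2
      map_smul' := fun c q => extend_smul c q.1 q.2 }

theorem extendL_apply {r : ℕ} (q : State m r × Block m r) : extendL m r q = extend q.1 q.2 := rfl

theorem norm_extend_le {r : ℕ} (x : State m r) (v : Block m r) :
    ‖extend x v‖ ≤ max ‖x‖ ‖v‖ := by
  refine (pi_norm_le_iff_of_nonneg (le_max_of_le_left (norm_nonneg _))).2 fun j => ?_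
  refine Fin.lastCases ?_ (fun j => ?_) j
  · simp [extend]
  · have := norm_le_pi_norm x j
    simp [extend, this]

/-- The linear map whose `i`-th block is `B i` applied to block number `i + 1`. -/
noncomputable def shiftL (B : (i : ℕ) → Block m (i + 1) →L[ℝ] Block m i) (p : ℕ) :
    State m (p + 1) →L[ℝ] State m p :=
  ContinuousLinearMap.pi fun i : Fin p => (B i).comp
    (ContinuousLinearMap.proj (R := ℝ) (φ := fun k : Fin (p + 1) => Block m k) i.succ)

/-- Explicit steering curves for a chain of surjections. -/
theorem exists_chain_curves {p : ℕ} (B : (i : ℕ) → Block m (i + 1) →L[ℝ] Block m i)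
    (hB : ∀ i < p, Function.Surjective (B i)) :
    ∃ (QX : ℝ → State m p →L[ℝ] State m p) (QU : ℝ → State m p →L[ℝ] Block m p),
      (∀ s, HasDerivAt QX
        (((shiftL B p).comp ((extendL m p).comp (ContinuousLinearMap.inl ℝ _ _))).comp (QX s)
        + ((shiftL B p).comp ((extendL m p).comp (ContinuousLinearMap.inr ℝ _ _))).comp (QU s)) s) ∧
      ContDiff ℝ 1 QU ∧ QX 0 = 0 ∧ QX 1 = ContinuousLinearMap.id ℝ _ ∧
      (∀ s < 1 / 3, QU s = 0) ∧ ∀ s, 1 ≤ s → QU s = 0 := by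
  choose A hAj hAl using fun j : Fin p => exists_compatible_family (F := State m p) B hB j
    (ContinuousLinearMap.proj (R := ℝ) (φ := fun k : Fin p => Block m k) j)
  have hz : ∀ j l, (0 : ℝ) • A j l = 0 := fun j l => by
    ext1 x
    simp
  -- Differentiating in `s` raises the order of the derivative of `jetFun j`, and compatibility of
  -- `A j` rewrites this as `B l` applied to the next block, which is the chain equation. The values
  -- of the jets at `1` make `Q l 1` the projection to block `l`. Block `p` is the control; it
  -- vanishes for `s ≥ 1` because all `j` are below `p`.
  set Q : (l : ℕ) → ℝ → State m p →L[ℝ] Block m l := fun l s =>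
    ∑ j : Fin p, iteratedDeriv l (jetFun j) s • A j l with hQ
  have hQd : ∀ l < p, ∀ s, HasDerivAt (Q l) ((B l).comp (Q (l + 1) s)) s := by
    intro l hl s
    have h : HasDerivAt (Q l) (∑ j : Fin p, iteratedDeriv (l + 1) (jetFun j) s • A j l) s :=
      HasDerivAt.fun_sum fun j _ => (hasDerivAt_iteratedDeriv_jetFun j l s).smul_const (A j l)
    convert! h using 1
    ext1 x
    simp [hQ, hAl _ l hl]
  have hQ0 : ∀ l, ∀ s < 1 / 3, Q l s = 0 := fun l s hs =>
    Finset.sum_eq_zero fun j _ => by rw [iteratedDeriv_jetFun_of_lt _ _ hs, hz]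
  have hQ1 : ∀ l : Fin p, Q l 1 = ContinuousLinearMap.proj (R := ℝ) l := by
    intro l
    rw [← hAj l]
    refine (Finset.sum_eq_single l (fun j _ hj => ?_) (by simp)).trans ?_
    · rw [iteratedDeriv_jetFun_of_ge _ _ le_rfl]
      split_ifs with h
      · have : (j : ℕ) - l ≠ 0 := by
          have : (j : ℕ) ≠ l := fun h => hj (Fin.ext h)
          omega
        rw [sub_self, zero_pow this, zero_div, hz]
      · rw [hz]
    · rw [iteratedDeriv_jetFun_of_ge _ _ le_rfl]
      simp
  set QX : ℝ → State m p →L[ℝ] State m p := fun s => ∑ i : Fin p,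
    (ContinuousLinearMap.single ℝ (fun k : Fin p => Block m k) i).comp (Q i s) with hQX
  have hsingle : ∀ (c : (i : Fin p) → State m p →L[ℝ] Block m i) x k,
      (∑ i : Fin p, (ContinuousLinearMap.single ℝ (fun k : Fin p => Block m k) i).comp (c i)) x k
        = c k x := by
    intro c x k
    simp
  have hshift : ∀ s x i, shiftL B p (extend (QX s x) (Q p s x)) i = B i (Q (i + 1) s x) := by
    intro s x i
    have h : extend (QX s x) (Q p s x) i.succ = Q (i + 1) s x := by
      obtain ⟨i, hi⟩ := i
      rcases Nat.lt_or_ge (i + 1) p with hip | hip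
      · refine (extend_of_lt _ _ hip _).trans ?_
        exact hsingle (fun i => Q i s) x ⟨i + 1, hip⟩
      · obtain rfl : p = i + 1 := by omega
        exact extend_last _ _ _
    exact congrArg (B i) h
  refine ⟨QX, Q p, fun s => ?_, ?_, ?_, ?_, hQ0 p, fun s hs => ?_⟩
  · have h : HasDerivAt QX (∑ i : Fin p,
        (ContinuousLinearMap.single ℝ (fun k : Fin p => Block m k) i).comp
          ((B i).comp (Q (i + 1) s))) s := by
      refine HasDerivAt.fun_sum fun i _ => ?_
      have := (hasDerivAt_const s
        (ContinuousLinearMap.single ℝ (fun k : Fin p => Block m k) i)).clm_comp (hQd i i.2 s)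
      simpa using this
    convert! h using 1
    ext1 x
    funext i
    rw [hsingle]
    refine Eq.trans ?_ (hshift s x i)
    have h2 : shiftL B p (extend (QX s x) (Q p s x))
        = shiftL B p (extendL m p (QX s x, 0) + extendL m p (0, Q p s x)) := by
      rw [← map_add, extendL_apply]
      simp
    rw [h2, map_add]
    rfl
  · refine ContDiff.sum fun j _ => ContDiff.fun_smul ?_ contDiff_const
    rw [contDiff_one_iff_deriv]
    have h : ∀ l, Continuous (iteratedDeriv l (jetFun j)) := fun l =>
      continuous_iff_continuousAt.2 fun s => (hasDerivAt_iteratedDeriv_jetFun j l s).continuousAt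
    refine ⟨fun s => (hasDerivAt_iteratedDeriv_jetFun j p s).differentiableAt, ?_⟩
    rw [← iteratedDeriv_succ]
    exact h _
  · refine Finset.sum_eq_zero fun i _ => ?_
    rw [hQ0 _ 0 (by norm_num), ContinuousLinearMap.comp_zero]
  · ext1 x
    funext i
    rw [hsingle (fun i => Q i 1), hQ1]
    rfl
  · refine Finset.sum_eq_zero fun j _ => ?_
    rw [iteratedDeriv_jetFun_of_ge _ _ hs, if_neg (not_le.2 j.2), hz]

end Chain

/-! ### Anisotropic scaling and linearization at the reference point. -/

section Scaling

variable {m : ℕ → ℕ}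

/-- The anisotropic dilation that multiplies block number `j` by `δ ^ (p - j)`. -/
noncomputable def dilate (δ : ℝ) (p : ℕ) {r : ℕ} (Z : State m r) : State m r :=
  fun j => δ ^ (p - j) • Z j

theorem dilate_sub (δ : ℝ) (p : ℕ) {r : ℕ} (Z Z' : State m r) :
    dilate δ p (Z - Z') = dilate δ p Z - dilate δ p Z' :=
  funext fun j => smul_sub (δ ^ (p - j)) (Z j) (Z' j)

theorem norm_dilate_le {δ : ℝ} (h0 : 0 ≤ δ) (h1 : δ ≤ 1) (p : ℕ) {r : ℕ} (Z : State m r) :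
    ‖dilate δ p Z‖ ≤ ‖Z‖ := by
  refine (pi_norm_le_iff_of_nonneg (norm_nonneg _)).2 fun j => ?_
  rw [dilate, norm_smul, Real.norm_of_nonneg (by positivity)]
  exact (mul_le_of_le_one_left (norm_nonneg _) (pow_le_one₀ h0 h1)).trans (norm_le_pi_norm Z j)

theorem norm_dilate_le_mul {δ : ℝ} (h0 : 0 ≤ δ) (h1 : δ ≤ 1) {p : ℕ} (Z : State m p) :
    ‖dilate δ p Z‖ ≤ δ * ‖Z‖ := by
  refine (pi_norm_le_iff_of_nonneg (by positivity)).2 fun j => ?_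
  have hj := j.2
  rw [dilate, norm_smul, Real.norm_of_nonneg (by positivity)]
  gcongr
  · exact pow_le_of_le_one h0 h1 (by omega)
  · exact norm_le_pi_norm Z j

theorem dilate_extend (δ : ℝ) {p : ℕ} (X : State m p) (V : Block m p) :
    dilate δ p (extend X V) = extend (dilate δ p X) V := by
  funext ⟨j, hj⟩
  rcases Nat.lt_or_ge j p with h | h
  · refine (congrArg (δ ^ (p - j) • ·) (extend_of_lt X V h hj)).trans ?_
    exact (extend_of_lt (dilate δ p X) V h hj).symm
  · obtain rfl : j = p := by omega
    refine (congrArg (δ ^ (j - j) • ·) (extend_last X V hj)).trans ?_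
    rw [extend_last, Nat.sub_self, pow_zero, one_smul]

variable {ν : ℕ} {f : (i : ℕ) → ℝ → State m (i + 2) → Block m i} {t₀ t₁ T : ℝ}

/-- By the chain rule the partial derivative in the last block is `D` restricted to that block, and
its range has the full dimension of the target. -/
theorem surjective_of_finrank_range {i : ℕ} (x : State m (i + 1)) (v : Block m (i + 1))
    {g : State m (i + 2) → Block m i} {D : State m (i + 2) →L[ℝ] Block m i}
    (hD : HasFDerivAt g D (extend x v))
    (hrank : Module.finrank ℝ (LinearMap.range (fderiv ℝ (fun v => g (extend x v)) v).toLinearMap)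
      = m i) :
    Function.Surjective
      (D.comp ((extendL m (i + 1)).comp (ContinuousLinearMap.inr ℝ _ _))) := by
  have h1 : HasFDerivAt (fun v => extend x v)
      ((extendL m (i + 1)).comp (ContinuousLinearMap.inr ℝ _ _)) v :=
    (extendL m (i + 1)).hasFDerivAt.comp v (hasFDerivAt_prodMk_right x v)
  have h2 := hD.comp v h1
  have h3 : fderiv ℝ (fun v => g (extend x v)) v = _ := h2.fderiv
  rw [h3] at hrank
  have h4 := Submodule.eq_top_of_finrank_eq (hrank.trans (finrank_euclideanSpace_fin (𝕜 := ℝ)).symm)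
  exact LinearMap.range_eq_top.1 h4

theorem extend_sub {r : ℕ} (x x' : State m r) (v v' : Block m r) :
    extend (x - x') (v - v') = extend x v - extend x' v' :=
  map_sub (extendL m r) (x, v) (x', v')

/-- Near the reference point the rescaled triangular field is close to a chain of surjections. -/
theorem RegularField.exists_linear_chain (hI : RegularField ν f t₀ T) (ht₁ : t₁ ∈ Icc t₀ T)
    (xs : State m (ν + 1))
    (hrank : ∀ (i : ℕ) (hi : i < ν),
      Module.finrank ℝ (LinearMap.range (fderiv ℝ
        (fun v : Block m (i + 1) =>
          f i t₁ (extend (trunc (r := i + 1) (Nat.le_succ_of_le hi) xs) v))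
        (xs ⟨i + 1, Nat.succ_lt_succ hi⟩)).toLinearMap) = m i) {p : ℕ} (hp : p ≤ ν) :
    ∃ B : (i : ℕ) → Block m (i + 1) →L[ℝ] Block m i, (∀ i < p, Function.Surjective (B i)) ∧
      ∀ κ > 0, ∃ r > 0, r ≤ 1 ∧ ∀ δ > 0, δ ≤ r → ∀ t ∈ Icc t₀ T, |t - t₁| ≤ r →
        ∀ (e : State m p) (w : Block m p), ‖e - trunc (Nat.le_succ_of_le hp) xs‖ ≤ r →
        ‖w - xs ⟨p, Nat.lt_succ_of_le hp⟩‖ ≤ r → ∀ (X X' : State m p) (V V' : Block m p),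
        ‖X‖ ≤ r → ‖X'‖ ≤ r → ‖V‖ ≤ r → ‖V'‖ ≤ r → ∀ i : Fin p,
          ‖(δ ^ (p - 1 - i))⁻¹ • (field f p t (e + dilate δ p X) (w + V) i
            - field f p t (e + dilate δ p X') (w + V') i)
            - B i (extend (X - X') (V - V') i.succ)‖ ≤ κ * max ‖X - X'‖ ‖V - V'‖ := by
  choose D hD using fun (i : ℕ) (hi : i < ν) => hI.strict_component hi ht₁ xs
  refine ⟨fun i => if hi : i < ν then
    (D i hi).comp ((extendL m (i + 1)).comp (ContinuousLinearMap.inr ℝ _ _)) else 0, ?_, ?_⟩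
  · intro i hip
    have hi : i < ν := by omega
    beta_reduce
    rw [dif_pos hi]
    have hx : extend (trunc (r := i + 1) (by omega) xs) (xs ⟨i + 1, by omega⟩)
        = trunc (s := ν + 1) (r := i + 2) (by omega) xs := by
      funext ⟨j, hj⟩
      rcases Nat.lt_or_ge j (i + 1) with h | h
      · exact extend_of_lt _ _ h hj
      · obtain rfl : j = i + 1 := by omega
        exact extend_last _ _ _
    refine surjective_of_finrank_range (g := f i t₁) (trunc (r := i + 1) (by omega) xs)
      (xs ⟨i + 1, by omega⟩) ?_ (hrank i hi)
    rw [hx, hasFDerivAt_iff_isLittleO, Asymptotics.isLittleO_iff]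
    intro c hc
    obtain ⟨r, hr, h⟩ := hD i hi c hc
    filter_upwards [Metric.closedBall_mem_nhds _ hr] with z hz
    exact h t₁ ht₁ (by simpa using hr.le) z _ (mem_closedBall_iff_norm.1 hz) (by simpa using hr.le)
  · intro κ hκ
    have hloc : ∀ i : Fin p, ∃ r > 0, r ≤ 1 ∧ ∀ δ > 0, δ ≤ r → ∀ t ∈ Icc t₀ T, |t - t₁| ≤ r →
        ∀ (e : State m p) (w : Block m p), ‖e - trunc (by omega) xs‖ ≤ r →
        ‖w - xs ⟨p, by omega⟩‖ ≤ r → ∀ (X X' : State m p) (V V' : Block m p),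
        ‖X‖ ≤ r → ‖X'‖ ≤ r → ‖V‖ ≤ r → ‖V'‖ ≤ r →
          ‖(δ ^ (p - 1 - i))⁻¹ • (field f p t (e + dilate δ p X) (w + V) i
            - field f p t (e + dilate δ p X') (w + V') i)
            - D i (i.2.trans_le hp) (extend 0 (extend (X - X') (V - V') i.succ))‖
          ≤ κ * max ‖X - X'‖ ‖V - V'‖ := by
      intro i
      have hip := i.2
      set Di := D i (i.2.trans_le hp)
      obtain ⟨r₁, hr₁, h⟩ := hD i (i.2.trans_le hp) (κ / 2) (by positivity)
      -- The bound `r₁ / 2` leaves room for two displacements, that of the base curve and that of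
      -- the perturbation. The last bound makes `‖Di‖ * δ ≤ κ / 2`.
      refine ⟨min 1 (min (r₁ / 2) (κ / (2 * (‖Di‖ + 1)))), by positivity, min_le_left _ _, ?_⟩
      intro δ hδ hδr t ht htr e w he hw X X' V V' hX hX' hV hV'
      have hδ1 : δ ≤ 1 := hδr.trans (min_le_left _ _)
      have hrr : min 1 (min (r₁ / 2) (κ / (2 * (‖Di‖ + 1)))) ≤ r₁ / 2 :=
        (min_le_right _ _).trans (min_le_left _ _)
      have hδD : ‖Di‖ * δ ≤ κ / 2 := by
        have h1 : δ ≤ κ / (2 * (‖Di‖ + 1)) :=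
          hδr.trans ((min_le_right _ _).trans (min_le_right _ _))
        rw [le_div_iff₀ (by positivity)] at h1
        nlinarith
      have hi2 : (i : ℕ) + 2 ≤ p + 1 := by omega
      set z : State m (i + 2) := trunc hi2 (extend (e + dilate δ p X) (w + V)) with hz
      set z' : State m (i + 2) := trunc hi2 (extend (e + dilate δ p X') (w + V')) with hz'
      set Zd : State m (p + 1) := extend (X - X') (V - V') with hZd
      have hZdn : ‖Zd‖ ≤ max ‖X - X'‖ ‖V - V'‖ := norm_extend_le _ _
      have hnear : ∀ (X : State m p) (V : Block m p),
          ‖X‖ ≤ min 1 (min (r₁ / 2) (κ / (2 * (‖Di‖ + 1)))) →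
          ‖V‖ ≤ min 1 (min (r₁ / 2) (κ / (2 * (‖Di‖ + 1)))) →
          ‖trunc hi2 (extend (e + dilate δ p X) (w + V)) - trunc (by omega) xs‖ ≤ r₁ := by
        intro X V hX hV
        have h1 : extend (trunc (r := p) (by omega) xs) (xs ⟨p, by omega⟩)
            = trunc (s := ν + 1) (r := p + 1) (by omega) xs := by
          funext ⟨j, hj⟩
          rcases Nat.lt_or_ge j p with h | h
          · exact extend_of_lt _ _ h hj
          · obtain rfl : j = p := by omega
            exact extend_last _ _ _
        have h2 : trunc hi2 (extend (e + dilate δ p X) (w + V)) - trunc (by omega) xs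
            = trunc hi2 (extend (e + dilate δ p X - trunc (by omega) xs)
              (w + V - xs ⟨p, by omega⟩)) := by
          rw [extend_sub, h1]
          rfl
        rw [h2]
        refine (norm_trunc_le _ _).trans ((norm_extend_le _ _).trans (max_le ?_ ?_))
        · rw [add_sub_right_comm]
          refine (norm_add_le _ _).trans ?_
          linarith [norm_dilate_le hδ.le hδ1 p X]
        · rw [add_sub_right_comm]
          refine (norm_add_le _ _).trans ?_
          linarith
      have hest := h t ht (htr.trans (hrr.trans (by linarith))) z z' (hnear X V hX hV)
        (hnear X' V' hX' hV')
      -- After the common factor `δ ^ (p - 1 - i)` is taken out, block `i + 1` carries the power `δ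
      -- ^ 0` and every earlier block at least one factor `δ`. Only the surjective part of the
      -- derivative survives as `δ → 0`.
      set N : State m (i + 2) := dilate δ (i + 1) (trunc hi2 Zd) with hN
      have hzN : z - z' = δ ^ (p - 1 - i) • N := by
        have h1 : z - z' = trunc hi2 (dilate δ p Zd) := by
          rw [hZd, dilate_extend, dilate_sub]
          have h2 : extend (dilate δ p X - dilate δ p X') (V - V')
              = extend (e + dilate δ p X) (w + V) - extend (e + dilate δ p X') (w + V') := by
            rw [← extend_sub, add_sub_add_left_eq_sub, add_sub_add_left_eq_sub]
          rw [h2]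
          rfl
        rw [h1]
        funext j
        have hj := j.2
        have h3 : p - j = (p - 1 - i) + (i + 1 - j) := by omega
        refine (congrArg (· • Zd (Fin.castLE hi2 j))
          ((congrArg (δ ^ ·) h3).trans (pow_add _ _ _))).trans ?_
        exact mul_smul _ _ _
      have hNn : ‖N‖ ≤ ‖Zd‖ := (norm_dilate_le hδ.le hδ1 _ _).trans (norm_trunc_le _ _)
      set Y : State m (i + 1) := dilate δ (i + 1) (trunc (by omega) Zd) with hY
      have hYn : ‖Y‖ ≤ δ * ‖Zd‖ := (norm_dilate_le_mul hδ.le hδ1 _).trans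
        (mul_le_mul_of_nonneg_left (norm_trunc_le _ _) hδ.le)
      have hNY : N = extend Y 0 + extend (r := i + 1) 0 (Zd i.succ) := by
        rw [← extend_add, add_zero, zero_add, hY, ← dilate_extend, hN]
        congr 1
        funext ⟨j, hj⟩
        rcases Nat.lt_or_ge j (i + 1) with h | h
        · exact (extend_of_lt (r := i + 1) (trunc (by omega) Zd) (Zd i.succ) h hj).symm
        · obtain rfl : j = i + 1 := by omega
          exact (extend_last (r := i + 1) (trunc (by omega) Zd) (Zd i.succ) hj).symm
      have hpow : 0 < δ ^ (p - 1 - i) := by positivity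
      have hsplit : (δ ^ (p - 1 - i))⁻¹ • (field f p t (e + dilate δ p X) (w + V) i
            - field f p t (e + dilate δ p X') (w + V') i) - Di (extend (r := i + 1) 0 (Zd i.succ))
          = (δ ^ (p - 1 - i))⁻¹ • (f i t z - f i t z' - Di (z - z')) + Di (extend Y 0) := by
        rw [smul_sub _ (f i t z - f i t z'), hzN, map_smul, inv_smul_smul₀ hpow.ne', hNY, map_add]
        rw [field, field]
        abel
      rw [hsplit]
      refine (norm_add_le _ _).trans ?_
      have h5 : ‖(δ ^ (p - 1 - i))⁻¹ • (f i t z - f i t z' - Di (z - z'))‖ ≤ κ / 2 * ‖Zd‖ := by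
        rw [norm_smul, norm_inv, Real.norm_of_nonneg hpow.le, inv_mul_le_iff₀ hpow]
        refine hest.trans ?_
        rw [hzN, norm_smul, Real.norm_of_nonneg hpow.le]
        have : 0 ≤ κ / 2 * δ ^ (p - 1 - i) := by positivity
        nlinarith
      have h6 : ‖Di (extend Y 0)‖ ≤ κ / 2 * ‖Zd‖ := by
        have h7 : ‖extend Y (0 : Block m (i + 1))‖ ≤ δ * ‖Zd‖ :=
          (norm_extend_le _ _).trans (max_le hYn (by rw [norm_zero]; positivity))
        calc _ ≤ ‖Di‖ * (δ * ‖Zd‖) := (Di.le_opNorm _).trans (by gcongr)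
          _ = ‖Di‖ * δ * ‖Zd‖ := by ring
          _ ≤ _ := by gcongr
      have h8 := mul_le_mul_of_nonneg_left hZdn hκ.le
      linarith
    choose r hr hr1 h using hloc
    obtain ⟨ρ, hρ, hρr⟩ : ∃ ρ > 0, ρ ≤ 1 ∧ ∀ i, ρ ≤ r i := by
      rcases isEmpty_or_nonempty (Fin p) with hE | hE
      · exact ⟨1, one_pos, le_rfl, fun i => hE.elim i⟩
      · obtain ⟨i, hi⟩ := Finite.exists_min r
        exact ⟨r i, hr i, hr1 i, hi⟩
    refine ⟨ρ, hρ, hρr.1, fun δ hδ hδr t ht htr e w he hw X X' V V' hX hX' hV hV' i => ?_⟩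
    have hi := hρr.2 i
    beta_reduce
    rw [dif_pos (i.2.trans_le hp)]
    exact h i δ hδ (hδr.trans hi) t ht (htr.trans hi) e w (he.trans hi) (hw.trans hi) X X' V V'
      (hX.trans hi) (hX'.trans hi) (hV.trans hi) (hV'.trans hi)

end Scaling

/-! ### Local steering of the nonlinear system after `t₁`. -/

section LocalSteering

open Metric
open scoped NNReal

variable {m : ℕ → ℕ} {ν : ℕ} {f : (i : ℕ) → ℝ → State m (i + 2) → Block m i} {t₀ t₁ T : ℝ}

theorem continuous_extend {r : ℕ} :
    Continuous fun q : State m r × Block m r => extend q.1 q.2 :=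
  (extendL m r).continuous

theorem continuous_trunc {r s : ℕ} (h : r ≤ s) :
    Continuous (trunc h : State m s → State m r) :=
  continuous_pi fun j => continuous_apply (Fin.castLE h j)

theorem continuous_dilate {r : ℕ} (p : ℕ) :
    Continuous fun q : ℝ × State m r => dilate q.1 p q.2 := by
  refine continuous_pi fun j => ?_
  exact (continuous_fst.pow _).smul ((continuous_apply j).comp continuous_snd)

/-- Only the last component sees the control; the earlier ones are functions of the state alone. -/
theorem field_of_lt {p : ℕ} (t : ℝ) (x : State m p) (v : Block m p) {i : ℕ} (hi : i + 2 ≤ p) :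
    field f p t x v ⟨i, by omega⟩ = f i t (trunc hi x) := by
  rw [field]
  congr 1
  funext ⟨j, hj⟩
  have hj' : j < i + 2 := hj
  exact extend_of_lt (j := j) x v (by omega) (by omega)

theorem RegularField.continuousOn_field (hI : RegularField ν f t₀ T) {p : ℕ} (hp : p ≤ ν) :
    ContinuousOn (fun q : ℝ × State m p × Block m p => field f p q.1 q.2.1 q.2.2)
      (Icc t₀ T ×ˢ univ) := by
  refine continuousOn_pi.2 fun i => ?_
  exact (hI.continuousOn_component (i.2.trans_le hp)).comp
    (f := fun q : ℝ × State m p × Block m p => (q.1, trunc _ (extend q.2.1 q.2.2)))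
    (continuous_fst.prodMk ((continuous_trunc _).comp
      (continuous_extend.comp continuous_snd))).continuousOn fun q hq => ⟨hq.1, mem_univ _⟩

theorem RegularField.lipschitz_field (hI : RegularField ν f t₀ T) {p : ℕ} (hp : p ≤ ν) (R : ℝ) :
    ∃ L : ℝ≥0, ∀ t ∈ Icc t₀ T, ∀ (x x' : State m p) (u u' : Block m p), ‖x‖ ≤ R → ‖x'‖ ≤ R →
      ‖u‖ ≤ R → ‖u'‖ ≤ R →
      ‖field f p t x u - field f p t x' u'‖ ≤ L * max ‖x - x'‖ ‖u - u'‖ := by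
  choose L hL using fun i : Fin p => hI.lipschitz_component (i.2.trans_le hp) R
  refine ⟨∑ i, L i, fun t ht x x' u u' hx hx' hu hu' => ?_⟩
  refine (pi_norm_le_iff_of_nonneg (by positivity)).2 fun i => ?_
  have hip : (i : ℕ) + 2 ≤ p + 1 := by
    have := i.2
    omega
  have hb : ∀ (x : State m p) (u : Block m p), ‖x‖ ≤ R → ‖u‖ ≤ R →
      trunc hip (extend x u) ∈ closedBall 0 R := fun x u hx hu =>
    mem_closedBall_zero_iff.2 ((norm_trunc_le _ _).trans ((norm_extend_le _ _).trans (max_le hx hu)))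
  have h := (hL i t ht).dist_le_mul _ (hb x u hx hu) _ (hb x' u' hx' hu')
  rw [dist_eq_norm, dist_eq_norm] at h
  refine h.trans ?_
  have h1 : trunc hip (extend x u) - trunc hip (extend x' u')
      = trunc hip (extend (x - x') (u - u')) := by
    rw [extend_sub]
    rfl
  have h2 : (L i : ℝ) ≤ ((∑ i, L i : ℝ≥0) : ℝ) :=
    NNReal.coe_le_coe.2 (Finset.single_le_sum (fun _ _ => zero_le) (Finset.mem_univ i))
  rw [h1]
  gcongr
  exact (norm_trunc_le _ _).trans (norm_extend_le _ _)

set_option maxHeartbeats 1000000 in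
/-- Steering on a short interval after `t₁`: small target displacements of `y` can be reached by
adding to `v0` a control that vanishes near both end points of the interval. -/
theorem RegularField.exists_local_steering (hI : RegularField ν f t₀ T) (ht₁ : t₁ ∈ Icc t₀ T)
    (xs : State m (ν + 1))
    (hrank : ∀ (i : ℕ) (hi : i < ν),
      Module.finrank ℝ (LinearMap.range (fderiv ℝ
        (fun v : Block m (i + 1) =>
          f i t₁ (extend (trunc (r := i + 1) (Nat.le_succ_of_le hi) xs) v))
        (xs ⟨i + 1, Nat.succ_lt_succ hi⟩)).toLinearMap) = m i) {k : ℕ} (hk : k + 1 ≤ ν)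
    {v0 : ℝ → Block m (k + 1)} (hv0 : Continuous v0) (hv0t : v0 t₁ = xs ⟨k + 1, by omega⟩) :
    ∃ QU : ℝ → State m (k + 1) →L[ℝ] Block m (k + 1), ContDiff ℝ 1 QU ∧ (∀ s < 1 / 3, QU s = 0) ∧
      (∀ s, 1 ≤ s → QU s = 0) ∧ ∃ r > 0, ∀ {P : Type} [TopologicalSpace P]
        {y W : P → ℝ → State m (k + 1)}
        (_ : ContinuousOn (fun q : P × ℝ => y q.1 q.2) (univ ×ˢ Icc t₁ T))
        (_ : ContinuousOn (fun q : P × ℝ => W q.1 q.2) (univ ×ˢ Icc t₁ T))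
        (_ : ∀ q, ∀ t ∈ Icc t₁ T, HasDerivWithinAt (y q) (W q t) (Icc t₁ T) t)
        (_ : ∀ q, ∀ t ∈ Icc t₁ T, ∀ (i : ℕ) (hi : i + 2 ≤ k + 1),
          W q t ⟨i, by omega⟩ = f i t (trunc hi (y q t)))
        (_ : ∀ q, y q t₁ = trunc (by omega) xs)
        {δ : P → ℝ} (_ : Continuous δ) (_ : ∀ q, 0 < δ q) (_ : ∀ q, δ q ≤ r)
        (_ : ∀ q, t₁ + δ q ≤ T)
        (_ : ∀ q, ∀ t ∈ Icc t₁ (t₁ + δ q), ‖y q t - trunc (by omega) xs‖ ≤ r ∧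
          ‖W q t ⟨k, Nat.lt_succ_self k⟩ - f k t₁ (trunc (by omega) xs)‖ ≤ r)
        {η : P → State m (k + 1)} (_ : Continuous η) (_ : ∀ q, ‖η q‖ ≤ r),
        ∃ c : P → State m (k + 1), Continuous c ∧ ∀ q, ∃ x : ℝ → State m (k + 1),
          x t₁ = trunc (by omega) xs ∧
          x (t₁ + δ q) = y q (t₁ + δ q) + dilate (δ q) (k + 1) (η q) ∧
          ∀ t ∈ Icc t₁ (t₁ + δ q), HasDerivWithinAt x
            (field f (k + 1) t (x t) (v0 t + QU ((t - t₁) / δ q) (c q)))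
            (Icc t₁ (t₁ + δ q)) t := by
  obtain ⟨B, hB, hchain⟩ := hI.exists_linear_chain ht₁ xs hrank hk
  obtain ⟨QX, QU, hQX, hQU, hQ0, hQ1, hQU0, hQU1⟩ := exists_chain_curves B hB
  refine ⟨QU, hQU, hQU0, hQU1, ?_⟩
  set NX := (shiftL B (k + 1)).comp ((extendL m (k + 1)).comp (ContinuousLinearMap.inl ℝ _ _))
  set NU := (shiftL B (k + 1)).comp ((extendL m (k + 1)).comp (ContinuousLinearMap.inr ℝ _ _))
  have hN : ∀ X V, NX X + NU V = shiftL B (k + 1) (extend X V) := by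
    intro X V
    have : extend X V = extendL m (k + 1) (X, 0) + extendL m (k + 1) (0, V) := by
      rw [← map_add, extendL_apply]
      simp
    rw [this, map_add]
    rfl
  obtain ⟨K₁, hK₁⟩ := (isCompact_Icc (a := (0 : ℝ)) (b := 1)).exists_bound_of_continuousOn
    (f := QX) fun s _ => (hQX s).continuousAt.continuousWithinAt
  obtain ⟨K₂, hK₂⟩ := (isCompact_Icc (a := (0 : ℝ)) (b := 1)).exists_bound_of_continuousOn
    (f := QU) hQU.continuous.continuousOn
  set K : ℝ := max 1 (max K₁ K₂)
  have hK : 1 ≤ K := le_max_left _ _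
  have hK0 : 0 < K := one_pos.trans_le hK
  set L : ℝ≥0 := ⟨‖NX‖ + 1, by positivity⟩
  -- The constants are fixed in the order in which `exists_steering` consumes them: `κ` gives the
  -- contraction factor `1 / 4`, then `r₀` is the radius on which linearization has this accuracy,
  -- and `κ'` is the admissible residual at the origin.
  set κ : ℝ := min 1 (1 / (4 * K * Real.exp L)) with hκ
  have hκ0 : 0 < κ := by positivity
  obtain ⟨r₀, hr₀, hr₀1, hest⟩ := hchain κ hκ0
  set κ' : ℝ := r₀ / (32 * K) / Real.exp L with hκ'
  have hκ'0 : 0 < κ' := by positivity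
  set xt : State m (k + 1) := trunc (by omega) xs with hxt
  have hcont : ContinuousOn (fun q : ℝ × State m (k + 1) => field f (k + 1) q.1 q.2 (v0 q.1))
      (Icc t₀ T ×ˢ univ) :=
    (hI.continuousOn_field hk).comp (f := fun q : ℝ × State m (k + 1) => (q.1, q.2, v0 q.1))
      (by fun_prop) fun q hq => ⟨hq.1, mem_univ _⟩
  obtain ⟨ρ₁, hρ₁, hρ₁'⟩ := Metric.continuousOn_iff.1 hcont (t₁, xt) ⟨ht₁, mem_univ _⟩ (κ' / 2)
    (by positivity)
  obtain ⟨ρ₂, hρ₂, hρ₂'⟩ := Metric.continuousAt_iff.1 (hv0.continuousAt (x := t₁)) r₀ hr₀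
  have hlast : field f (k + 1) t₁ xt (v0 t₁) ⟨k, Nat.lt_succ_self k⟩ = f k t₁ (trunc (by omega) xs) := by
    rw [field, hv0t]
    congr 1
    funext ⟨j, hj⟩
    rcases Nat.lt_or_ge j (k + 1) with h | h
    · exact extend_of_lt xt _ h hj
    · obtain rfl : j = k + 1 := by
        have : j < k + 2 := hj
        omega
      exact extend_last xt _ _
  set r : ℝ := min (min r₀ (r₀ / (32 * K))) (min (κ' / 2) (min (ρ₁ / 2) (ρ₂ / 2))) with hr
  have hr0 : 0 < r := by positivity
  have hrr₀ : r ≤ r₀ := (min_le_left _ _).trans (min_le_left _ _)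
  have hrK : r ≤ r₀ / (32 * K) := (min_le_left _ _).trans (min_le_right _ _)
  have hrκ : r ≤ κ' / 2 := (min_le_right _ _).trans (min_le_left _ _)
  have hrρ₁ : r < ρ₁ := by
    have : r ≤ ρ₁ / 2 := (min_le_right _ _).trans ((min_le_right _ _).trans (min_le_left _ _))
    linarith
  have hrρ₂ : r < ρ₂ := by
    have : r ≤ ρ₂ / 2 := (min_le_right _ _).trans ((min_le_right _ _).trans (min_le_right _ _))
    linarith
  refine ⟨r, hr0, ?_⟩
  intro P _ y W hy hW hd hode hy0 δ hδ hδ0 hδr hδT hsmall η hη hηr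
  -- The equation for `X` when `x = y + dilate δ (k + 1) X` and `t = t₁ + δ s`: differentiation in
  -- `s` contributes one factor `δ`, so `k + 1 - i` becomes `k - i`.
  set G : P → ℝ → State m (k + 1) → Block m (k + 1) → State m (k + 1) := fun q s X V i =>
    (δ q ^ (k - i))⁻¹ • (field f (k + 1) (t₁ + δ q * s) (y q (t₁ + δ q * s) + dilate (δ q) (k + 1) X)
      (v0 (t₁ + δ q * s) + V) i - W q (t₁ + δ q * s) i) with hG
  have htm : ∀ q, ∀ s ∈ Icc (0 : ℝ) 1, t₁ + δ q * s ∈ Icc t₁ (t₁ + δ q) := fun q s hs =>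
    ⟨by nlinarith [hδ0 q, hs.1], by nlinarith [hδ0 q, hs.2]⟩
  have htT : ∀ q, ∀ t ∈ Icc t₁ (t₁ + δ q), t ∈ Icc t₁ T := fun q t ht =>
    ⟨ht.1, ht.2.trans (hδT q)⟩
  have htT₀ : ∀ t ∈ Icc t₁ T, t ∈ Icc t₀ T := fun t ht => ⟨ht₁.1.trans ht.1, ht.2⟩
  have htr : ∀ q, ∀ t ∈ Icc t₁ (t₁ + δ q), |t - t₁| ≤ r := fun q t ht =>
    abs_le.2 ⟨by linarith [ht.1], by linarith [ht.2, hδr q]⟩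
  have hδ1 : ∀ q, δ q ≤ 1 := fun q => (hδr q).trans (hrr₀.trans hr₀1)
  have hv0r : ∀ q, ∀ t ∈ Icc t₁ (t₁ + δ q), ‖v0 t - xs ⟨k + 1, by omega⟩‖ ≤ r₀ := by
    intro q t ht
    rw [← hv0t, ← dist_eq_norm]
    exact (hρ₂' ((htr q t ht).trans_lt hrρ₂)).le
  have hGc : ContinuousOn (fun q : P × ℝ × State m (k + 1) × Block m (k + 1) =>
      G q.1 q.2.1 q.2.2.1 q.2.2.2) (univ ×ˢ Icc 0 1 ×ˢ univ) := by
    have hmaps : MapsTo (fun q : P × ℝ × State m (k + 1) × Block m (k + 1) =>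
        (q.1, t₁ + δ q.1 * q.2.1)) (univ ×ˢ Icc 0 1 ×ˢ univ) (univ ×ˢ Icc t₁ T) := fun q hq =>
      ⟨mem_univ _, htT q.1 _ (htm q.1 _ hq.2.1)⟩
    have hyc := hy.comp (f := fun q : P × ℝ × State m (k + 1) × Block m (k + 1) =>
        (q.1, t₁ + δ q.1 * q.2.1)) (by fun_prop) hmaps
    have hWc := hW.comp (f := fun q : P × ℝ × State m (k + 1) × Block m (k + 1) =>
        (q.1, t₁ + δ q.1 * q.2.1)) (by fun_prop) hmaps
    have hdc : Continuous fun q : P × ℝ × State m (k + 1) × Block m (k + 1) =>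
        dilate (δ q.1) (k + 1) q.2.2.1 :=
      (continuous_dilate (k + 1)).comp (f := fun q : P × ℝ × State m (k + 1) × Block m (k + 1) =>
        (δ q.1, q.2.2.1)) (by fun_prop)
    have hvc : Continuous fun q : P × ℝ × State m (k + 1) × Block m (k + 1) =>
        v0 (t₁ + δ q.1 * q.2.1) + q.2.2.2 := by fun_prop
    have htc : Continuous fun q : P × ℝ × State m (k + 1) × Block m (k + 1) =>
        t₁ + δ q.1 * q.2.1 := by fun_prop
    have hfc := (hI.continuousOn_field hk).comp
      (htc.continuousOn.prodMk ((hyc.add hdc.continuousOn).prodMk hvc.continuousOn))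
      fun q hq => ⟨htT₀ _ (htT q.1 _ (htm q.1 _ hq.2.1)), mem_univ _⟩
    refine continuousOn_pi.2 fun i => ContinuousOn.fun_smul ?_ ?_
    · have : Continuous fun q : P × ℝ × State m (k + 1) × Block m (k + 1) =>
          (δ q.1 ^ (k - i))⁻¹ :=
        Continuous.inv₀ (by fun_prop) fun q => (pow_pos (hδ0 q.1) _).ne'
      exact this.continuousOn
    · exact (continuousOn_pi.1 hfc i).sub (continuousOn_pi.1 hWc i)
  have hGest : ∀ q, ∀ s ∈ Icc (0 : ℝ) 1, ∀ x x' u u', ‖x‖ ≤ r₀ → ‖x'‖ ≤ r₀ → ‖u‖ ≤ r₀ →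
      ‖u'‖ ≤ r₀ →
      ‖G q s x u - G q s x' u' - (NX (x - x') + NU (u - u'))‖ ≤ κ * max ‖x - x'‖ ‖u - u'‖ := by
    intro q s hs x x' u u' hx hx' hu hu'
    have ht := htm q s hs
    rw [hN]
    refine (pi_norm_le_iff_of_nonneg (by positivity)).2 fun i => ?_
    have h := hest (δ q) (hδ0 q) ((hδr q).trans hrr₀) _ (htT₀ _ (htT q _ ht))
      ((htr q _ ht).trans hrr₀) (y q (t₁ + δ q * s)) (v0 (t₁ + δ q * s))
      ((hsmall q _ ht).1.trans hrr₀) (hv0r q _ ht) x x' u u' hx hx' hu hu' i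
    refine le_of_eq_of_le (congrArg norm ?_) h
    simp only [Pi.sub_apply, hG, smul_sub, Nat.add_sub_cancel]
    rw [sub_sub_sub_cancel_right]
    rfl
  -- Blocks before the last have zero residual because `y` solves their equations, so the negative
  -- powers of `δ` multiply `0`. The last block carries no power of `δ`, and its residual is small
  -- because the velocity of `y` is close to the value of the field at `t₁`.
  have hG0 : ∀ q, ∀ s ∈ Icc (0 : ℝ) 1, ‖G q s 0 0‖ ≤ κ' := by
    intro q s hs
    have ht := htm q s hs
    refine (pi_norm_le_iff_of_nonneg hκ'0.le).2 fun i => ?_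
    have hdil : dilate (δ q) (k + 1) (0 : State m (k + 1)) = 0 :=
      funext fun j => smul_zero (δ q ^ (k + 1 - j))
    simp only [hG, hdil, add_zero]
    obtain ⟨i, hik⟩ := i
    rcases Nat.lt_or_ge i k with hi | hi
    rotate_left
    · obtain rfl : i = k := by omega
      simp only [Nat.sub_self, pow_zero, inv_one, one_smul]
      have h1 := (hρ₁' (t₁ + δ q * s, y q (t₁ + δ q * s)) ⟨htT₀ _ (htT q _ ht), mem_univ _⟩
        (max_lt ((htr q _ ht).trans_lt hrρ₁)
          ((dist_eq_norm _ _).trans_lt ((hsmall q _ ht).1.trans_lt hrρ₁)))).le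
      rw [dist_eq_norm] at h1
      have h2 := (norm_le_pi_norm _ ⟨i, hik⟩).trans h1
      rw [Pi.sub_apply, hlast] at h2
      have h3 := (hsmall q _ ht).2
      have h4 := norm_sub_le_norm_sub_add_norm_sub
        (field f (i + 1) (t₁ + δ q * s) (y q (t₁ + δ q * s)) (v0 (t₁ + δ q * s)) ⟨i, hik⟩)
        (f i t₁ (trunc (by omega) xs)) (W q (t₁ + δ q * s) ⟨i, hik⟩)
      rw [norm_sub_rev (f i t₁ _)] at h4
      linarith
    · have hi : i + 2 ≤ k + 1 := by omega
      have h1 := hode q _ (htT q _ ht) i hi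
      have h2 := field_of_lt (f := f) (t₁ + δ q * s) (y q (t₁ + δ q * s)) (v0 (t₁ + δ q * s)) hi
      have h3 : field f (k + 1) (t₁ + δ q * s) (y q (t₁ + δ q * s)) (v0 (t₁ + δ q * s)) ⟨i, hik⟩
          - W q (t₁ + δ q * s) ⟨i, hik⟩ = 0 := sub_eq_zero.2 (h2.trans h1.symm)
      rw [h3, smul_zero, norm_zero]
      exact hκ'0.le
  have hGlip : ∀ q₀, ∀ R : ℝ, ∃ L : ℝ≥0, ∀ᶠ q in 𝓝 q₀, ∀ s ∈ Icc (0 : ℝ) 1, ∀ u, ‖u‖ ≤ R →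
      LipschitzOnWith L (fun x => G q s x u) (closedBall 0 R) := by
    intro q₀ R
    set R' : ℝ := max (‖xt‖ + r + R) (‖xs ⟨k + 1, by omega⟩‖ + r₀ + R)
    obtain ⟨Lf, hLf⟩ := hI.lipschitz_field hk R'
    -- The negative powers of `δ` are only locally bounded in the parameter. This suffices, since
    -- this Lipschitz constant enters only continuity and uniqueness.
    set D : ℝ := (δ q₀ ^ (k + 1))⁻¹ + 1
    have hD0 : 0 ≤ D := by
      have := hδ0 q₀
      positivity
    have hDe : ∀ᶠ q in 𝓝 q₀, (δ q ^ (k + 1))⁻¹ < D := by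
      have : Continuous fun q => (δ q ^ (k + 1))⁻¹ :=
        Continuous.inv₀ (by fun_prop) fun q => (pow_pos (hδ0 q) _).ne'
      exact this.continuousAt.eventually_lt continuousAt_const (by simp [D])
    refine ⟨⟨D, hD0⟩ * Lf, hDe.mono fun q hq s hs u hu => LipschitzOnWith.of_dist_le_mul
      fun x hx x' hx' => ?_⟩
    rw [mem_closedBall_zero_iff] at hx hx'
    have ht := htm q s hs
    have hxb : ∀ x : State m (k + 1), ‖x‖ ≤ R →
        ‖y q (t₁ + δ q * s) + dilate (δ q) (k + 1) x‖ ≤ R' := by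
      intro x hx
      have h1 := (hsmall q _ ht).1
      have h2 := norm_le_norm_add_norm_sub' (y q (t₁ + δ q * s)) xt
      have h3 := norm_dilate_le (hδ0 q).le (hδ1 q) (k + 1) x
      refine (norm_add_le _ _).trans (le_max_of_le_left ?_)
      linarith
    have hub : ‖v0 (t₁ + δ q * s) + u‖ ≤ R' := by
      have h1 := hv0r q _ ht
      have h2 := norm_le_norm_add_norm_sub' (v0 (t₁ + δ q * s)) (xs ⟨k + 1, by omega⟩)
      refine (norm_add_le _ _).trans (le_max_of_le_right ?_)
      linarith
    rw [dist_eq_norm, dist_eq_norm]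
    refine (pi_norm_le_iff_of_nonneg (by positivity)).2 fun i => ?_
    have hp := hδ0 q
    have h1 := hLf _ (htT₀ _ (htT q _ ht)) _ _ _ _ (hxb x hx) (hxb x' hx') hub hub
    rw [sub_self, norm_zero, max_eq_left (norm_nonneg _), add_sub_add_left_eq_sub,
      ← dilate_sub] at h1
    have h2 := norm_dilate_le (hδ0 q).le (hδ1 q) (k + 1) (x - x')
    simp only [Pi.sub_apply, hG]
    rw [← smul_sub, sub_sub_sub_cancel_right, norm_smul, norm_inv,
      Real.norm_of_nonneg (by positivity)]
    change _ ≤ D * (Lf : ℝ) * _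
    rw [mul_assoc]
    have h3 : (δ q ^ (k - i))⁻¹ ≤ D := by
      refine le_trans ?_ hq.le
      gcongr ?_⁻¹
      exact pow_le_pow_of_le_one hp.le (hδ1 q) (by omega)
    refine mul_le_mul h3 ?_ (norm_nonneg _) hD0
    refine (norm_le_pi_norm (field f (k + 1) (t₁ + δ q * s) _ _ - _) i).trans (h1.trans ?_)
    gcongr
  have hexp : 0 < Real.exp L := Real.exp_pos _
  obtain ⟨c, hc, hX⟩ := exists_steering hGc hGlip hQX hQU.continuous hQ0 hQ1 (K := K) (κ := κ)
    (κ' := κ') (L := L) hK hr₀ (fun s hs => (hK₁ s hs).trans ((le_max_left _ _).trans (le_max_right _ _)))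
    (fun s hs => (hK₂ s hs).trans ((le_max_right _ _).trans (le_max_right _ _))) hGest hG0
    (by
      change ‖NX‖ + κ ≤ ‖NX‖ + 1
      gcongr
      exact min_le_left _ _) hκ0.le
    (by
      calc κ * K * Real.exp L ≤ 1 / (4 * K * Real.exp L) * K * Real.exp L := by
            gcongr
            exact min_le_right _ _
        _ = 1 / 4 := by field_simp)
    (by
      rw [hκ']
      exact (div_mul_cancel₀ _ hexp.ne').le) hη (fun q => (hηr q).trans hrK)
  refine ⟨c, hc, fun q => ?_⟩
  obtain ⟨X, hX0, hX1, hXd⟩ := hX q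
  have hδq := hδ0 q
  refine ⟨fun t => y q t + dilate (δ q) (k + 1) (X ((t - t₁) / δ q)), ?_, ?_, fun t ht => ?_⟩
  · have hdil : dilate (δ q) (k + 1) (0 : State m (k + 1)) = 0 :=
      funext fun j => smul_zero (δ q ^ (k + 1 - j))
    beta_reduce
    rw [sub_self, zero_div, hX0, hy0, hdil, add_zero]
  · beta_reduce
    rw [add_sub_cancel_left, div_self hδq.ne', hX1]
  · have hs : (t - t₁) / δ q ∈ Icc (0 : ℝ) 1 :=
      ⟨div_nonneg (by linarith [ht.1]) hδq.le, (div_le_one hδq).2 (by linarith [ht.2])⟩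
    have hts : t₁ + δ q * ((t - t₁) / δ q) = t := by
      field_simp
      ring
    have haff : HasDerivWithinAt (fun t => (t - t₁) / δ q) (1 / δ q) (Icc t₁ (t₁ + δ q)) t :=
      (((hasDerivAt_id t).sub_const t₁).div_const (δ q)).hasDerivWithinAt
    have hXt := HasDerivWithinAt.scomp (h := fun t => (t - t₁) / δ q) t (hXd _ hs) haff fun t ht =>
      ⟨div_nonneg (by linarith [ht.1]) hδq.le, (div_le_one hδq).2 (by linarith [ht.2])⟩
    have hyt := (hd q t (htT q t ht)).mono (Icc_subset_Icc_right (hδT q))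
    rw [hasDerivWithinAt_pi] at hXt hyt ⊢
    intro i
    have h := (hyt i).add ((hXt i).const_smul (δ q ^ (k + 1 - i)))
    convert! h using 1
    simp only [Pi.smul_apply, hG, hts]
    have hpow : δ q ^ (k + 1 - (i : ℕ)) * (1 / δ q) * (δ q ^ (k - (i : ℕ)))⁻¹ = 1 := by
      have hi := i.2
      rw [show k + 1 - (i : ℕ) = (k - i) + 1 by omega, pow_succ]
      field_simp
    rw [smul_smul, smul_smul, hpow, one_smul, add_sub_cancel]

end LocalSteering

/-! ### Following the prescribed curve backwards in time. -/

section Backward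

open Metric MeasureTheory
open scoped NNReal Interval

variable {E E₁ U X : Type*} [NormedAddCommGroup E] [NormedSpace ℝ E] [CompleteSpace E]
  [NormedAddCommGroup E₁] [NormedSpace ℝ E₁]
  [NormedAddCommGroup U]

/-- The integral of the norm over the whole segment dominates, and only the two end pieces of length
`h` contribute to it. -/
theorem norm_integral_le_of_eq_zero_middle {g : ℝ → E₁} {Λ M h σ : ℝ}
    (hg : ContinuousOn g (Icc 0 Λ)) (hM : ∀ s ∈ Icc 0 Λ, ‖g s‖ ≤ M) (hh : 0 ≤ h) (hΛ : 2 * h ≤ Λ)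
    (h0 : ∀ s ∈ Icc h (Λ - h), g s = 0) (hσ : σ ∈ Icc 0 Λ) :
    ‖∫ s in (0 : ℝ)..σ, g s‖ ≤ 2 * M * h := by
  have hint : ∀ {a b}, a ∈ Icc 0 Λ → b ∈ Icc 0 Λ →
      IntervalIntegrable (fun s => ‖g s‖) volume a b := fun ha hb =>
    (hg.norm.mono (by
      rw [← uIcc_of_le (hσ.1.trans hσ.2)] at ha hb ⊢
      exact uIcc_subset_uIcc ha hb)).intervalIntegrable
  have m0 : (0 : ℝ) ∈ Icc 0 Λ := ⟨le_rfl, by linarith⟩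
  have m1 : h ∈ Icc 0 Λ := ⟨hh, by linarith⟩
  have m2 : Λ - h ∈ Icc 0 Λ := ⟨by linarith, by linarith⟩
  have m3 : Λ ∈ Icc 0 Λ := ⟨by linarith, le_rfl⟩
  have hM0 : 0 ≤ M := (norm_nonneg _).trans (hM 0 m0)
  have hpiece : ∀ {a b}, a ∈ Icc 0 Λ → b ∈ Icc 0 Λ → a ≤ b →
      ∫ s in a..b, ‖g s‖ ≤ M * (b - a) := by
    intro a b ha hb hab
    calc ∫ s in a..b, ‖g s‖ ≤ ∫ _ in a..b, M :=
          intervalIntegral.integral_mono_on hab (hint ha hb) (by simp)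
            fun s hs => hM s ⟨ha.1.trans hs.1, hs.2.trans hb.2⟩
      _ = M * (b - a) := by rw [intervalIntegral.integral_const, smul_eq_mul, mul_comm]
  calc ‖∫ s in (0 : ℝ)..σ, g s‖ ≤ ∫ s in (0 : ℝ)..σ, ‖g s‖ :=
        intervalIntegral.norm_integral_le_integral_norm hσ.1
    _ ≤ ∫ s in (0 : ℝ)..Λ, ‖g s‖ := by
        rw [← intervalIntegral.integral_add_adjacent_intervals (hint m0 hσ) (hint hσ m3)]
        exact le_add_of_nonneg_right
          (intervalIntegral.integral_nonneg hσ.2 fun _ _ => norm_nonneg _)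
    _ = (∫ s in (0 : ℝ)..h, ‖g s‖) + (∫ s in h..(Λ - h), ‖g s‖) + ∫ s in (Λ - h)..Λ, ‖g s‖ := by
        rw [intervalIntegral.integral_add_adjacent_intervals (hint m0 m1) (hint m1 m2),
          intervalIntegral.integral_add_adjacent_intervals (hint m0 m2) (hint m2 m3)]
    _ = (∫ s in (0 : ℝ)..h, ‖g s‖) + 0 + ∫ s in (Λ - h)..Λ, ‖g s‖ := by
        congr 2
        refine (intervalIntegral.integral_congr (g := fun _ => (0 : ℝ)) fun s hs => ?_).trans (by simp)
        rw [uIcc_of_le (by linarith)] at hs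
        beta_reduce
        rw [h0 s hs, norm_zero]
    _ ≤ M * (h - 0) + 0 + M * (Λ - (Λ - h)) := by
        gcongr
        · exact hpiece m0 m1 hh
        · exact hpiece m2 m3 (by linarith)
    _ = 2 * M * h := by ring

variable [CompleteSpace E₁]

/-- A control that follows a chattering control except near the end points of `[a, b]` keeps the
solution close to the prescribed curve `y`. -/
theorem exists_backward_solution {a b : ℝ} (hab : a ≤ b) {Φ : ℝ → E → U → E}
    (hΦ : ContinuousOn (fun q : ℝ × E × U => Φ q.1 q.2.1 q.2.2) (Icc a b ×ˢ univ))
    {y W : ℝ → E} (hW : ContinuousOn W (Icc a b))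
    (hd : ∀ t ∈ Icc a b, HasDerivWithinAt y (W t) (Icc a b) t)
    {φ : ℝ → U → E₁}
    (hφ : ContinuousOn (fun q : ℝ × U => φ q.1 q.2) (Icc a b ×ˢ univ))
    {ι : E₁ →L[ℝ] E} (hι : ∀ e, ‖ι e‖ ≤ ‖e‖)
    (hφι : ∀ t ∈ Icc a b, ∀ u, Φ t (y t) u - W t = ι (φ t u))
    {u V : ℝ → U} (hu : Continuous u) (hV : Continuous V) {R M h ε : ℝ} {L : ℝ≥0}
    (huR : ∀ t ∈ Icc a b, ‖u t‖ ≤ R) (hVR : ∀ t ∈ Icc a b, ‖V t‖ ≤ R)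
    (hyR : ∀ t ∈ Icc a b, ‖y t‖ + 1 ≤ R)
    (hL : ∀ t ∈ Icc a b, ∀ u, ‖u‖ ≤ R → LipschitzOnWith L (fun x => Φ t x u) (closedBall 0 R))
    (hM : ∀ t ∈ Icc a b, ∀ u, ‖u‖ ≤ R → ‖φ t u‖ ≤ M)
    (hh : 0 ≤ h) (hh2 : 2 * h ≤ b - a) (huV : ∀ t ∈ Icc (a + h) (b - h), u t = V t)
    (hMh : 4 * M * h ≤ ε / 2)
    (hchat : ∀ σ ∈ Icc 0 (b - a), ‖∫ s in (0 : ℝ)..σ, φ (b - s) (V (b - s))‖ ≤ ε / 2)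
    (hεL : ε * Real.exp (L * (b - a)) ≤ 1) :
    ∃ x : ℝ → E, x b = y b ∧ (∀ t ∈ Icc a b, HasDerivWithinAt x (Φ t (x t) (u t)) (Icc a b) t) ∧
      ‖x a - y a‖ ≤ ε * Real.exp (L * (b - a)) := by
  have hrev : MapsTo (fun s : ℝ => b - s) (Icc 0 (b - a)) (Icc a b) := fun s hs =>
    ⟨by linarith [hs.2], by linarith [hs.1]⟩
  have hrev' : MapsTo (fun t : ℝ => b - t) (Icc a b) (Icc 0 (b - a)) := fun s hs =>
    ⟨by linarith [hs.2], by linarith [hs.1]⟩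
  have hyc : ContinuousOn y (Icc a b) := fun t ht => (hd t ht).continuousWithinAt
  -- Time is reversed so that the condition at `b` becomes an initial condition.
  set F : ℝ → E → E := fun s z => -Φ (b - s) z (u (b - s)) with hF
  have hFc : ContinuousOn (Function.uncurry F) (Icc 0 (b - a) ×ˢ univ) :=
    (hΦ.comp (f := fun q : ℝ × E => (b - q.1, q.2, u (b - q.1))) (by fun_prop)
      fun q hq => ⟨hrev hq.1, mem_univ _⟩).neg
  set Z : ℝ → E := fun s => y (b - s) with hZ
  have hZd : ∀ s ∈ Icc 0 (b - a), HasDerivWithinAt Z (-W (b - s)) (Icc 0 (b - a)) s := by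
    intro s hs
    have h1 : HasDerivWithinAt (fun s : ℝ => b - s) (-1) (Icc 0 (b - a)) s :=
      ((hasDerivAt_id s).const_sub b).hasDerivWithinAt
    have h2 := HasDerivWithinAt.scomp (h := fun s : ℝ => b - s) s (hd _ (hrev hs)) h1 hrev
    rw [neg_one_smul] at h2
    exact h2
  have hZc : ContinuousOn Z (Icc 0 (b - a)) := fun s hs => (hZd s hs).continuousWithinAt
  have hφc : ∀ {w : ℝ → U}, Continuous w →
      ContinuousOn (fun s => φ (b - s) (w (b - s))) (Icc 0 (b - a)) := fun {w} hw =>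
    hφ.comp (f := fun s : ℝ => (b - s, w (b - s))) (by fun_prop) fun s hs => ⟨hrev hs, mem_univ _⟩
  have hsub : ∀ {σ : ℝ}, σ ∈ Icc 0 (b - a) → [[0, σ]] ⊆ Icc 0 (b - a) := fun hσ => by
    rw [uIcc_of_le hσ.1]
    exact Icc_subset_Icc_right hσ.2
  have hdefect : ∀ σ ∈ Icc 0 (b - a), ‖Z σ - y b - ∫ s in (0 : ℝ)..σ, F s (Z s)‖ ≤ ε := by
    intro σ hσ
    have hWc : ContinuousOn (fun s => -W (b - s)) (Icc 0 (b - a)) :=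
      (hW.comp (by fun_prop) hrev).neg
    have h1 : Z σ - Z 0 = ∫ s in (0 : ℝ)..σ, -W (b - s) :=
      solution_eq_integral (F := fun s _ => -W (b - s))
        (hWc.comp continuousOn_fst fun q hq => hq.1) hZd hσ
    have hZ0 : Z 0 = y b := by rw [hZ]; simp
    rw [hZ0] at h1
    have hFZ : ContinuousOn (fun s => F s (Z s)) (Icc 0 (b - a)) :=
      hFc.comp (continuousOn_id.prodMk hZc) fun s hs => ⟨hs, mem_univ _⟩
    rw [h1, ← intervalIntegral.integral_sub (hWc.mono (hsub hσ)).intervalIntegrable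
      (hFZ.mono (hsub hσ)).intervalIntegrable]
    -- The defect of the reversed curve is the integral of `φ`, not of its norm, so the cancellation
    -- in the chattering control is retained.
    have h2 : ∫ s in (0 : ℝ)..σ, (-W (b - s) - F s (Z s))
        = ι (∫ s in (0 : ℝ)..σ, φ (b - s) (u (b - s))) := by
      rw [← ι.intervalIntegral_comp_comm
        ((hφc hu).mono (hsub hσ)).intervalIntegrable]
      refine intervalIntegral.integral_congr fun s hs => ?_
      rw [uIcc_of_le hσ.1] at hs
      rw [← hφι _ (hrev ⟨hs.1, hs.2.trans hσ.2⟩), hF, hZ]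
      exact neg_sub_neg _ _
    rw [h2]
    refine (hι _).trans ?_
    have h3 : ∫ s in (0 : ℝ)..σ, φ (b - s) (u (b - s))
        = (∫ s in (0 : ℝ)..σ, φ (b - s) (V (b - s)))
          + ∫ s in (0 : ℝ)..σ, (φ (b - s) (u (b - s)) - φ (b - s) (V (b - s))) := by
      rw [intervalIntegral.integral_sub ((hφc hu).mono (hsub hσ)).intervalIntegrable
      ((hφc hV).mono (hsub hσ)).intervalIntegrable]
      abel
    have h4 := norm_integral_le_of_eq_zero_middle (M := 2 * M) (h := h)
      ((hφc hu).sub (hφc hV)) (fun s hs => by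
        refine (norm_sub_le _ _).trans ?_
        have h5 := hM _ (hrev hs) _ (huR _ (hrev hs))
        have h6 := hM _ (hrev hs) _ (hVR _ (hrev hs))
        linarith) hh hh2 (fun s hs => by
        rw [Pi.sub_apply, huV (b - s) ⟨by linarith [hs.2], by linarith [hs.1]⟩, sub_self]) hσ
    rw [h3]
    refine (norm_add_le _ _).trans ?_
    have h7 := hchat σ hσ
    have h8 : 2 * (2 * M) * h = 4 * M * h := by ring
    rw [h8] at h4
    simp only [Pi.sub_apply] at h4
    linarith
  have hF1 : ∀ s ∈ Icc 0 (b - a), LipschitzOnWith L (F s) (closedBall (Z s) 1) := by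
    intro s hs
    have h1 : LipschitzOnWith L (fun x => Φ (b - s) x (u (b - s))) (closedBall (Z s) 1) :=
      (hL _ (hrev hs) _ (huR _ (hrev hs))).mono (by
      refine closedBall_subset_closedBall' ?_
      rw [dist_zero_right]
      linarith [hyR _ (hrev hs)])
    intro x hx x' hx'
    rw [hF]
    beta_reduce
    rw [edist_neg_neg]
    exact h1 hx hx'
  obtain ⟨x, hx0, hxd, hxz⟩ := exists_solution_near (sub_nonneg.2 hab) hFc hZc one_pos hF1 hdefect
    (by rwa [sub_zero])
  refine ⟨fun t => x (b - t), by simpa using hx0, fun t ht => ?_, ?_⟩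
  · have h1 : HasDerivWithinAt (fun s : ℝ => b - s) (-1) (Icc a b) t :=
      ((hasDerivAt_id t).const_sub b).hasDerivWithinAt
    have h2 := HasDerivWithinAt.scomp (h := fun s : ℝ => b - s) t (hxd _ (hrev' ht)) h1 hrev'
    rw [neg_one_smul, hF] at h2
    beta_reduce at h2
    rw [neg_neg, sub_sub_cancel] at h2
    exact h2
  · have h1 := hxz (b - a) ⟨sub_nonneg.2 hab, le_rfl⟩
    rw [hZ, sub_zero] at h1
    beta_reduce at h1
    rwa [sub_sub_cancel] at h1

/-- Requiring all smaller positive numbers to be good as well turns the admissible bounds into an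
interval. This set is convex, so locally constant choices are patched by a partition of unity. -/
theorem exists_continuous_of_local {X : Type*} [TopologicalSpace X] [ParacompactSpace X]
    [NormalSpace X] {good : X → ℝ → Prop}
    (h : ∀ x₀, ∃ h₀ > 0, ∀ᶠ x in 𝓝 x₀, ∀ h, 0 < h → h ≤ h₀ → good x h) :
    ∃ δ : X → ℝ, Continuous δ ∧ ∀ x, 0 < δ x ∧ good x (δ x) := by
  obtain ⟨g, hg⟩ := exists_continuous_forall_mem_convex_of_local_const
    (t := fun x => {d : ℝ | 0 < d ∧ ∀ h, 0 < h → h ≤ d → good x h})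
    (fun x => by
      refine Set.OrdConnected.convex ⟨fun a ha b hb c hc =>
        ⟨ha.1.trans_le hc.1, fun h h0 hh => hb.2 h h0 (hh.trans hc.2)⟩⟩)
    (fun x₀ => by
      obtain ⟨h₀, hh₀, hx⟩ := h x₀
      exact ⟨h₀, hx.mono fun x hx => ⟨hh₀, hx⟩⟩)
  exact ⟨g, g.continuous, fun x => ⟨(hg x).1, (hg x).2 _ (hg x).1 le_rfl⟩⟩

theorem exists_eventually_bound [MetricSpace X] [ProperSpace X] {Z F : Type*} [TopologicalSpace Z]
    [NormedAddCommGroup F] {g : X → Z → F} {K : Set Z} (hK : IsCompact K)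
    (hg : ContinuousOn (fun q : X × Z => g q.1 q.2) (univ ×ˢ K)) (x₀ : X) :
    ∃ M, ∀ᶠ x in 𝓝 x₀, ∀ z ∈ K, ‖g x z‖ ≤ M := by
  obtain ⟨M, hM⟩ := ((isCompact_closedBall x₀ 1).prod hK).exists_bound_of_continuousOn
    (hg.mono (prod_mono_left (subset_univ _)))
  exact ⟨M, eventually_of_mem (closedBall_mem_nhds x₀ one_pos) fun x hx z hz => hM (x, z) ⟨hx, hz⟩⟩

end Backward

/-! ### Transitions between the affine, the chattering and the terminal control. -/

section Blend

variable {U : Type*} [NormedAddCommGroup U] [NormedSpace ℝ U]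

/-- The control that equals `v0` before `a`, follows `V` inside `[a, b]` and reaches `β` at `b`, with
transitions of length `h`. -/
noncomputable def blend (v0 V : ℝ → U) (β : U) (a b h t : ℝ) : U :=
  v0 t + Real.smoothTransition ((t - a) / h) • (V t - v0 t)
    + Real.smoothTransition (1 - (b - t) / h) • (β - V t)

variable {v0 V : ℝ → U} {β : U} {a b h t : ℝ}

theorem blend_of_le (hh : 0 < h) (hab : h ≤ b - a) (ht : t ≤ a) : blend v0 V β a b h t = v0 t := by
  have h1 : 1 ≤ (b - t) / h := (one_le_div hh).2 (by linarith)
  rw [blend, Real.smoothTransition.zero_of_nonpos (div_nonpos_of_nonpos_of_nonneg (by linarith) hh.le),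
    Real.smoothTransition.zero_of_nonpos (by linarith), zero_smul, zero_smul, add_zero, add_zero]

theorem blend_right (hh : 0 < h) (hab : h ≤ b - a) : blend v0 V β a b h b = β := by
  rw [blend, Real.smoothTransition.one_of_one_le ((one_le_div hh).2 hab),
    Real.smoothTransition.one_of_one_le (by simp), one_smul, one_smul]
  abel

theorem blend_middle (hh : 0 < h) (ht : t ∈ Icc (a + h) (b - h)) : blend v0 V β a b h t = V t := by
  have h1 : 1 ≤ (b - t) / h := (one_le_div hh).2 (by linarith [ht.2])
  rw [blend, Real.smoothTransition.one_of_one_le ((one_le_div hh).2 (by linarith [ht.1])),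
    Real.smoothTransition.zero_of_nonpos (by linarith), one_smul, zero_smul]
  abel

theorem norm_blend_le {R : ℝ} (h0 : ‖v0 t‖ ≤ R) (hV : ‖V t‖ ≤ R) (hβ : ‖β‖ ≤ R) :
    ‖blend v0 V β a b h t‖ ≤ 5 * R := by
  have hs : ∀ (s : ℝ) (u : U), ‖Real.smoothTransition s • u‖ ≤ ‖u‖ := fun s u => by
    rw [norm_smul, Real.norm_of_nonneg (Real.smoothTransition.nonneg s)]
    exact mul_le_of_le_one_left (norm_nonneg _) (Real.smoothTransition.le_one s)
  refine (norm_add₃_le).trans ?_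
  have h1 := (hs ((t - a) / h) (V t - v0 t)).trans (norm_sub_le _ _)
  have h2 := (hs (1 - (b - t) / h) (β - V t)).trans (norm_sub_le _ _)
  linarith

theorem JointC1.blend {Y : Type*} [TopologicalSpace Y] (hv0 : ContDiff ℝ 1 v0) {V : Y → ℝ → U}
    (hV : JointC1 V) {β : Y → U} (hβ : Continuous β) {a h : Y → ℝ} (ha : Continuous a)
    (hh : Continuous h) (hh0 : ∀ q, 0 < h q) (b : ℝ) :
    JointC1 fun q t => TriangularControl.blend v0 (V q) (β q) (a q) b (h q) t := by
  have hS : JointC1 fun (_ : Unit) t => Real.smoothTransition t :=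
    JointC1.of_contDiff Real.smoothTransition.contDiff
  have hi : Continuous fun q => 1 / h q := continuous_const.div hh fun q => (hh0 q).ne'
  have h1 := hS.comp_affine (π := fun _ : Y => ()) continuous_const hi
    (β := fun q => -a q / h q) (ha.neg.div hh fun q => (hh0 q).ne')
  have h2 := hS.comp_affine (π := fun _ : Y => ()) continuous_const hi
    (β := fun q => 1 - b / h q) (continuous_const.sub (continuous_const.div hh fun q => (hh0 q).ne'))
  have h0 : JointC1 fun (_ : Y) t => v0 t := JointC1.of_contDiff hv0
  have h3 := (h0.add (h1.smul (hV.sub h0))).add (h2.smul ((JointC1.const hβ).sub hV))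
  convert! h3 using 3 with q t
  rw [TriangularControl.blend]
  congr 4 <;> ring

end Blend

/-! ### Continuous families of backward controls. -/

section Backward

open Metric MeasureTheory
open scoped NNReal

variable {E E₁ U X : Type*} [NormedAddCommGroup E] [NormedSpace ℝ E] [CompleteSpace E]
  [NormedAddCommGroup E₁] [NormedSpace ℝ E₁] [FiniteDimensional ℝ E₁]
  [NormedAddCommGroup U] [NormedSpace ℝ U] [ProperSpace U] [MetricSpace X] [ProperSpace X]

set_option maxHeartbeats 1000000 in
/-- Continuous families of controls whose solutions, ending at the end point of `y`, stay close to
`y` down to the time `t₁ + δ`. -/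
theorem exists_backward_control {t₁ T : ℝ} (ht₁T : t₁ ≤ T) {Φ : ℝ → E → U → E}
    (hΦ : ContinuousOn (fun q : ℝ × E × U => Φ q.1 q.2.1 q.2.2) (Icc t₁ T ×ˢ univ))
    (hΦL : ∀ R : ℝ, ∃ L : ℝ≥0, ∀ t ∈ Icc t₁ T, ∀ u, ‖u‖ ≤ R →
      LipschitzOnWith L (fun x => Φ t x u) (closedBall 0 R))
    {y W : X → ℝ → E} (hy : ContinuousOn (fun q : X × ℝ => y q.1 q.2) (univ ×ˢ Icc t₁ T))
    (hW : ContinuousOn (fun q : X × ℝ => W q.1 q.2) (univ ×ˢ Icc t₁ T))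
    (hd : ∀ ξ, ∀ t ∈ Icc t₁ T, HasDerivWithinAt (y ξ) (W ξ t) (Icc t₁ T) t)
    {φ : X → ℝ → U → E₁}
    (hφ : ContinuousOn (fun q : X × ℝ × U => φ q.1 q.2.1 q.2.2) (univ ×ˢ Icc t₁ T ×ˢ univ))
    (hsurj : ∀ ξ, ∀ t ∈ Icc t₁ T, Function.Surjective (φ ξ t))
    {ι : E₁ →L[ℝ] E} (hι : ∀ e, ‖ι e‖ ≤ ‖e‖)
    (hφι : ∀ ξ, ∀ t ∈ Icc t₁ T, ∀ u, Φ t (y ξ t) u - W ξ t = ι (φ ξ t u))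
    {v0 : ℝ → U} (hv0 : ContDiff ℝ 1 v0) {δ : X → ℝ} (hδ : Continuous δ) (hδ0 : ∀ ξ, 0 < δ ξ)
    (hδT : ∀ ξ, t₁ + δ ξ < T) {ε : X → ℝ} (hε : Continuous ε) (hε0 : ∀ ξ, 0 < ε ξ) :
    ∃ Uc : X × U → ℝ → U, JointC1 Uc ∧ (∀ q, ∀ t ≤ t₁ + δ q.1, Uc q t = v0 t) ∧
      (∀ q, Uc q T = q.2) ∧ ∃ x₁ : X × U → E, Continuous x₁ ∧
        ∀ q, ‖x₁ q - y q.1 (t₁ + δ q.1)‖ ≤ ε q.1 ∧ ∃ x : ℝ → E, x (t₁ + δ q.1) = x₁ q ∧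
          x T = y q.1 T ∧ ∀ t ∈ Icc (t₁ + δ q.1) T,
            HasDerivWithinAt x (Φ t (x t) (Uc q t)) (Icc (t₁ + δ q.1) T) t := by
  have := FiniteDimensional.complete ℝ E₁
  have hsubI : ∀ ξ, Icc (t₁ + δ ξ) T ⊆ Icc t₁ T := fun ξ =>
    Icc_subset_Icc_left (by linarith [hδ0 ξ])
  -- Chattering is applied in reversed time, since its integrals start at `0`, which corresponds to
  -- `T`. The projection extends `φ` to all times.
  set τ : ℝ → ℝ := fun σ => projIcc t₁ T ht₁T (T - σ) with hτ
  have hτm : ∀ σ, τ σ ∈ Icc t₁ T := fun σ => (projIcc t₁ T ht₁T (T - σ)).2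
  have hτc : Continuous τ := continuous_subtype_val.comp (continuous_projIcc.comp (by fun_prop))
  have hτeq : ∀ σ ∈ Icc 0 (T - t₁), τ σ = T - σ := fun σ hσ => by
    rw [hτ]
    beta_reduce
    rw [projIcc_of_mem ht₁T ⟨by linarith [hσ.2], by linarith [hσ.1]⟩]
  obtain ⟨V, hVC, hV⟩ := exists_chattering (φ := fun ξ σ v => φ ξ (τ σ) v) (sub_nonneg.2 ht₁T)
    (hφ.comp_continuous (f := fun q : X × ℝ × U => (q.1, τ q.2.1, q.2.2)) (by fun_prop)
      fun q => ⟨mem_univ _, hτm _, mem_univ _⟩) fun ξ σ => hsurj ξ _ (hτm σ)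
  have hslice : ∀ {g : X → ℝ → E}, ContinuousOn (fun q : X × ℝ => g q.1 q.2) (univ ×ˢ Icc t₁ T) →
      ∀ ξ, ContinuousOn (g ξ) (Icc t₁ T) := fun hg ξ =>
    hg.comp (f := fun t : ℝ => (ξ, t)) (by fun_prop) fun t ht => ⟨mem_univ _, ht⟩
  obtain ⟨h, hhc, hh⟩ := exists_continuous_of_local (X := X × U) (good := fun q h => ∀ hh : 0 < h,
      2 * h ≤ T - (t₁ + δ q.1) ∧ ∃ x : ℝ → E, x T = y q.1 T ∧ (∀ t ∈ Icc (t₁ + δ q.1) T,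
        HasDerivWithinAt x (Φ t (x t) (blend v0 (fun t => V (q.1, ⟨h, hh⟩) (-1 * t + T)) q.2
          (t₁ + δ q.1) T h t)) (Icc (t₁ + δ q.1) T) t) ∧
        ‖x (t₁ + δ q.1) - y q.1 (t₁ + δ q.1)‖ ≤ ε q.1) (by
    rintro ⟨ξ₀, β₀⟩
    obtain ⟨⟨RV, hRV⟩, hchat⟩ := hV ξ₀
    obtain ⟨Ry, hRy⟩ := exists_eventually_bound isCompact_Icc hy ξ₀
    obtain ⟨R0, hR0⟩ := (isCompact_Icc (a := t₁) (b := T)).exists_bound_of_continuousOn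
      hv0.continuous.continuousOn
    -- A common bound, locally uniform in the parameters, for the three ingredients of the control
    -- and for the tube around the curve. The blended control can be up to five times as large.
    set R₁ : ℝ := |RV| + |Ry| + |R0| + ‖β₀‖ + 2 with hR₁
    have hRVR : RV ≤ R₁ := by
      linarith [le_abs_self RV, abs_nonneg Ry, abs_nonneg R0, norm_nonneg β₀]
    have hRyR : Ry + 1 ≤ R₁ := by
      linarith [abs_nonneg RV, le_abs_self Ry, abs_nonneg R0, norm_nonneg β₀]
    have hR0R : R0 ≤ R₁ := by
      linarith [abs_nonneg RV, abs_nonneg Ry, le_abs_self R0, norm_nonneg β₀]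
    have hβR : ‖β₀‖ + 1 ≤ R₁ := by
      linarith [abs_nonneg RV, abs_nonneg Ry, abs_nonneg R0]
    have hR₁0 : 0 ≤ R₁ := by positivity
    obtain ⟨L, hL⟩ := hΦL (5 * R₁)
    obtain ⟨M, hM⟩ := exists_eventually_bound (g := fun ξ (z : ℝ × U) => φ ξ z.1 z.2)
      ((isCompact_Icc (a := t₁) (b := T)).prod (isCompact_closedBall (0 : U) (5 * R₁)))
      (hφ.mono (prod_mono_right (prod_mono_right (subset_univ _)))) ξ₀
    set M' : ℝ := max M 1 with hM'
    have hM'0 : 0 < M' := by positivity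
    have hεξ := hε0 ξ₀
    -- Half of `ε ξ₀` is used because `ε` exceeds it throughout a neighbourhood. The `1` is the
    -- radius of the tube.
    set ε' : ℝ := min 1 (ε ξ₀ / 2) / Real.exp (L * (T - t₁)) with hε'
    have hε'0 : 0 < ε' := by positivity
    obtain ⟨h₁, hh₁, hch⟩ := hchat (ε' / 2) (by positivity)
    have hgap : 0 < T - (t₁ + δ ξ₀) := sub_pos.2 (hδT ξ₀)
    refine ⟨min h₁ (min ((T - (t₁ + δ ξ₀)) / 4) (ε' / (8 * M'))), by positivity, ?_⟩
    have e1 : ∀ᶠ ξ in 𝓝 ξ₀, (T - (t₁ + δ ξ₀)) / 2 < T - (t₁ + δ ξ) :=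
      continuousAt_const.eventually_lt (by fun_prop) (by linarith)
    have e2 : ∀ᶠ ξ in 𝓝 ξ₀, ε ξ₀ / 2 < ε ξ :=
      continuousAt_const.eventually_lt hε.continuousAt (by linarith)
    have e3 : ∀ᶠ β in 𝓝 β₀, ‖β‖ < ‖β₀‖ + 1 :=
      continuous_norm.continuousAt.eventually_lt continuousAt_const (by linarith)
    filter_upwards [(e1.and (e2.and (hRV.and (hRy.and (hM.and hch))))).prod_inl_nhds β₀,
      e3.prod_inr_nhds ξ₀] with ⟨ξ, β⟩ ⟨f1, f2, f3, f4, f5, f6⟩ f7 h h0 hhle hh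
    have g1 : h ≤ h₁ := hhle.trans (min_le_left _ _)
    have g2 : h ≤ (T - (t₁ + δ ξ₀)) / 4 :=
      hhle.trans ((min_le_right _ _).trans (min_le_left _ _))
    have g3 : h ≤ ε' / (8 * M') := hhle.trans ((min_le_right _ _).trans (min_le_right _ _))
    dsimp only at f1 f2 f3 f4 f5 f6 f7 ⊢
    have hlen : 2 * h ≤ T - (t₁ + δ ξ) := by linarith
    refine ⟨hlen, ?_⟩
    have hexp : ε' * Real.exp (L * (T - (t₁ + δ ξ))) ≤ min 1 (ε ξ₀ / 2) := by
      calc _ ≤ ε' * Real.exp (L * (T - t₁)) := by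
            gcongr
            linarith [hδ0 ξ]
        _ = _ := div_mul_cancel₀ _ (Real.exp_pos _).ne'
    set Vf : ℝ → U := fun t => V (ξ, ⟨h, hh⟩) (-1 * t + T) with hVf
    have hVfc : Continuous Vf := hVC.continuous.comp (f := fun t : ℝ => (_, -1 * t + T)) (by fun_prop)
    have hVfR : ∀ t, ‖Vf t‖ ≤ R₁ := fun t => (f3 _ _).trans hRVR
    have hβ1 : ‖β‖ ≤ R₁ := f7.le.trans hβR
    have huc : Continuous fun t => blend v0 Vf β (t₁ + δ ξ) T h t := by
      have hSc := Real.smoothTransition.continuous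
      have hv0c := hv0.continuous
      unfold blend
      fun_prop
    obtain ⟨x, hx1, hx2, hx3⟩ := exists_backward_solution (hδT ξ).le
      (hΦ.mono (prod_mono_left (hsubI ξ))) ((hslice hW ξ).mono (hsubI ξ))
      (fun t ht => (hd ξ t (hsubI ξ ht)).mono (hsubI ξ))
      (hφ.comp (f := fun q : ℝ × U => (ξ, q)) (by fun_prop)
        fun q hq => ⟨mem_univ _, hsubI ξ hq.1, mem_univ _⟩) hι
      (fun t ht => hφι ξ t (hsubI ξ ht)) huc hVfc (R := 5 * R₁) (M := M') (h := h) (ε := ε') (L := L)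
      (fun t ht => norm_blend_le ((hR0 t (hsubI ξ ht)).trans hR0R) (hVfR t) hβ1)
      (fun t _ => (hVfR t).trans (by linarith))
      (fun t ht => by linarith [f4 t (hsubI ξ ht)])
      (fun t ht => hL t (hsubI ξ ht))
      (fun t ht u hu => (f5 (t, u) ⟨hsubI ξ ht, mem_closedBall_zero_iff.2 hu⟩).trans
        (le_max_left _ _)) hh.le hlen (fun t ht => blend_middle hh ht)
      (by
        rw [le_div_iff₀ (by positivity)] at g3
        linarith)
      (fun σ hσ => by
        have hσ' : σ ∈ Icc 0 (T - t₁) := ⟨hσ.1, by linarith [hσ.2, hδ0 ξ]⟩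
        refine le_of_eq_of_le (congrArg norm ?_) (f6 ⟨h, hh⟩ g1 σ hσ')
        refine intervalIntegral.integral_congr fun s hs => ?_
        rw [uIcc_of_le hσ.1] at hs
        rw [hτeq s ⟨hs.1, hs.2.trans hσ'.2⟩, hVf]
        beta_reduce
        congr 2
        ring)
      (hexp.trans (min_le_left _ _))
    exact ⟨x, hx1, hx2, hx3.trans (hexp.trans ((min_le_right _ _).trans f2.le))⟩)
  have hh0 : ∀ q, 0 < h q := fun q => (hh q).1
  have hlen : ∀ q : X × U, 2 * h q ≤ T - (t₁ + δ q.1) := fun q => ((hh q).2 (hh0 q)).1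
  choose x hxT hxd hxε using fun q => ((hh q).2 (hh0 q)).2
  set Uc : X × U → ℝ → U := fun q t => blend v0
    (fun t => V (q.1, ⟨h q, hh0 q⟩) (-1 * t + T)) q.2 (t₁ + δ q.1) T (h q) t with hUc
  have hUcC : JointC1 Uc := by
    have h1 := hVC.comp_affine (π := fun q : X × U => (q.1, (⟨h q, hh0 q⟩ : Ioi (0 : ℝ))))
      (continuous_fst.prodMk (hhc.subtype_mk _)) (α := fun _ => -1) continuous_const
      (β := fun _ => T) continuous_const
    exact JointC1.blend hv0 h1 continuous_snd (by fun_prop) hhc hh0 T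
  refine ⟨Uc, hUcC, fun q t ht => blend_of_le (hh0 q) (by linarith [hlen q, hh0 q]) ht,
    fun q => blend_right (hh0 q) (by linarith [hlen q, hh0 q]), fun q => x q (t₁ + δ q.1), ?_,
    fun q => ⟨hxε q, x q, rfl, hxT q, hxd q⟩⟩
  -- The intervals `[t₁ + δ, T]` vary with the parameter. Rescaling them to `[0, 1]`, with time
  -- reversed, allows continuous dependence of the end point to be applied.
  set Λ : X × U → ℝ := fun q => T - (t₁ + δ q.1) with hΛ
  have hΛc : Continuous Λ := by fun_prop
  have hΛ0 : ∀ q, 0 < Λ q := fun q => sub_pos.2 (hδT q.1)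
  have hm : ∀ q, ∀ s ∈ Icc (0 : ℝ) 1, T - s * Λ q ∈ Icc (t₁ + δ q.1) T := fun q s hs =>
    ⟨by
      have := mul_le_of_le_one_left (hΛ0 q).le hs.2
      simp only [hΛ] at this ⊢
      linarith, by linarith [mul_nonneg hs.1 (hΛ0 q).le]⟩
  have hend := continuous_solution_endpoint (E := E) (P := X × U) zero_le_one
    (F := fun q s z => -Λ q • Φ (T - s * Λ q) z (Uc q (T - s * Λ q)))
    (x₀ := fun q => y q.1 T) (x := fun q s => x q (T - s * Λ q)) ?_ ?_ ?_ (fun q => ?_)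
    (fun q s hs => ?_)
  · convert! hend using 2 with q
    simp [hΛ]
  · have h1 : Continuous fun q : (X × U) × ℝ × E => Uc q.1 (T - q.2.1 * Λ q.1) :=
      hUcC.continuous.comp (f := fun q : (X × U) × ℝ × E => (q.1, T - q.2.1 * Λ q.1)) (by fun_prop)
    have h2 := hΦ.comp (f := fun q : (X × U) × ℝ × E =>
      (T - q.2.1 * Λ q.1, q.2.2, Uc q.1 (T - q.2.1 * Λ q.1)))
      (s := univ ×ˢ Icc 0 1 ×ˢ univ)
      (Continuous.prodMk (by fun_prop) (Continuous.prodMk (by fun_prop) h1)).continuousOn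
      fun q hq => ⟨hsubI _ (hm q.1 _ hq.2.1), mem_univ _⟩
    exact ContinuousOn.fun_smul (by fun_prop) h2
  · intro q₀ R
    obtain ⟨Ru, hRu⟩ := exists_eventually_bound (X := X × U) (isCompact_Icc (a := t₁) (b := T))
      hUcC.continuous.continuousOn q₀
    obtain ⟨L, hL⟩ := hΦL (max R Ru)
    refine ⟨⟨T - t₁, sub_nonneg.2 ht₁T⟩ * L, hRu.mono fun q hq s hs =>
      LipschitzOnWith.of_dist_le_mul fun z hz z' hz' => ?_⟩
    have hms := hsubI _ (hm q s hs)
    have hb := closedBall_subset_closedBall (x := (0 : E)) (le_max_left R Ru)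
    have h1 := (hL _ hms _ ((hq _ hms).trans (le_max_right _ _))).dist_le_mul _ (hb hz) _ (hb hz')
    rw [dist_eq_norm] at h1
    rw [dist_eq_norm, ← smul_sub, norm_smul, norm_neg, Real.norm_of_nonneg (hΛ0 q).le]
    change _ ≤ (T - t₁) * (L : ℝ) * _
    rw [mul_assoc]
    refine mul_le_mul ?_ h1 (norm_nonneg _) (sub_nonneg.2 ht₁T)
    simp only [hΛ]
    linarith [hδ0 q.1]
  · exact hy.comp_continuous (f := fun q : X × U => (q.1, T)) (by fun_prop)
      fun q => ⟨mem_univ _, ht₁T, le_rfl⟩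
  · rw [zero_mul, sub_zero, hxT]
  · have h1 : HasDerivWithinAt (fun s : ℝ => T - s * Λ q) (-Λ q) (Icc 0 1) s := by
      have := (((hasDerivAt_id s).mul_const (Λ q)).const_sub T).hasDerivWithinAt (s := Icc 0 1)
      rwa [one_mul] at this
    exact HasDerivWithinAt.scomp (h := fun s : ℝ => T - s * Λ q) s (hxd q _ (hm q s hs)) h1
      fun s hs => hm q s hs

end Backward

/-! ### Gluing the two pieces of the trajectory and of the control. -/

section Assembly

open Metric
open scoped NNReal

/-- Converts the description of the given family as a map into a function space into joint
continuity in parameter and time, the form used in all the constructions. -/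
theorem continuousOn_prod_of_tendstoUniformlyOn {X Z F : Type*} [TopologicalSpace X]
    [TopologicalSpace Z] [PseudoMetricSpace F] {g : X → Z → F} {K : Set Z}
    (hu : ∀ x₀, TendstoUniformlyOn g (g x₀) (𝓝 x₀) K) (hc : ∀ x, ContinuousOn (g x) K) :
    ContinuousOn (fun q : X × Z => g q.1 q.2) (univ ×ˢ K) := by
  rintro ⟨x₀, z₀⟩ ⟨-, hz₀⟩
  rw [Metric.continuousWithinAt_iff']
  intro ε hε
  have h1 := Metric.tendstoUniformlyOn_iff.1 (hu x₀) (ε / 2) (half_pos hε)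
  have h2 := Metric.continuousWithinAt_iff'.1 (hc x₀ z₀ hz₀) (ε / 2) (half_pos hε)
  rw [nhdsWithin_prod_eq, nhdsWithin_univ]
  filter_upwards [(h1.prod_mk (h2.and self_mem_nhdsWithin))] with ⟨x, z⟩ ⟨h3, h4, hz⟩
  have h5 := h3 z hz
  calc dist (g x z) (g x₀ z₀) ≤ dist (g x z) (g x₀ z) + dist (g x₀ z) (g x₀ z₀) := dist_triangle _ _ _
    _ < ε := by
      rw [dist_comm (g x z)]
      linarith

/-- At the junction both one-sided derivatives equal the field at the common value, and derivatives
within two sets combine on their union. Away from one of the closed pieces the derivative within it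
is vacuous. -/
theorem exists_glued_solution {E : Type*} [NormedAddCommGroup E] [NormedSpace ℝ E] {F : ℝ → E → E}
    {a c b : ℝ} (hac : a ≤ c) (hcb : c < b) {x₁ x₂ : ℝ → E} (hx : x₁ c = x₂ c)
    (h₁ : ∀ t ∈ Icc a c, HasDerivWithinAt x₁ (F t (x₁ t)) (Icc a c) t)
    (h₂ : ∀ t ∈ Icc c b, HasDerivWithinAt x₂ (F t (x₂ t)) (Icc c b) t) :
    ∃ x : ℝ → E, x a = x₁ a ∧ x b = x₂ b ∧
      ∀ t ∈ Icc a b, HasDerivWithinAt x (F t (x t)) (Icc a b) t := by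
  set x : ℝ → E := fun t => if t ≤ c then x₁ t else x₂ t with hxdef
  have e₁ : ∀ t ∈ Icc a c, x t = x₁ t := fun t ht => if_pos ht.2
  have e₂ : ∀ t ∈ Icc c b, x t = x₂ t := by
    intro t ht
    rcases ht.1.eq_or_lt with h | h
    · rw [← h, ← hx]
      exact if_pos le_rfl
    · exact if_neg (not_le.2 h)
  refine ⟨x, e₁ a ⟨le_rfl, hac⟩, e₂ b ⟨hcb.le, le_rfl⟩, fun t ht => ?_⟩
  rw [← Icc_union_Icc_eq_Icc hac hcb.le]
  have key : ∀ (x' : ℝ → E) (s : Set ℝ), IsClosed s → (∀ t ∈ s, x t = x' t) →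
      (∀ t ∈ s, HasDerivWithinAt x' (F t (x' t)) s t) → HasDerivWithinAt x (F t (x t)) s t := by
    intro x' s hs he hd
    by_cases hts : t ∈ s
    · rw [he t hts]
      exact (hd t hts).congr he (he t hts)
    · exact HasFDerivWithinAt.of_notMem_closure (by rwa [hs.closure_eq])
  exact (key x₁ _ isClosed_Icc e₁ h₁).union (key x₂ _ isClosed_Icc e₂ h₂)

variable {m : ℕ → ℕ} {ν : ℕ} {f : (i : ℕ) → ℝ → State m (i + 2) → Block m i} {t₀ t₁ T : ℝ}

theorem exists_joint_derivative (hT : t₁ < T) {p : ℕ} {y : State m p → ℝ → State m p}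
    (hy : ∀ i : Fin p, ContinuousC1Family t₁ T (fun ξ t => y ξ t i)) :
    ContinuousOn (fun q : State m p × ℝ => y q.1 q.2) (univ ×ˢ Icc t₁ T) ∧
    ∃ W : State m p → ℝ → State m p,
      ContinuousOn (fun q : State m p × ℝ => W q.1 q.2) (univ ×ˢ Icc t₁ T) ∧
      ∀ ξ, ∀ t ∈ Icc t₁ T, HasDerivWithinAt (y ξ) (W ξ t) (Icc t₁ T) t := by
  refine ⟨continuousOn_pi.2 fun i => continuousOn_prod_of_tendstoUniformlyOn (hy i).tendsto
    fun ξ => ((hy i).contDiffOn ξ).continuousOn,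
    fun ξ t i => derivWithin (fun t => y ξ t i) (Icc t₁ T) t, continuousOn_pi.2 fun i =>
      continuousOn_prod_of_tendstoUniformlyOn (hy i).tendsto_deriv fun ξ =>
        ((hy i).contDiffOn ξ).continuousOn_derivWithin (uniqueDiffOn_Icc hT) le_rfl,
    fun ξ t ht => hasDerivWithinAt_pi.2 fun i => ?_⟩
  exact (((hy i).contDiffOn ξ).differentiableOn one_ne_zero t ht).hasDerivWithinAt

theorem dilate_inverse {δ : ℝ} (hδ : δ ≠ 0) {p : ℕ} (x : State m p) :
    dilate δ p (fun i => (δ ^ (p - i))⁻¹ • x i) = x :=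
  funext fun i => smul_inv_smul₀ (pow_ne_zero (p - i) hδ) (x i)

/-- Supplies the length of the steering interval as a continuous function: `y` and `w` keep their
initial values near `t₁` up to `r`, locally uniformly in the parameter. -/
theorem exists_small_time {X : Type*} [MetricSpace X] (hT : t₁ < T) {r : ℝ} (hr : 0 < r) {E F : Type*}
    [PseudoMetricSpace E] [PseudoMetricSpace F] {y : X → ℝ → E} {w : X → ℝ → F} {y₀ : E} {w₀ : F}
    (hy : ContinuousOn (fun q : X × ℝ => y q.1 q.2) (univ ×ˢ Icc t₁ T))
    (hw : ContinuousOn (fun q : X × ℝ => w q.1 q.2) (univ ×ˢ Icc t₁ T))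
    (hy0 : ∀ ξ, y ξ t₁ = y₀) (hw0 : ∀ ξ, w ξ t₁ = w₀) :
    ∃ δ : X → ℝ, Continuous δ ∧ ∀ ξ, 0 < δ ξ ∧ δ ξ ≤ r ∧ t₁ + δ ξ < T ∧
      ∀ t ∈ Icc t₁ (t₁ + δ ξ), dist (y ξ t) y₀ ≤ r ∧ dist (w ξ t) w₀ ≤ r := by
  refine exists_continuous_of_local (good := fun ξ d => d ≤ r ∧ t₁ + d < T ∧
    ∀ t ∈ Icc t₁ (t₁ + d), dist (y ξ t) y₀ ≤ r ∧ dist (w ξ t) w₀ ≤ r) fun ξ₀ => ?_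
  have hm : (ξ₀, t₁) ∈ (univ : Set X) ×ˢ Icc t₁ T := ⟨mem_univ _, le_rfl, hT.le⟩
  obtain ⟨ρ₁, hρ₁, h₁⟩ := Metric.continuousOn_iff.1 hy _ hm r hr
  obtain ⟨ρ₂, hρ₂, h₂⟩ := Metric.continuousOn_iff.1 hw _ hm r hr
  have hT' : 0 < T - t₁ := sub_pos.2 hT
  refine ⟨min (min r ((T - t₁) / 2)) (min ρ₁ ρ₂ / 2), by positivity, ?_⟩
  filter_upwards [ball_mem_nhds ξ₀ (lt_min hρ₁ hρ₂)] with ξ hξ d hd hdle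
  have d1 : d ≤ r := hdle.trans ((min_le_left _ _).trans (min_le_left _ _))
  have d2 : d ≤ (T - t₁) / 2 := hdle.trans ((min_le_left _ _).trans (min_le_right _ _))
  have d3 : d ≤ min ρ₁ ρ₂ / 2 := hdle.trans (min_le_right _ _)
  refine ⟨d1, by linarith, fun t ht => ?_⟩
  have hdist : dist (ξ, t) (ξ₀, t₁) < min ρ₁ ρ₂ := by
    refine max_lt hξ ?_
    rw [Real.dist_eq, abs_of_nonneg (sub_nonneg.2 ht.1)]
    linarith [ht.2, lt_min hρ₁ hρ₂]
  have htm : (ξ, t) ∈ (univ : Set X) ×ˢ Icc t₁ T := ⟨mem_univ _, ht.1, by linarith [ht.2]⟩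
  have g1 := (h₁ _ htm (hdist.trans_le (min_le_left _ _))).le
  have g2 := (h₂ _ htm (hdist.trans_le (min_le_right _ _))).le
  dsimp only at g1 g2
  rw [hy0] at g1
  rw [hw0] at g2
  exact ⟨g1, g2⟩

theorem RegularField.trajectory_unique (hI : RegularField ν f t₀ T) (ht₁ : t₁ ∈ Icc t₀ T) {p : ℕ}
    (hp : p ≤ ν) {v : ℝ → Block m p} (hv : ContinuousOn v (Icc t₁ T)) {y₀ : State m p}
    {x x' : ℝ → State m p} (hx : IsTrajectory f p t₁ T y₀ v x)
    (hx' : IsTrajectory f p t₁ T y₀ v x') : EqOn x x' (Icc t₁ T) := by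
  obtain ⟨Rv, hRv⟩ := isCompact_Icc.exists_bound_of_continuousOn hv
  refine solution_unique (F := fun t x => field f p t x (v t)) (fun R => ?_) hx.ode hx'.ode
    (hx.initial.trans hx'.initial.symm)
  obtain ⟨L, hL⟩ := hI.lipschitz_field hp (max R Rv)
  refine ⟨L, fun t ht => LipschitzOnWith.of_dist_le_mul fun z hz z' hz' => ?_⟩
  rw [mem_closedBall_zero_iff] at hz hz'
  have hb := (hRv t ht).trans (le_max_right R Rv)
  have h := hL t ⟨ht₁.1.trans ht.1, ht.2⟩ z z' _ _ (hz.trans (le_max_left _ _))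
    (hz'.trans (le_max_left _ _)) hb hb
  rw [sub_self, norm_zero, max_eq_left (norm_nonneg _)] at h
  rwa [dist_eq_norm, dist_eq_norm]

set_option maxHeartbeats 1000000 in
/-- The controls follow a chattering control backwards in time from `T` to `t₁ + δ` and then correct
the remaining error by steering on `[t₁, t₁ + δ]`. -/
theorem RegularField.exists_control_family (ht₁ : t₁ ∈ Ioo t₀ T) (hI : RegularField ν f t₀ T)
    (hII : SurjectiveBlocks ν f t₀ T) (xs zs : State m (ν + 1))
    (hzs : ∀ (i : ℕ) (hi : i < ν),
      zs ⟨i, Nat.lt_succ_of_lt hi⟩ = f i t₁ (trunc (Nat.succ_le_succ hi) xs))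
    (hrank : ∀ (i : ℕ) (hi : i < ν),
      Module.finrank ℝ (LinearMap.range (fderiv ℝ
        (fun v : Block m (i + 1) =>
          f i t₁ (extend (trunc (r := i + 1) (Nat.le_succ_of_le hi) xs) v))
        (xs ⟨i + 1, Nat.succ_lt_succ hi⟩)).toLinearMap) = m i) {k : ℕ} (hk : k + 1 ≤ ν)
    {y : State m (k + 1) → ℝ → State m (k + 1)}
    (hy_C1 : ∀ i : Fin (k + 1), ContinuousC1Family t₁ T (fun ξ t => y ξ t i))
    (hy_ode : ∀ (ξ : State m (k + 1)) (i : ℕ) (hi : i + 2 ≤ k + 1), ∀ t ∈ Icc t₁ T,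
      HasDerivWithinAt (fun s => y ξ s ⟨i, by omega⟩) (f i t (trunc hi (y ξ t))) (Icc t₁ T) t)
    (hy_start : ∀ ξ, y ξ t₁ = trunc (by omega) xs) (hy_end : ∀ ξ, y ξ T = ξ)
    (hy_deriv : ∀ ξ, HasDerivWithinAt (fun s => y ξ s ⟨k, Nat.lt_succ_self k⟩)
      (zs ⟨k, by omega⟩) (Icc t₁ T) t₁) :
    ∃ vhat : State m (k + 1) × Block m (k + 1) → ℝ → Block m (k + 1),
      ContinuousC1Family t₁ T vhat ∧
      ∀ (ξ : State m (k + 1)) (β : Block m (k + 1)),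
        vhat (ξ, β) T = β ∧ vhat (ξ, β) t₁ = xs ⟨k + 1, by omega⟩ ∧
        HasDerivWithinAt (vhat (ξ, β)) (zs ⟨k + 1, by omega⟩) (Icc t₁ T) t₁ ∧
        (∃ x, IsTrajectory f (k + 1) t₁ T (trunc (by omega) xs) (vhat (ξ, β)) x) ∧
        ∀ x, IsTrajectory f (k + 1) t₁ T (trunc (by omega) xs) (vhat (ξ, β)) x → x T = ξ := by
  have hk' : k + 1 < ν + 1 := Nat.lt_succ_of_le hk
  have hT : t₁ < T := ht₁.2
  have ht₁' : t₁ ∈ Icc t₀ T := ⟨ht₁.1.le, hT.le⟩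
  have hsub : Icc t₁ T ⊆ Icc t₀ T := Icc_subset_Icc_left ht₁.1.le
  have hun : UniqueDiffOn ℝ (Icc t₁ T) := uniqueDiffOn_Icc hT
  obtain ⟨hy, W, hW, hd⟩ := exists_joint_derivative hT hy_C1
  have hdi := fun ξ t ht => hasDerivWithinAt_pi.1 (hd ξ t ht)
  have hode : ∀ ξ, ∀ t ∈ Icc t₁ T, ∀ (i : ℕ) (hi : i + 2 ≤ k + 1),
      W ξ t ⟨i, by omega⟩ = f i t (trunc hi (y ξ t)) := fun ξ t ht i hi =>
    (hun t ht).eq_deriv _ (hdi ξ t ht ⟨i, by omega⟩) (hy_ode ξ i hi t ht)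
  have hWlast : ∀ ξ, W ξ t₁ ⟨k, Nat.lt_succ_self k⟩ = f k t₁ (trunc (by omega) xs) := fun ξ => by
    rw [← hzs k hk]
    exact (hun t₁ ⟨le_rfl, hT.le⟩).eq_deriv _ (hdi ξ t₁ ⟨le_rfl, hT.le⟩ _) (hy_deriv ξ)
  -- The affine control with the prescribed value and velocity at `t₁`. It is used unmodified at the
  -- start, so both conditions there hold automatically.
  set v0 : ℝ → Block m (k + 1) := fun t => xs ⟨k + 1, hk'⟩ + (t - t₁) • zs ⟨k + 1, hk'⟩
    with hv0
  have hv0C : ContDiff ℝ 1 v0 := by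
    rw [hv0]
    fun_prop
  have hv0t : v0 t₁ = xs ⟨k + 1, hk'⟩ := by
    rw [hv0]
    beta_reduce
    rw [sub_self, zero_smul, add_zero]
  obtain ⟨QU, hQU, hQU0, hQU1, r, hr, hloc⟩ :=
    hI.exists_local_steering ht₁' xs hrank hk hv0C.continuous hv0t
  obtain ⟨δ, hδ, hδ'⟩ := exists_small_time hT (lt_min hr one_pos) hy
    (w := fun ξ t => W ξ t ⟨k, Nat.lt_succ_self k⟩)
    ((continuous_apply (⟨k, Nat.lt_succ_self k⟩ : Fin (k + 1))).comp_continuousOn hW) hy_start hWlast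
  have hδ0 : ∀ ξ, 0 < δ ξ := fun ξ => (hδ' ξ).1
  have hδr : ∀ ξ, δ ξ ≤ r := fun ξ => (hδ' ξ).2.1.trans (min_le_left _ _)
  have hδ1 : ∀ ξ, δ ξ ≤ 1 := fun ξ => (hδ' ξ).2.1.trans (min_le_right _ _)
  have hδT : ∀ ξ, t₁ + δ ξ < T := fun ξ => (hδ' ξ).2.2.1
  set ι : Block m k →L[ℝ] State m (k + 1) :=
    ContinuousLinearMap.single ℝ (fun i : Fin (k + 1) => Block m i) ⟨k, Nat.lt_succ_self k⟩
  obtain ⟨Uc, hUc, hUc0, hUcT, x₁, hx₁, hx₁'⟩ := exists_backward_control hT.le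
    (Φ := field f (k + 1)) ((hI.continuousOn_field hk).mono (prod_mono_left hsub))
    (fun R => by
      obtain ⟨L, hL⟩ := hI.lipschitz_field hk R
      refine ⟨L, fun t ht u hu => LipschitzOnWith.of_dist_le_mul fun z hz z' hz' => ?_⟩
      rw [mem_closedBall_zero_iff] at hz hz'
      have h := hL t (hsub ht) z z' u u hz hz' hu hu
      rw [sub_self, norm_zero, max_eq_left (norm_nonneg _)] at h
      rwa [dist_eq_norm, dist_eq_norm]) hy hW hd
    -- The defect of the last equation along `y ξ`. The other components have no defect, so `ι`
    -- embeds the last block, and surjectivity of `f k` is unaffected by subtracting the velocity.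
    (φ := fun ξ t v => f k t (extend (y ξ t) v) - W ξ t ⟨k, Nat.lt_succ_self k⟩)
    (by
      have hmaps : MapsTo (fun q : State m (k + 1) × ℝ × Block m (k + 1) => (q.1, q.2.1))
          (univ ×ˢ Icc t₁ T ×ˢ univ) (univ ×ˢ Icc t₁ T) := fun q hq => ⟨mem_univ _, hq.2.1⟩
      have h1 := hy.comp (by fun_prop) hmaps
      have h2 := (hI.continuousOn_component hk).comp
        (f := fun q : State m (k + 1) × ℝ × Block m (k + 1) =>
          (q.2.1, extend (y q.1 q.2.1) q.2.2))
        (ContinuousOn.prodMk (by fun_prop) (continuous_extend.comp_continuousOn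
          (h1.prodMk (by fun_prop)))) fun q hq => ⟨hsub hq.2.1, mem_univ _⟩
      exact h2.sub ((continuous_apply (⟨k, Nat.lt_succ_self k⟩ : Fin (k + 1))).comp_continuousOn
        (hW.comp (by fun_prop) hmaps)))
    (fun ξ t ht b => by
      obtain ⟨v, hv⟩ := (hII k hk t (hsub ht) (y ξ t)).2 (b + W ξ t ⟨k, Nat.lt_succ_self k⟩)
      exact ⟨v, sub_eq_of_eq_add hv⟩)
    (ι := ι)
    (fun e => (pi_norm_le_iff_of_nonneg (norm_nonneg _)).2 fun i => by
      by_cases hi : i = ⟨k, Nat.lt_succ_self k⟩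
      · subst hi
        simp [ι]
      · simp [ι, hi])
    (fun ξ t ht u => by
      funext ⟨i, hi⟩
      rcases Nat.lt_or_ge i k with h | h
      · have h1 := field_of_lt (f := f) t (y ξ t) u (i := i) (by omega)
        have h2 := hode ξ t ht i (by omega)
        have h3 : (⟨i, hi⟩ : Fin (k + 1)) ≠ ⟨k, Nat.lt_succ_self k⟩ := fun h' => by
          have := Fin.mk.inj h'
          omega
        refine (sub_eq_zero.2 (h1.trans h2.symm)).trans ?_
        simp [ι, h3]
      · obtain rfl : i = k := by omega
        simp only [ι, ContinuousLinearMap.single_apply, Pi.single_eq_same, Pi.sub_apply]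
        rfl)
    -- Undoing the dilation may enlarge the error by `δ⁻¹ ^ (k + 1)`, the power at block `0`. This
    -- accuracy keeps the rescaled target `η` below `r`.
    hv0C hδ hδ0 hδT (ε := fun ξ => δ ξ ^ (k + 1) * r) (by fun_prop)
    (fun ξ => mul_pos (pow_pos (hδ0 ξ) _) hr)
  set η : State m (k + 1) × Block m (k + 1) → State m (k + 1) := fun q i =>
    (δ q.1 ^ (k + 1 - i))⁻¹ • (x₁ q - y q.1 (t₁ + δ q.1)) i with hη
  have hηc : Continuous η := by
    have h1 : Continuous fun q : State m (k + 1) × Block m (k + 1) => y q.1 (t₁ + δ q.1) :=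
      hy.comp_continuous (f := fun q : State m (k + 1) × Block m (k + 1) => (q.1, t₁ + δ q.1))
        (by fun_prop) fun q => ⟨mem_univ _, by linarith [hδ0 q.1], (hδT q.1).le⟩
    refine continuous_pi fun i => Continuous.smul (Continuous.inv₀ (by fun_prop)
      fun q => (pow_pos (hδ0 q.1) _).ne') ((continuous_apply i).comp (hx₁.sub h1))
  have hηr : ∀ q, ‖η q‖ ≤ r := by
    intro q
    have hp := hδ0 q.1
    refine (pi_norm_le_iff_of_nonneg hr.le).2 fun i => ?_
    rw [hη]
    beta_reduce
    rw [norm_smul, norm_inv, Real.norm_of_nonneg (by positivity),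
      inv_mul_le_iff₀ (by positivity)]
    refine (norm_le_pi_norm (x₁ q - y q.1 (t₁ + δ q.1)) i).trans ((hx₁' q).1.trans ?_)
    exact mul_le_mul_of_nonneg_right (pow_le_pow_of_le_one hp.le (hδ1 q.1) (by omega)) hr.le
  obtain ⟨c, hc, hcx⟩ := hloc (P := State m (k + 1) × Block m (k + 1))
    (y := fun q => y q.1) (W := fun q => W q.1)
    (hy.comp (f := fun q : (State m (k + 1) × Block m (k + 1)) × ℝ => (q.1.1, q.2)) (by fun_prop)
      fun q hq => ⟨mem_univ _, hq.2⟩)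
    (hW.comp (f := fun q : (State m (k + 1) × Block m (k + 1)) × ℝ => (q.1.1, q.2)) (by fun_prop)
      fun q hq => ⟨mem_univ _, hq.2⟩)
    (fun q => hd q.1) (fun q => hode q.1) (fun q => hy_start q.1) (δ := fun q => δ q.1)
    (hδ.comp continuous_fst) (fun q => hδ0 q.1) (fun q => hδr q.1) (fun q => (hδT q.1).le)
    (fun q t ht => by
      have h := (hδ' q.1).2.2.2 t ht
      rw [dist_eq_norm, dist_eq_norm] at h
      exact ⟨h.1.trans (min_le_left _ _), h.2.trans (min_le_left _ _)⟩) hηc hηr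
  -- The two terms do not interfere: up to `t₁ + δ` the first is `v0`, and from there on the second
  -- is `0`. The sum is jointly `C¹` because both terms are, so no matching at `t₁ + δ` is required.
  set vhat : State m (k + 1) × Block m (k + 1) → ℝ → Block m (k + 1) := fun q t =>
    Uc q t + QU ((t - t₁) / δ q.1) (c q) with hvhat
  have hvC : JointC1 vhat := by
    have h1 : JointC1 fun (_ : Unit) t => QU t := JointC1.of_contDiff hQU
    have h2 := h1.comp_affine (π := fun _ : State m (k + 1) × Block m (k + 1) => ())
      continuous_const (α := fun q => 1 / δ q.1) (β := fun q => -t₁ / δ q.1)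
      (continuous_const.div (by fun_prop) fun q => (hδ0 q.1).ne')
      (continuous_const.div (by fun_prop) fun q => (hδ0 q.1).ne')
    convert! hUc.add (h2.clm_apply hc) using 3 with q t
    rw [hvhat]
    beta_reduce
    congr 3
    ring
  have hv1 : ∀ q, ∀ t ≤ t₁ + δ q.1, vhat q t = v0 t + QU ((t - t₁) / δ q.1) (c q) :=
    fun q t ht => by
      rw [hvhat]
      beta_reduce
      rw [hUc0 q t ht]
  have hv2 : ∀ q, ∀ t, t₁ + δ q.1 ≤ t → vhat q t = Uc q t := fun q t ht => by
    rw [hvhat]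
    beta_reduce
    rw [hQU1 _ ((one_le_div (hδ0 q.1)).2 (by linarith)), zero_apply, add_zero]
  have hv3 : ∀ q, ∀ t < t₁ + δ q.1 / 3, vhat q t = v0 t := fun q t ht => by
    have h := hδ0 q.1
    rw [hv1 q t (by linarith), hQU0 _ ((div_lt_iff₀ h).2 (by linarith)),
      zero_apply, add_zero]
  refine ⟨vhat, hvC.continuousC1Family hT, fun ξ β => ⟨?_, ?_, ?_, ?_⟩⟩
  · rw [hv2 _ _ (hδT ξ).le, hUcT]
  · rw [hv3 _ _ (by linarith [hδ0 ξ]), hv0t]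
  · have h1 : HasDerivAt v0 (zs ⟨k + 1, hk'⟩) t₁ := by
      have h2 := (((hasDerivAt_id t₁).sub_const t₁).smul_const
        (zs ⟨k + 1, hk'⟩)).const_add (xs ⟨k + 1, hk'⟩)
      rw [one_smul] at h2
      exact h2
    refine (h1.congr_of_eventuallyEq ?_).hasDerivWithinAt
    filter_upwards [Iio_mem_nhds (show t₁ < t₁ + δ ξ / 3 by linarith [hδ0 ξ])] with t ht
    exact hv3 (ξ, β) t ht
  · obtain ⟨-, x₂, hx₂a, hx₂T, hx₂⟩ := hx₁' (ξ, β)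
    obtain ⟨x₀, hx₀a, hx₀δ, hx₀⟩ := hcx (ξ, β)
    obtain ⟨x, hxa, hxT, hx⟩ := exists_glued_solution
      (F := fun t x => field f (k + 1) t x (vhat (ξ, β) t)) (a := t₁) (c := t₁ + δ ξ)
      (x₁ := x₀) (x₂ := x₂)
      (by linarith [hδ0 ξ]) (hδT ξ)
      (by
        rw [hx₂a, hx₀δ]
        refine (congrArg (y ξ (t₁ + δ ξ) + ·) (dilate_inverse (hδ0 ξ).ne' _)).trans ?_
        exact add_sub_cancel _ _)
      (fun t ht => by
        rw [hv1 _ _ ht.2]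
        exact hx₀ t ht)
      (fun t ht => by
        rw [hv2 _ _ ht.1]
        exact hx₂ t ht)
    have htraj : IsTrajectory f (k + 1) t₁ T (trunc (by omega) xs) (vhat (ξ, β)) x :=
      ⟨hxa.trans hx₀a, hx⟩
    refine ⟨⟨x, htraj⟩, fun x' hx' => ?_⟩
    have hvc : ContinuousOn (vhat (ξ, β)) (Icc t₁ T) :=
      (hvC.differentiable (ξ, β)).continuous.continuousOn
    -- Every trajectory with this control coincides with the glued one, whose backward piece ends at
    -- `y ξ T = ξ`.
    rw [hI.trajectory_unique ht₁' hk hvc hx' htraj ⟨hT.le, le_rfl⟩, hxT, hx₂T]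
    exact hy_end ξ

end Assembly

end TriangularControl

theorem theorem2p2
    -- block dimensions and components of the triangular right-hand side
    (ν : ℕ) (m : ℕ → ℕ) (hm : ∀ i < ν, m i ≤ m (i + 1))
    (f : (i : ℕ) → ℝ → TriangularControl.State m (i + 2) → TriangularControl.Block m i)
    (t₀ t₁ T : ℝ) (ht₁ : t₁ ∈ Ioo t₀ T)
    (hI : TriangularControl.RegularField ν f t₀ T)
    (hII : TriangularControl.SurjectiveBlocks ν f t₀ T)
    -- reference point `x*₁, …, x*_{ν+1} = u*` and reference velocities `z*₁, …, z*_{ν+1}`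
    (xs zs : TriangularControl.State m (ν + 1))
    (hzs : ∀ (i : ℕ) (hi : i < ν),
      zs ⟨i, by omega⟩ = f i t₁ (TriangularControl.trunc (by omega) xs))
    (hrank : ∀ (i : ℕ) (hi : i < ν),
      Module.finrank ℝ (LinearMap.range (fderiv ℝ
        (fun v : TriangularControl.Block m (i + 1) => f i t₁
          (TriangularControl.extend (TriangularControl.trunc (r := i + 1) (by omega) xs) v))
        (xs ⟨i + 1, by omega⟩)).toLinearMap) = m i)
    -- number of blocks of the truncated system
    (p : ℕ) (hp : 1 ≤ p) (hpν : p ≤ ν)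
    -- the given family of trajectories
    (y : TriangularControl.State m p → ℝ → TriangularControl.State m p)
    (hy_C1 : ∀ i : Fin p, TriangularControl.ContinuousC1Family t₁ T (fun ξ t => y ξ t i))
    (hy_ode : ∀ (ξ : TriangularControl.State m p) (i : ℕ) (hi : i + 2 ≤ p), ∀ t ∈ Icc t₁ T,
      HasDerivWithinAt (fun s => y ξ s ⟨i, by omega⟩)
        (f i t (TriangularControl.trunc hi (y ξ t))) (Icc t₁ T) t)
    (hy_start : ∀ ξ, y ξ t₁ = TriangularControl.trunc (by omega) xs)
    (hy_end : ∀ ξ, y ξ T = ξ)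
    (hy_deriv : ∀ ξ, HasDerivWithinAt (fun s => y ξ s ⟨p - 1, by omega⟩)
      (zs ⟨p - 1, by omega⟩) (Icc t₁ T) t₁) :
    ∃ vhat : TriangularControl.State m p × TriangularControl.Block m p →
        ℝ → TriangularControl.Block m p,
      TriangularControl.ContinuousC1Family t₁ T vhat ∧
      ∀ (ξ : TriangularControl.State m p) (β : TriangularControl.Block m p),
        vhat (ξ, β) T = β ∧
        vhat (ξ, β) t₁ = xs ⟨p, by omega⟩ ∧
        HasDerivWithinAt (vhat (ξ, β)) (zs ⟨p, by omega⟩) (Icc t₁ T) t₁ ∧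
        (∃ x : ℝ → TriangularControl.State m p,
          TriangularControl.IsTrajectory f p t₁ T
            (TriangularControl.trunc (by omega) xs) (vhat (ξ, β)) x) ∧
        (∀ x : ℝ → TriangularControl.State m p,
          TriangularControl.IsTrajectory f p t₁ T
            (TriangularControl.trunc (by omega) xs) (vhat (ξ, β)) x → x T = ξ) := by
  obtain ⟨k, rfl⟩ : ∃ k, p = k + 1 := ⟨p - 1, by omega⟩
  exact hI.exists_control_family ht₁ hII xs zs hzs hrank hpν hy_C1 hy_ode hy_start hy_end hy_deriv
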